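/- **Setting.** A bounded domain is a nonempty connected bounded open subset of $\mathbb C^n$. $L^2(D)$ and all integrals are with respect to Lebesgue measure; $A^2(D)\subseteq L^2(D)$ is the closed subspace of (classes of) square-integrable holomorphic functions on $D$, and the Bergman projection $P_D$ is the orthogonal projector of $L^2(D)$ onto $A^2(D)$. $J(\psi)$ denotes the determinant of the complex Jacobian matrix of a holomorphic map $\psi$. A *ramified covering* $\pi:E\dashrightarrow D$ of a bounded domain $D\subseteq\mathbb C^n$ consists of a bounded domain $E\subseteq\mathbb C^n$, proper complex analytic subsets $V\subsetneq E$ and $W\subsetneq D$, and a finite-sheeted holomorphic (surjective) covering map $\pi:E\setminus V\to D\setminus W$. Its *covering group* $G$ is the group of all biholomorphic maps $g:E\setminus V\to E\setminus V$ with $\pi\circ g=\pi$. The covering is *normal* if for all $z_1,z_2\in E\setminus V$ one has $\pi(z_1)=\pi(z_2)$ if and only if $g(z_1)=z_2$ for some $g\in G$. **Proposition 1.3.** Let $\pi:E\dashrightarrow D$ be a ramified covering. The map $\pi^*u:=J(\pi)\cdot(u\circ\pi)$ (defined on $E\setminus V$, that is, almost everywhere on $E$) is well defined on almost-everywhere classes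 and maps $L^2(D)$ into $L^2(E)$. Put $\pi^*(L^2(D))=\{J(\pi)\cdot(u\circ\pi)\colon u\in L^2(D)\}\subseteq L^2(E)$. (i) For every $p\in[1,+\infty)$ and every $C>0$, with $\sigma:=|J(\pi)|^{2-p}$, the estimate $$\int_D|P_Du|^p\le C\int_D|u|^p\qquad\text{for all }u\in L^2(D)\cap L^p(D)$$ holds if and only if $$\int_E|P_Ev|^p\,\sigma\le C\int_E|v|^p\,\sigma\qquad\text{for all }v\in\pi^*(L^2(D))\cap L^p(E,\sigma)$$ holds, where $L^p(E,\sigma)$ is the $L^p$ space of the measure with density $\sigma$ on $E$. (ii) If moreover $\pi$ is normal with covering group $G$, then $$\pi^*(L^2(D))=\{v\in L^2(E)\colon J(g)\cdot(v\circ g)=v\ \text{ almost everywhere on } E, \text{ for all } g\in G\}.$$ -/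

import Mathlib

open MeasureTheory Set Filter Topology
open scoped ENNReal

/-- Sub-mean value property of holomorphic functions on closed polydiscs (balls of the sup norm). -/
theorem enorm_mul_volume_closedBall_le {n : ℕ} {U : Set (Fin n → ℂ)} (hU : IsOpen U)
    {F : (Fin n → ℂ) → ℂ} (hF : DifferentiableOn ℂ F U) {z : Fin n → ℂ} {r : ℝ}
    (hr : Metric.closedBall z r ⊆ U) :
    ‖F z‖ₑ * volume (Metric.closedBall z r) ≤ ∫⁻ w in Metric.closedBall z r, ‖F w‖ₑ := by
  set B := Metric.closedBall z r with hB
  set G : (Fin n → ℂ) → ℝ≥0∞ := B.indicator fun w => ‖F w‖ₑ with hG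
  have hBm : MeasurableSet B := Metric.isClosed_closedBall.measurableSet
  have hGm : Measurable G := by
    have h1 : Measurable (B.indicator F) := by
      classical
      rw [← piecewise_eq_indicator]
      exact (hF.continuousOn.mono hr).measurable_piecewise continuous_zero.continuousOn hBm
    have h2 : G = fun w => ‖B.indicator F w‖ₑ := by
      ext w; simp [hG, enorm_indicator_eq_indicator_enorm]
    rw [h2]; exact h1.enorm
  have hrot : ∀ θ : ℝ, ∫⁻ v, G (z + circleMap 0 1 θ • v) = ∫⁻ v, G v := by
    intro θ
    have hmp : MeasurePreserving (fun v : Fin n → ℂ => circleMap 0 1 θ • v) := by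
      have := volume_preserving_pi (α' := fun _ : Fin n => ℂ) (β' := fun _ : Fin n => ℂ)
        (f := fun _ x => rotation (Circle.exp θ) x)
        (fun _ => (rotation (Circle.exp θ)).measurePreserving)
      convert this using 2 with v
      ext i
      simp [circleMap, rotation_apply]
    have := (measurePreserving_add_left (volume : Measure (Fin n → ℂ)) z).comp hmp
    exact this.lintegral_comp hGm
  have hpt : ∀ v ∈ Metric.closedBall (0 : Fin n → ℂ) r,
      ‖F z‖ₑ * ENNReal.ofReal (2 * Real.pi) ≤
        ∫⁻ θ in Ioc 0 (2 * Real.pi), G (z + circleMap 0 1 θ • v) := by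
    intro v hv
    have hmem : ∀ t : ℂ, ‖t‖ ≤ 1 → z + t • v ∈ B := by
      intro t ht
      simp only [hB, Metric.mem_closedBall, dist_self_add_left, norm_smul]
      have : ‖v‖ ≤ r := by simpa using hv
      nlinarith [norm_nonneg v, norm_nonneg t]
    have hd : ∀ t ∈ Metric.closedBall (0 : ℂ) 1, DifferentiableAt ℂ (fun t : ℂ => F (z + t • v)) t := by
      intro t ht
      have h1 : DifferentiableAt ℂ F (z + t • v) :=
        (hF _ (hr (hmem t (by simpa using ht)))).differentiableAt
          (hU.mem_nhds (hr (hmem t (by simpa using ht))))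
      exact h1.comp t (by fun_prop)
    have hav : Real.circleAverage (fun t : ℂ => F (z + t • v)) 0 1 = F z := by
      have := circleAverage_of_differentiable_on_off_countable (c := 0) (R := 1)
        (f := fun t : ℂ => F (z + t • v)) (s := ∅) countable_empty
        (fun t ht => (hd t (by simpa using ht)).continuousAt.continuousWithinAt)
        (fun t ht => hd t (by
          have := Metric.ball_subset_closedBall ht.1
          simpa using this))
      simpa using this
    rw [Real.circleAverage_def] at hav
    have hpi : (0 : ℝ) < 2 * Real.pi := by positivity
    have h2 : ∫ θ in Ioc 0 (2 * Real.pi), F (z + circleMap 0 1 θ • v) = (2 * Real.pi) • F z := by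
      rw [← hav, smul_smul, mul_inv_cancel₀ hpi.ne', one_smul,
        intervalIntegral.integral_of_le hpi.le]
    calc ‖F z‖ₑ * ENNReal.ofReal (2 * Real.pi) = ‖(2 * Real.pi) • F z‖ₑ := by
          rw [enorm_smul, mul_comm, Real.enorm_of_nonneg hpi.le]
      _ ≤ ∫⁻ θ in Ioc 0 (2 * Real.pi), ‖F (z + circleMap 0 1 θ • v)‖ₑ := by
          rw [← h2]; exact enorm_integral_le_lintegral_enorm _
      _ = ∫⁻ θ in Ioc 0 (2 * Real.pi), G (z + circleMap 0 1 θ • v) := by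
          refine lintegral_congr fun θ => ?_
          rw [hG, indicator_of_mem (hmem _ (by simp))]
  have hfin : ENNReal.ofReal (2 * Real.pi) ≠ ⊤ := ENNReal.ofReal_ne_top
  have hne : ENNReal.ofReal (2 * Real.pi) ≠ 0 := by
    simp [Real.pi_pos]
  have hvol : volume B = volume (Metric.closedBall (0 : Fin n → ℂ) r) := by
    rw [hB, Measure.addHaar_closedBall_center]
  have key : ‖F z‖ₑ * volume B * ENNReal.ofReal (2 * Real.pi) ≤
      (∫⁻ w, G w) * ENNReal.ofReal (2 * Real.pi) := by
    calc ‖F z‖ₑ * volume B * ENNReal.ofReal (2 * Real.pi)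
        = ∫⁻ _ in Metric.closedBall (0 : Fin n → ℂ) r,
            ‖F z‖ₑ * ENNReal.ofReal (2 * Real.pi) := by
          rw [setLIntegral_const, hvol]; ring
      _ ≤ ∫⁻ v in Metric.closedBall (0 : Fin n → ℂ) r,
            ∫⁻ θ in Ioc 0 (2 * Real.pi), G (z + circleMap 0 1 θ • v) :=
          setLIntegral_mono' Metric.isClosed_closedBall.measurableSet hpt
      _ ≤ ∫⁻ v, ∫⁻ θ in Ioc 0 (2 * Real.pi), G (z + circleMap 0 1 θ • v) :=
          setLIntegral_le_lintegral _ _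
      _ = ∫⁻ θ in Ioc 0 (2 * Real.pi), ∫⁻ v, G (z + circleMap 0 1 θ • v) := by
          refine lintegral_lintegral_swap ?_
          refine (hGm.comp ?_).aemeasurable
          have : Continuous fun p : (Fin n → ℂ) × ℝ => z + circleMap 0 1 p.2 • p.1 := by
            fun_prop
          exact this.measurable
      _ = (∫⁻ w, G w) * ENNReal.ofReal (2 * Real.pi) := by
          simp_rw [hrot]
          rw [setLIntegral_const]; simp
  have := (ENNReal.mul_le_mul_iff_left hne hfin).1 key
  rwa [hG, lintegral_indicator hBm] at this

/-- Pointwise values of an `L²` holomorphic function are controlled by its `L²` norm. -/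
theorem norm_sq_mul_volume_closedBall_le {n : ℕ} {D : Set (Fin n → ℂ)} (hD : IsOpen D)
    {F : (Fin n → ℂ) → ℂ} (hF : DifferentiableOn ℂ F D)
    (f : Lp ℂ 2 (volume.restrict D)) (hfF : f =ᵐ[volume.restrict D] F)
    {z : Fin n → ℂ} {r : ℝ} (hr : Metric.closedBall z r ⊆ D) :
    ‖F z‖ ^ 2 * (volume (Metric.closedBall z r)).toReal ≤ ‖f‖ ^ 2 := by
  have h1 := enorm_mul_volume_closedBall_le hD (hF.pow 2) hr
  have h2 : ∫⁻ w in Metric.closedBall z r, ‖(F ^ 2) w‖ₑ ≤ ‖f‖ₑ ^ 2 := by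
    calc ∫⁻ w in Metric.closedBall z r, ‖(F ^ 2) w‖ₑ
        ≤ ∫⁻ w in D, ‖(F ^ 2) w‖ₑ := lintegral_mono_set hr
      _ = ∫⁻ w in D, ‖f w‖ₑ ^ 2 := by
          refine lintegral_congr_ae ?_
          filter_upwards [hfF] with w hw
          rw [hw, Pi.pow_apply, enorm_pow]
      _ = ‖f‖ₑ ^ 2 := by
          rw [Lp.enorm_def, eLpNorm_eq_lintegral_rpow_enorm_toReal (by norm_num) (by norm_num),
            ← ENNReal.rpow_natCast, ← ENNReal.rpow_mul]
          simp
  have h3 := h1.trans h2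
  have h4 := ENNReal.toReal_mono (by simp) h3
  simpa [ENNReal.toReal_mul, ENNReal.toReal_pow, enorm_pow] using h4

/-- The Bergman space `A²(D) = L²(D) ∩ 𝒪(D)`: the classes in `L²(D)` that have a representative
which is holomorphic on `D`. -/
def bergmanSpace {n : ℕ} (D : Set (Fin n → ℂ)) :
    Submodule ℂ (Lp ℂ 2 (volume.restrict D)) where
  carrier := {f | ∃ F : (Fin n → ℂ) → ℂ, DifferentiableOn ℂ F D ∧ f =ᵐ[volume.restrict D] F}
  zero_mem' := ⟨0, differentiableOn_const 0, Lp.coeFn_zero _ _ _⟩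
  add_mem' := by
    rintro f g ⟨F, hF, hfF⟩ ⟨G, hG, hgG⟩
    exact ⟨F + G, hF.add hG, (Lp.coeFn_add f g).trans (hfF.add hgG)⟩
  smul_mem' := by
    rintro c f ⟨F, hF, hfF⟩
    exact ⟨c • F, hF.const_smul c, (Lp.coeFn_smul c f).trans (hfF.const_smul c)⟩

/-- `A²(D)` is a closed subspace of `L²(D)`. -/
theorem isClosed_bergmanSpace {n : ℕ} {D : Set (Fin n → ℂ)} (hD : IsOpen D) :
    IsClosed (bergmanSpace D : Set (Lp ℂ 2 (volume.restrict D))) := by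
  refine IsSeqClosed.isClosed fun f f₀ hf hlim => ?_
  choose F hF hfF using hf
  -- pointwise bounds for differences on compact balls
  have hdiff : ∀ k m, ((f k - f m : Lp ℂ 2 (volume.restrict D)) : (Fin n → ℂ) → ℂ)
      =ᵐ[volume.restrict D] (F k - F m) := fun k m =>
    (Lp.coeFn_sub _ _).trans ((hfF k).sub (hfF m))
  have hcau : CauchySeq f := hlim.cauchySeq
  have hbound : ∀ r : ℝ, 0 < r → ∃ K : ℝ, 0 < K ∧ ∀ z, Metric.closedBall z r ⊆ D → ∀ k m,
      ‖F k z - F m z‖ ≤ K * ‖f k - f m‖ := by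
    intro r hr
    have hv : 0 < (volume (Metric.closedBall (0 : Fin n → ℂ) r)).toReal :=
      ENNReal.toReal_pos (Metric.measure_closedBall_pos _ _ hr).ne'
        measure_closedBall_lt_top.ne
    refine ⟨(Real.sqrt (volume (Metric.closedBall (0 : Fin n → ℂ) r)).toReal)⁻¹, by positivity,
      fun z hz k m => ?_⟩
    have h := norm_sq_mul_volume_closedBall_le hD ((hF k).sub (hF m)) _ (hdiff k m) hz
    rw [Measure.addHaar_closedBall_center] at h
    have h' := Real.sqrt_le_sqrt h
    rw [Real.sqrt_mul (by positivity), Real.sqrt_sq (norm_nonneg _),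
      Real.sqrt_sq (norm_nonneg _)] at h'
    rw [inv_mul_eq_div, le_div_iff₀ (by positivity)]
    exact h'
  have hpc : ∀ z ∈ D, ∃ l, Tendsto (fun k => F k z) atTop (𝓝 l) := by
    intro z hz
    obtain ⟨r, hr, hrD⟩ := Metric.nhds_basis_closedBall.mem_iff.1 (hD.mem_nhds hz)
    obtain ⟨K, hK, hb⟩ := hbound r hr
    refine cauchySeq_tendsto_of_complete (Metric.cauchySeq_iff.2 fun ε hε => ?_)
    obtain ⟨N, hN⟩ := Metric.cauchySeq_iff.1 hcau (ε / K) (by positivity)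
    refine ⟨N, fun k hk m hm => ?_⟩
    have := hN k hk m hm
    rw [dist_eq_norm, lt_div_iff₀ hK] at this
    rw [dist_eq_norm]
    linarith [hb z hrD k m]
  choose! F₀ hF₀ using hpc
  refine ⟨F₀, fun z hz => ?_, ?_⟩
  · -- holomorphy of the limit
    obtain ⟨R, hR, hRD⟩ := Metric.nhds_basis_closedBall.mem_iff.1 (hD.mem_nhds hz)
    set r := R / 3 with hr
    have hr0 : 0 < r := by positivity
    obtain ⟨K, hK, hb⟩ := hbound r hr0
    have hsub : ∀ w ∈ Metric.ball z r, Metric.ball w r ⊆ D ∧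
        ∀ y ∈ Metric.ball w r, Metric.closedBall y r ⊆ D := by
      intro w hw
      have h2 : ∀ y ∈ Metric.ball w r, Metric.closedBall y r ⊆ D := by
        intro y hy x hx
        apply hRD
        rw [Metric.mem_closedBall] at hx ⊢
        rw [Metric.mem_ball] at hy hw
        linarith [dist_triangle4 x y w z]
      exact ⟨fun y hy => h2 y hy (Metric.mem_closedBall_self hr0.le), h2⟩
    have hderiv : ∀ k m, ∀ w ∈ Metric.ball z r,
        ‖fderiv ℂ (F k) w - fderiv ℂ (F m) w‖ ≤ 2 * K / r * ‖f k - f m‖ := by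
      intro k m w hw
      obtain ⟨h1, h2⟩ := hsub w hw
      have hwD : w ∈ D := h1 (Metric.mem_ball_self hr0)
      have hd := Complex.norm_fderiv_le_div_of_mapsTo_ball (f := F k - F m) (c := w) (R₁ := r)
        (R₂ := 2 * (K * ‖f k - f m‖)) (((hF k).sub (hF m)).mono h1) (fun y hy => by
          rw [Metric.mem_closedBall, dist_eq_norm]
          have e1 := hb y (h2 y hy) k m
          have e2 := hb w (h2 w (Metric.mem_ball_self hr0)) k m
          calc ‖(F k - F m) y - (F k - F m) w‖ ≤ ‖(F k - F m) y‖ + ‖(F k - F m) w‖ :=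
                norm_sub_le _ _
            _ ≤ 2 * (K * ‖f k - f m‖) := by
                simp only [Pi.sub_apply]; linarith) hr0
      rw [fderiv_sub ((hF k w hwD).differentiableAt (hD.mem_nhds hwD))
        ((hF m w hwD).differentiableAt (hD.mem_nhds hwD))] at hd
      refine hd.trans_eq ?_
      ring
    have hucs : UniformCauchySeqOn (fun k => fderiv ℂ (F k)) atTop (Metric.ball z r) := by
      refine Metric.uniformCauchySeqOn_iff.2 fun ε hε => ?_
      obtain ⟨N, hN⟩ := Metric.cauchySeq_iff.1 hcau (ε / (2 * K / r)) (by positivity)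
      refine ⟨N, fun k hk m hm w hw => ?_⟩
      have := hN k hk m hm
      rw [dist_eq_norm, lt_div_iff₀ (by positivity)] at this
      rw [dist_eq_norm]
      linarith [hderiv k m w hw]
    have hlimd : ∀ w ∈ Metric.ball z r, ∃ l, Tendsto (fun k => fderiv ℂ (F k) w) atTop (𝓝 l) :=
      fun w hw => cauchySeq_tendsto_of_complete (hucs.cauchySeq hw)
    choose! g' hg' using hlimd
    have hD' : ∀ w ∈ Metric.ball z r, w ∈ D := fun w hw =>
      (hsub w hw).1 (Metric.mem_ball_self hr0)
    have := hasFDerivAt_of_tendstoUniformlyOn (𝕜 := ℂ) (f := F) (g := F₀) (g' := g')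
      (f' := fun k => fderiv ℂ (F k)) Metric.isOpen_ball
      (hucs.tendstoUniformlyOn_of_tendsto hg')
      (fun k w hw => ((hF k w (hD' w hw)).differentiableAt (hD.mem_nhds (hD' w hw))).hasFDerivAt)
      (fun w hw => hF₀ w (hD' w hw)) (Metric.mem_ball_self hr0)
    exact this.differentiableAt.differentiableWithinAt
  · -- the pointwise limit represents the limit in the mean
    obtain ⟨ns, hns, hae⟩ := (tendstoInMeasure_of_tendsto_Lp hlim).exists_seq_tendsto_ae
    filter_upwards [hae, ae_all_iff.2 hfF, ae_restrict_mem hD.measurableSet] with w h1 h2 h3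
    refine tendsto_nhds_unique h1 ?_
    simp_rw [h2]
    exact (hF₀ w h3).comp hns.tendsto_atTop

/-- The Bergman projection `P_D`: the orthogonal projector of `L²(D)` onto `A²(D)`, regarded as an
operator from `L²(D)` to itself. -/
noncomputable def bergmanProjection {n : ℕ} (D : Set (Fin n → ℂ)) (hD : IsOpen D) :
    Lp ℂ 2 (volume.restrict D) →L[ℂ] Lp ℂ 2 (volume.restrict D) :=
  haveI : CompleteSpace (bergmanSpace D) := (isClosed_bergmanSpace hD).completeSpace_coe
  (bergmanSpace D).starProjection

/-- A bounded domain of `ℂⁿ`: a nonempty connected bounded open set. -/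
structure IsBoundedDomain {n : ℕ} (D : Set (Fin n → ℂ)) : Prop where
  isOpen : IsOpen D
  isConnected : IsConnected D
  isBounded : Bornology.IsBounded D

/-- `A` is a complex analytic subset of the open set `D`: every point of `D` (not only of `A`) has
an open neighbourhood in `D` on which `A` is the common zero set of finitely many holomorphic
functions. -/
def IsAnalyticSubset {n : ℕ} (D A : Set (Fin n → ℂ)) : Prop :=
  A ⊆ D ∧ ∀ z ∈ D, ∃ U : Set (Fin n → ℂ), IsOpen U ∧ z ∈ U ∧ U ⊆ D ∧
    ∃ (k : ℕ) (f : Fin k → (Fin n → ℂ) → ℂ), (∀ i, DifferentiableOn ℂ (f i) U) ∧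
      A ∩ U = {w | w ∈ U ∧ ∀ i, f i w = 0}

/-- A ramified covering `π : E ⇢ D` of bounded domains of `ℂⁿ`: proper analytic subsets `V ⊂ E` and
`W ⊂ D`, and a finite-sheeted holomorphic covering map `π : E ∖ V → D ∖ W`. The function `π` is a
total function, but only its values on `E ∖ V` matter. -/
structure IsRamifiedCovering {n : ℕ} (E V D W : Set (Fin n → ℂ))
    (π : (Fin n → ℂ) → (Fin n → ℂ)) : Prop where
  domain_source : IsBoundedDomain E
  domain_target : IsBoundedDomain D
  analytic_source : IsAnalyticSubset E V
  proper_source : V ≠ E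
  analytic_target : IsAnalyticSubset D W
  proper_target : W ≠ D
  mapsTo : MapsTo π (E \ V) (D \ W)
  holomorphic : DifferentiableOn ℂ π (E \ V)
  isCoveringMap : IsCoveringMap (mapsTo.restrict π (E \ V) (D \ W))
  surjOn : SurjOn π (E \ V) (D \ W)
  finite_fibers : ∀ z ∈ D \ W, {w | w ∈ E \ V ∧ π w = z}.Finite

/-- The complex Jacobian determinant `J(ψ)(z)`. -/
noncomputable def jacobian {n : ℕ} (ψ : (Fin n → ℂ) → (Fin n → ℂ)) (z : Fin n → ℂ) : ℂ :=
  (fderiv ℂ ψ z).det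

/-- The pull-back `ψ^* u = J(ψ) · (u ∘ ψ)`. -/
noncomputable def pullback {n : ℕ} (ψ : (Fin n → ℂ) → (Fin n → ℂ)) (u : (Fin n → ℂ) → ℂ) :
    (Fin n → ℂ) → ℂ :=
  fun z => jacobian ψ z * u (ψ z)

/-- The subset `π^*(L²(D)) = {J(π) · (u ∘ π) : u ∈ L²(D)}` of `L²(E)`. For a ramified covering the
equality almost everywhere on `E` is an equality almost everywhere on `E ∖ V`. -/
def pullbackL2 {n : ℕ} (E D : Set (Fin n → ℂ)) (π : (Fin n → ℂ) → (Fin n → ℂ)) :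
    Set (Lp ℂ 2 (volume.restrict E)) :=
  {v | ∃ u : (Fin n → ℂ) → ℂ, MemLp u 2 (volume.restrict D) ∧
    v =ᵐ[volume.restrict E] pullback π u}

/-- The weight `σ = |J(π)|^(2 - p)`. -/
noncomputable def jacobianWeight {n : ℕ} (π : (Fin n → ℂ) → (Fin n → ℂ)) (p : ℝ)
    (z : Fin n → ℂ) : ℝ≥0∞ :=
  ‖jacobian π z‖ₑ ^ (2 - p)

/-- A permutation of `Ω`, as a self-map of `ℂⁿ` (extended by the identity outside `Ω`). -/
noncomputable def ambientMap {n : ℕ} {Ω : Set (Fin n → ℂ)} (g : Equiv.Perm Ω) :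
    (Fin n → ℂ) → (Fin n → ℂ) :=
  haveI : DecidablePred (· ∈ Ω) := Classical.decPred _
  Equiv.Perm.ofSubtype g

theorem ambientMap_apply {n : ℕ} {Ω : Set (Fin n → ℂ)} (g : Equiv.Perm Ω) {z : Fin n → ℂ}
    (hz : z ∈ Ω) : ambientMap g z = g ⟨z, hz⟩ := by
  classical
  exact Equiv.Perm.ofSubtype_apply_of_mem g hz

/-- The covering group of `π` on `Ω = E ∖ V`: the group of all biholomorphic self-maps `g` of `Ω`
such that `π ∘ g = π` on `Ω`. -/
def coveringGroup {n : ℕ} (Ω : Set (Fin n → ℂ)) (π : (Fin n → ℂ) → (Fin n → ℂ)) :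
    Subgroup (Equiv.Perm Ω) where
  carrier := {g | DifferentiableOn ℂ (ambientMap g) Ω ∧ DifferentiableOn ℂ (ambientMap g⁻¹) Ω ∧
    ∀ z : Ω, π (g z) = π z}
  one_mem' := by
    have h : DifferentiableOn ℂ (ambientMap (1 : Equiv.Perm Ω)) Ω :=
      differentiableOn_id.congr fun z hz => ambientMap_apply 1 hz
    exact ⟨h, by simpa using h, fun z => rfl⟩
  mul_mem' := by
    have key : ∀ g h : Equiv.Perm Ω, DifferentiableOn ℂ (ambientMap g) Ω →
        DifferentiableOn ℂ (ambientMap h) Ω → DifferentiableOn ℂ (ambientMap (g * h)) Ω := by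
      intro g h hg hh
      have hm : MapsTo (ambientMap h) Ω Ω := fun z hz => by
        rw [ambientMap_apply h hz]; exact (h ⟨z, hz⟩).2
      refine (hg.comp hh hm).congr fun z hz => ?_
      simp only [Function.comp_apply, ambientMap_apply h hz,
        ambientMap_apply g (h ⟨z, hz⟩).2, ambientMap_apply (g * h) hz, Equiv.Perm.mul_apply]
    rintro g h ⟨hg, hg', hgπ⟩ ⟨hh, hh', hhπ⟩
    refine ⟨key g h hg hh, ?_, fun z => ?_⟩
    · rw [mul_inv_rev]; exact key _ _ hh' hg'
    · rw [Equiv.Perm.mul_apply, hgπ, hhπ]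
  inv_mem' := by
    rintro g ⟨hg, hg', hgπ⟩
    refine ⟨hg', by simpa using hg, fun z => ?_⟩
    simpa using (hgπ (g⁻¹ z)).symm

/-- The covering is normal: its covering group acts transitively on the fibers of `π`. -/
def IsNormalCovering {n : ℕ} (Ω : Set (Fin n → ℂ)) (π : (Fin n → ℂ) → (Fin n → ℂ)) : Prop :=
  ∀ z₁ z₂ : Ω, π z₁ = π z₂ ↔ ∃ g ∈ coveringGroup Ω π, g z₁ = z₂

/-! Let `N` be the number of sheets. Off the exceptional sets every point downstairs has `N`
holomorphic inverse branches, and the real Jacobian of a branch is the inverse of |J(π)|² upstairs.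
Summing over branches, integrating a(z)|J(π)(z)|² over E equals integrating the fibre sum of a over
D. Hence π^* multiplies squared L² norms by `N`. With the weight |J(π)|^(2-p) the same computation
works for every p, since |J|^p |J|^(2-p) = |J|²: the weighted p-th power integral of π^*u is `N`
times that of u.

The adjoint of π^* is the push-forward v ↦ Σ v/J(π) along fibres. Both maps preserve holomorphy and
square integrability, so both respect Bergman spaces. Therefore π^*(P_D u) lies in A²(E), and π^*u -
π^*(P_D u) is orthogonal to A²(E), that is, P_E π^* = π^* P_D (`bergmanProjection_pullback`). The
two estimates then differ by the common factor `N`, which cancels. For a normal covering, invariance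
of v under the group says that v/J(π) is constant on fibres, so it descends to D.

Three analytic facts support this. Proper analytic subsets are null and do not disconnect
(`IsAnalyticSubset.isPreconnected_diff`), so `N` is constant. The inverse branches, which a
topological covering gives only as continuous maps, are holomorphic
(`differentiableOn_of_rightInverse`, from Radó's theorem and Sard's lemma), so J(π) has no zeros off
V. Square-integrable holomorphic functions extend across analytic subsets
(`exists_extension_of_lintegral_ne_top`), so holomorphy off V or W suffices for membership in the
Bergman space. -/

/-! ### Holomorphic parameter integrals and the Jacobian determinant. -/

/-- Integrals of a holomorphic function over translated circles depend holomorphically on the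
translation. -/
theorem differentiableAt_integral_circleMap {n : ℕ} {U : Set (Fin n → ℂ)} (hU : IsOpen U)
    {F : (Fin n → ℂ) → ℂ} (hF : DifferentiableOn ℂ F U) {k : ℝ → ℂ} (hk : Continuous k)
    {v z₀ : Fin n → ℂ} {ρ : ℝ} (hz : ∀ θ, z₀ + circleMap 0 ρ θ • v ∈ U) :
    DifferentiableAt ℂ
      (fun z => ∫ θ in (0 : ℝ)..2 * Real.pi, k θ * F (z + circleMap 0 ρ θ • v)) z₀ := by
  have hcont : Continuous fun θ : ℝ => z₀ + circleMap 0 ρ θ • v := by fun_prop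
  -- The circle is compact, so F is bounded by M on a closed δ-thickening of it. The Cauchy estimate
  -- on balls of radius δ/2 bounds the derivative by 2M/(δ/2), which dominates the differentiated
  -- integrand.
  set K : Set (Fin n → ℂ) := (fun θ : ℝ => z₀ + circleMap 0 ρ θ • v) '' Icc 0 (2 * Real.pi)
    with hK
  have hKc : IsCompact K := isCompact_Icc.image hcont
  have hKU : K ⊆ U := by rintro _ ⟨θ, -, rfl⟩; exact hz θ
  obtain ⟨δ, hδ, hδU⟩ := hKc.exists_cthickening_subset_open hU hKU
  obtain ⟨M, hM⟩ := (hKc.cthickening (r := δ)).exists_bound_of_continuousOn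
    (hF.continuousOn.mono hδU)
  obtain ⟨A, hA⟩ := isCompact_Icc.exists_bound_of_continuousOn
    (hk.continuousOn (s := Icc 0 (2 * Real.pi)))
  have hpi : (0 : ℝ) ≤ 2 * Real.pi := by positivity
  have hball : ∀ z ∈ Metric.ball z₀ (δ / 2), ∀ θ ∈ Icc 0 (2 * Real.pi),
      Metric.ball (z + circleMap 0 ρ θ • v) (δ / 2) ⊆ Metric.cthickening δ K := by
    intro z hz θ hθ y hy
    refine Metric.mem_cthickening_of_dist_le y (z₀ + circleMap 0 ρ θ • v) δ K ⟨θ, hθ, rfl⟩ ?_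
    have h1 : dist (z + circleMap 0 ρ θ • v) (z₀ + circleMap 0 ρ θ • v) = dist z z₀ :=
      dist_add_right _ _ _
    have h2 := dist_triangle y (z + circleMap 0 ρ θ • v) (z₀ + circleMap 0 ρ θ • v)
    rw [Metric.mem_ball] at hz hy
    linarith
  have hmem : ∀ z ∈ Metric.ball z₀ (δ / 2), ∀ θ ∈ Icc 0 (2 * Real.pi),
      z + circleMap 0 ρ θ • v ∈ U := fun z hz θ hθ =>
    hδU (hball z hz θ hθ (Metric.mem_ball_self (by positivity)))
  have hmeas : ∀ z ∈ Metric.ball z₀ (δ / 2), ContinuousOn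
      (fun θ => k θ * F (z + circleMap 0 ρ θ • v)) (Icc 0 (2 * Real.pi)) := by
    intro z hz
    refine hk.continuousOn.mul (hF.continuousOn.comp ?_ (fun θ hθ => hmem z hz θ hθ))
    fun_prop
  have huIoc : uIoc (0 : ℝ) (2 * Real.pi) ⊆ Icc 0 (2 * Real.pi) := by
    rw [uIoc_of_le hpi]; exact Ioc_subset_Icc_self
  simp_rw [intervalIntegral.integral_of_le hpi]
  refine (hasFDerivAt_integral_of_dominated_of_fderiv_le (𝕜 := ℂ)
    (s := Metric.ball z₀ (δ / 2))
    (F' := fun z θ => k θ • fderiv ℂ F (z + circleMap 0 ρ θ • v))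
    (bound := fun _ => A * (2 * M / (δ / 2)))
    (Metric.ball_mem_nhds _ (by positivity)) ?_ ?_ ?_ ?_ ?_ ?_).differentiableAt
  · filter_upwards [Metric.ball_mem_nhds z₀ (half_pos hδ)] with z hz
    exact ((hmeas z hz).mono Ioc_subset_Icc_self).aestronglyMeasurable measurableSet_Ioc
  · exact ((hmeas z₀ (Metric.mem_ball_self (half_pos hδ))).integrableOn_compact
      isCompact_Icc).mono_set Ioc_subset_Icc_self
  · refine (hk.measurable.smul ?_).aestronglyMeasurable
    exact (measurable_fderiv ℂ F).comp hcont.measurable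
  · refine (ae_restrict_iff' measurableSet_Ioc).2 (Eventually.of_forall fun θ hθ z hz => ?_)
    have hθ' := Ioc_subset_Icc_self hθ
    rw [norm_smul]
    have hd := Complex.norm_fderiv_le_div_of_mapsTo_ball (f := F)
      (c := z + circleMap 0 ρ θ • v) (R₁ := δ / 2) (R₂ := 2 * M)
      (hF.mono ((hball z hz θ hθ').trans hδU)) (fun y hy => by
        rw [Metric.mem_closedBall, dist_eq_norm]
        have e1 := hM _ (hball z hz θ hθ' hy)
        have e2 := hM _ (hball z hz θ hθ' (Metric.mem_ball_self (half_pos hδ)))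
        linarith [norm_sub_le (F y) (F (z + circleMap 0 ρ θ • v))]) (half_pos hδ)
    exact mul_le_mul (hA θ hθ') hd (norm_nonneg _) ((norm_nonneg _).trans (hA θ hθ'))
  · exact integrable_const _
  · refine (ae_restrict_iff' measurableSet_Ioc).2 (Eventually.of_forall fun θ hθ z hz => ?_)
    have hmm := hmem z hz θ (Ioc_subset_Icc_self hθ)
    have h1 : HasFDerivAt F (fderiv ℂ F (z + circleMap 0 ρ θ • v)) (z + circleMap 0 ρ θ • v) :=
      ((hF _ hmm).differentiableAt (hU.mem_nhds hmm)).hasFDerivAt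
    have h2 := h1.comp z ((hasFDerivAt_id z).add_const (circleMap 0 ρ θ • v))
    simpa using h2.const_mul (k θ)

/-- Restriction of a holomorphic function to a complex line. -/
theorem differentiableAt_comp_line {n : ℕ} {Y : Type*} [NormedAddCommGroup Y]
    [NormedSpace ℂ Y] {U : Set (Fin n → ℂ)} (hU : IsOpen U)
    {F : (Fin n → ℂ) → Y} (hF : DifferentiableOn ℂ F U) {z v : Fin n → ℂ} {t : ℂ}
    (ht : z + t • v ∈ U) : DifferentiableAt ℂ (fun t : ℂ => F (z + t • v)) t :=
  ((hF _ ht).differentiableAt (hU.mem_nhds ht)).comp t (f := fun t : ℂ => z + t • v)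
    (by fun_prop)

/-- Directional derivatives of holomorphic functions are holomorphic. -/
theorem differentiableOn_fderiv_apply {n : ℕ} {U : Set (Fin n → ℂ)} (hU : IsOpen U)
    {F : (Fin n → ℂ) → ℂ} (hF : DifferentiableOn ℂ F U) (v : Fin n → ℂ) :
    DifferentiableOn ℂ (fun z => fderiv ℂ F z v) U := by
  intro z₀ hz₀
  obtain ⟨r, hr, hrU⟩ := Metric.isOpen_iff.1 hU z₀ hz₀
  set ρ : ℝ := r / 2 / (‖v‖ + 1) with hρ
  have hρ0 : 0 < ρ := by positivity
  have hρv : ρ * ‖v‖ < r / 2 := by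
    rw [hρ, div_mul_eq_mul_div, div_lt_iff₀ (by positivity)]
    nlinarith [norm_nonneg v]
  have hmem : ∀ z ∈ Metric.ball z₀ (r / 2), ∀ t : ℂ, ‖t‖ ≤ ρ → z + t • v ∈ U := by
    intro z hz t ht
    refine hrU ?_
    rw [Metric.mem_ball] at hz ⊢
    have h1 : dist (z + t • v) z = ‖t‖ * ‖v‖ := by
      rw [dist_eq_norm, add_sub_cancel_left, norm_smul]
    have h2 : ‖t‖ * ‖v‖ ≤ ρ * ‖v‖ := by gcongr
    linarith [dist_triangle (z + t • v) z z₀]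
  -- Cauchy's formula for the first derivative on the line z + tv expresses the directional
  -- derivative as an integral of F over translated circles, which is holomorphic in z.
  have hform : ∀ z ∈ Metric.ball z₀ (r / 2), fderiv ℂ F z v =
      (2 * Real.pi * Complex.I : ℂ)⁻¹ • ∫ θ in (0 : ℝ)..2 * Real.pi,
        (circleMap 0 ρ θ * Complex.I * ((circleMap 0 ρ θ) ^ 2)⁻¹) *
          F (z + circleMap 0 ρ θ • v) := by
    intro z hz
    set S : Set ℂ := (fun t : ℂ => z + t • v) ⁻¹' U with hS
    have hSo : IsOpen S := hU.preimage (by fun_prop)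
    have hc := Complex.two_pi_I_inv_smul_circleIntegral_sub_sq_inv_smul_of_differentiable
      (f := fun t : ℂ => F (z + t • v)) (U := S) (c := 0) (w₀ := 0) (R := ρ) hSo
      (fun t ht => hmem z hz t (by simpa using ht))
      (fun t ht => (differentiableAt_comp_line hU hF ht).differentiableWithinAt)
      (Metric.mem_ball_self hρ0)
    have hzU : z ∈ U := by simpa using hmem z hz 0 (by simpa using hρ0.le)
    have hd : deriv (fun t : ℂ => F (z + t • v)) 0 = fderiv ℂ F z v := by
      have h1 : HasFDerivAt F (fderiv ℂ F z) (z + (0 : ℂ) • v) := by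
        simpa using ((hF _ hzU).differentiableAt (hU.mem_nhds hzU)).hasFDerivAt
      have h2 : HasDerivAt (fun t : ℂ => z + t • v) v 0 := by
        simpa using ((hasDerivAt_id (0 : ℂ)).smul_const v).const_add z
      exact (h1.comp_hasDerivAt 0 h2).deriv
    rw [← hd, ← hc, circleIntegral]
    simp [mul_assoc]
  have hk : Continuous fun θ => circleMap 0 ρ θ * Complex.I * ((circleMap 0 ρ θ) ^ 2)⁻¹ := by
    refine Continuous.mul (by fun_prop) (Continuous.inv₀ (by fun_prop) fun θ => ?_)
    simp [circleMap, hρ0.ne']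
  have hd := differentiableAt_integral_circleMap hU hF hk (v := v) (z₀ := z₀) (ρ := ρ)
    (fun θ => hmem z₀ (Metric.mem_ball_self (half_pos hr)) _ (by simp [abs_of_pos hρ0]))
  refine ((hd.const_smul ((2 * Real.pi * Complex.I : ℂ)⁻¹)).congr_of_eventuallyEq
    ?_).differentiableWithinAt
  filter_upwards [Metric.ball_mem_nhds z₀ (half_pos hr)] with z hz
  rw [hform z hz]; rfl

theorem jacobian_eq_det {n : ℕ} (ψ : (Fin n → ℂ) → (Fin n → ℂ)) (z : Fin n → ℂ) :
    jacobian ψ z = (Matrix.of fun i j => fderiv ℂ ψ z (Pi.single j 1) i).det := by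
  rw [jacobian, ContinuousLinearMap.det, ← LinearMap.det_toMatrix']
  congr 1

/-- The Jacobian determinant of a holomorphic map is holomorphic. -/
theorem differentiableOn_jacobian {n : ℕ} {U : Set (Fin n → ℂ)} (hU : IsOpen U)
    {ψ : (Fin n → ℂ) → (Fin n → ℂ)} (hψ : DifferentiableOn ℂ ψ U) :
    DifferentiableOn ℂ (jacobian ψ) U := by
  have h1 : ∀ i j, DifferentiableOn ℂ (fun z => fderiv ℂ ψ z (Pi.single j 1) i) U := by
    intro i j
    refine (differentiableOn_fderiv_apply hU (differentiableOn_pi.1 hψ i) (Pi.single j 1)).congr ?_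
    intro z hz
    have h2 : DifferentiableAt ℂ ψ z := (hψ z hz).differentiableAt (hU.mem_nhds hz)
    have h3 := (hasFDerivAt_pi'.1 h2.hasFDerivAt i).fderiv
    rw [h3]; rfl
  refine DifferentiableOn.congr (f := fun z =>
    (Matrix.of fun i j => fderiv ℂ ψ z (Pi.single j 1) i).det) ?_
    (fun z _ => jacobian_eq_det ψ z)
  simp only [Matrix.det_apply, Matrix.of_apply]
  refine DifferentiableOn.fun_sum fun σ _ => DifferentiableOn.const_smul ?_ _
  exact fun z hz => (HasFDerivWithinAt.finsetProd fun i _ =>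
    (h1 (σ i) i z hz).hasFDerivWithinAt).differentiableWithinAt

/-! ### Connectedness and smallness of zero sets. -/

/-- A relatively closed nowhere dense subset which does not disconnect small neighbourhoods does
not disconnect. -/
theorem IsPreconnected.diff_of_locally {X : Type*} [TopologicalSpace X] {E V : Set X}
    (hE : IsPreconnected E) (hd : E ⊆ closure (E \ V))
    (hloc : ∀ z ∈ E, ∃ U, IsOpen U ∧ z ∈ U ∧ U ⊆ E ∧ IsPreconnected (U \ V)) :
    IsPreconnected (E \ V) := by
  rintro u v hu hv huv ⟨x, hxE, hxu⟩ ⟨y, hyE, hyv⟩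
  by_contra hne
  rw [not_nonempty_iff_eq_empty] at hne
  -- A separation of E ∖ V by u and v fattens to E: `A u` and `A v` are open and cover E, hence
  -- overlap, and density of E ∖ V puts a point of both u and v in the overlap.
  set A : Set X → Set X := fun w => ⋃₀ {U | IsOpen U ∧ U ⊆ E ∧ U \ V ⊆ w} with hA
  have hAo : ∀ w, IsOpen (A w) := fun w => isOpen_sUnion fun U hU => hU.1
  have hcov : ∀ z ∈ E, ∃ U, IsOpen U ∧ z ∈ U ∧ U ⊆ E ∧ (U \ V ⊆ u ∨ U \ V ⊆ v) := by
    intro z hz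
    obtain ⟨U, hUo, hzU, hUE, hUc⟩ := hloc z hz
    have hsub : U \ V ⊆ E \ V := sdiff_subset_sdiff_left hUE
    refine ⟨U, hUo, hzU, hUE, isPreconnected_iff_subset_of_disjoint.1 hUc u v hu hv
      (hsub.trans huv) ?_⟩
    exact subset_empty_iff.1 ((inter_subset_inter_left _ hsub).trans hne.subset)
  have hdis : ∀ z ∈ E \ V, z ∈ u → z ∈ v → False := fun z hz h1 h2 =>
    (hne.subset ⟨hz, h1, h2⟩ : z ∈ (∅ : Set X))
  have hEA : E ⊆ A u ∪ A v := by
    intro z hz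
    obtain ⟨U, hUo, hzU, hUE, h | h⟩ := hcov z hz
    · exact Or.inl ⟨U, ⟨hUo, hUE, h⟩, hzU⟩
    · exact Or.inr ⟨U, ⟨hUo, hUE, h⟩, hzU⟩
  have hxA : x ∈ A u := by
    obtain ⟨U, hUo, hzU, hUE, h | h⟩ := hcov x hxE.1
    · exact ⟨U, ⟨hUo, hUE, h⟩, hzU⟩
    · exact (hdis x hxE hxu (h ⟨hzU, hxE.2⟩)).elim
  have hyA : y ∈ A v := by
    obtain ⟨U, hUo, hzU, hUE, h | h⟩ := hcov y hyE.1
    · exact (hdis y hyE (h ⟨hzU, hyE.2⟩) hyv).elim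
    · exact ⟨U, ⟨hUo, hUE, h⟩, hzU⟩
  obtain ⟨z, hzE, ⟨U, ⟨hU, hUE, hUu⟩, hzU⟩, ⟨U', ⟨hU', -, hUv⟩, hzU'⟩⟩ :=
    hE (A u) (A v) (hAo u) (hAo v) hEA ⟨x, hxE.1, hxA⟩ ⟨y, hyE.1, hyA⟩
  obtain ⟨w, ⟨hw, hw'⟩, hwE⟩ := mem_closure_iff.1 (hd hzE) (U ∩ U') (hU.inter hU') ⟨hzU, hzU'⟩
  exact hdis w hwE (hUu ⟨hw, hwE.2⟩) (hUv ⟨hw', hwE.2⟩)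

/-- The ball is homeomorphic to the plane, and a countable set does not disconnect a real vector
space of dimension greater than one. -/
theorem isPreconnected_ball_diff_countable {c : ℂ} {r : ℝ} (hr : 0 < r) {Z : Set ℂ}
    (hZ : Z.Countable) : IsPreconnected (Metric.ball c r \ Z) := by
  set e := OpenPartialHomeomorph.univBall c r with he
  have hrank : 1 < Module.rank ℝ ℂ := by simp [Complex.rank_real_complex]
  have hinj : Function.Injective e := by
    have := e.injOn
    rwa [OpenPartialHomeomorph.univBall_source, injOn_univ] at this
  have h1 := ((hZ.preimage hinj).isConnected_compl_of_one_lt_rank hrank).isPreconnected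
  have h2 := h1.image e (OpenPartialHomeomorph.continuous_univBall c r).continuousOn
  convert h2 using 1
  ext x
  constructor
  · rintro ⟨hx, hxZ⟩
    have hx' : x ∈ e.target := by rwa [OpenPartialHomeomorph.univBall_target c hr]
    exact ⟨e.symm x, by simpa [e.right_inv hx'] using hxZ, e.right_inv hx'⟩
  · rintro ⟨y, hy, rfl⟩
    refine ⟨?_, hy⟩
    rw [← OpenPartialHomeomorph.univBall_target c hr]
    exact e.map_source (by rw [OpenPartialHomeomorph.univBall_source]; trivial)

/-- Removing a countable set from a connected open set of the plane does not disconnect it. -/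
theorem IsPreconnected.diff_countable {S : Set ℂ} (hS : IsOpen S) (hc : IsPreconnected S)
    {Z : Set ℂ} (hZ : Z.Countable) : IsPreconnected (S \ Z) := by
  refine hc.diff_of_locally ?_ fun z hz => ?_
  · have := (hZ.dense_compl ℝ).open_subset_closure_inter hS
    rwa [sdiff_eq]
  · obtain ⟨r, hr, hrS⟩ := Metric.isOpen_iff.1 hS z hz
    exact ⟨_, Metric.isOpen_ball, Metric.mem_ball_self hr, hrS,
      isPreconnected_ball_diff_countable hr hZ⟩

/-- The zeros of a nonzero holomorphic function of one variable are countable. -/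
theorem DifferentiableOn.countable_zeros {S : Set ℂ} (hS : IsOpen S) (hc : IsPreconnected S)
    {f : ℂ → ℂ} (hf : DifferentiableOn ℂ f S) {a : ℂ} (ha : a ∈ S) (hfa : f a ≠ 0) :
    {t | t ∈ S ∧ f t = 0}.Countable := by
  have han := hf.analyticOnNhd hS
  -- Zeros are isolated, so the zero set is discrete, and a discrete subset of the plane is
  -- countable by the Lindelöf property.
  have hiso : ∀ x ∈ {t | t ∈ S ∧ f t = 0}, ({x} : Set ℂ) ∈ 𝓝[{t | t ∈ S ∧ f t = 0}] x := by
    rintro x ⟨hx, -⟩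
    rcases (han x hx).eventually_eq_zero_or_eventually_ne_zero with h | h
    · exact absurd (han.eqOn_zero_of_preconnected_of_eventuallyEq_zero hc hx h ha) hfa
    · rw [eventually_nhdsWithin_iff] at h
      rw [mem_nhdsWithin_iff_eventually]
      filter_upwards [h] with y hy hy'
      by_contra hne
      exact hy hne hy'.2
  obtain ⟨t, ht, htc, hcov⟩ := TopologicalSpace.countable_cover_nhdsWithin hiso
  exact htc.mono (by simpa using hcov)

theorem isOpen_line_preimage {n : ℕ} {B : Set (Fin n → ℂ)} (hB : IsOpen B) (a v : Fin n → ℂ) :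
    IsOpen {t : ℂ | a + t • v ∈ B} :=
  hB.preimage (f := fun t : ℂ => a + t • v) (by fun_prop)

theorem isPreconnected_line_preimage {n : ℕ} {B : Set (Fin n → ℂ)} (hB : Convex ℝ B)
    (a v : Fin n → ℂ) : IsPreconnected {t : ℂ | a + t • v ∈ B} := by
  refine Convex.isPreconnected fun s hs t ht p q hp hq hpq => ?_
  have h := hB hs ht hp hq hpq
  have : a + (p • s + q • t) • v = p • (a + s • v) + q • (a + t • v) := by
    calc a + (p • s + q • t) • v = (p + q) • a + (p • s + q • t) • v := by rw [hpq, one_smul]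
      _ = _ := by
        rw [add_smul, add_smul, smul_assoc, smul_assoc, smul_add, smul_add]; abel
  exact (congrArg (· ∈ B) this).mpr h

/-- The zeros on a complex line of a holomorphic function, not identically zero on the line. -/
theorem countable_zeros_line {n : ℕ} {B : Set (Fin n → ℂ)} (hB : IsOpen B) (hc : Convex ℝ B)
    {F : (Fin n → ℂ) → ℂ} (hF : DifferentiableOn ℂ F B) {a v : Fin n → ℂ} {s : ℂ}
    (hs : a + s • v ∈ B) (hFs : F (a + s • v) ≠ 0) :
    {t : ℂ | a + t • v ∈ B ∧ F (a + t • v) = 0}.Countable :=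
  DifferentiableOn.countable_zeros (S := {t : ℂ | a + t • v ∈ B})
    (f := fun t => F (a + t • v)) (isOpen_line_preimage hB a v)
    (isPreconnected_line_preimage hc a v)
    (fun _ ht => (differentiableAt_comp_line hB hF ht).differentiableWithinAt) hs hFs

/-- Identity theorem on convex open sets. -/
theorem eqOn_zero_of_eventuallyEq_zero {n : ℕ} {B : Set (Fin n → ℂ)} (hB : IsOpen B)
    (hc : Convex ℝ B) {F : (Fin n → ℂ) → ℂ} (hF : DifferentiableOn ℂ F B) {a : Fin n → ℂ}
    (ha : a ∈ B) (h0 : F =ᶠ[𝓝 a] 0) : EqOn F 0 B := by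
  intro b hb
  set S : Set ℂ := {t : ℂ | a + t • (b - a) ∈ B}
  have hd : DifferentiableOn ℂ (fun t : ℂ => F (a + t • (b - a))) S :=
    fun _ ht => (differentiableAt_comp_line hB hF ht).differentiableWithinAt
  have hcont : Tendsto (fun t : ℂ => a + t • (b - a)) (𝓝 0) (𝓝 a) := by
    have : Continuous fun t : ℂ => a + t • (b - a) := by fun_prop
    simpa using this.tendsto 0
  have han := hd.analyticOnNhd (isOpen_line_preimage hB _ _)
  have := han.eqOn_zero_of_preconnected_of_eventuallyEq_zero
    (isPreconnected_line_preimage hc _ _) (z₀ := 0)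
    (show (0 : ℂ) ∈ {t : ℂ | a + t • (b - a) ∈ B} by simpa using ha)
    (hcont.eventually h0) (show (1 : ℂ) ∈ {t : ℂ | a + t • (b - a) ∈ B} by simpa using hb)
  simpa using this

/-- A point with a neighbourhood inside the zero set would force F = 0 on all of B by the identity
theorem. -/
theorem dense_nonzeros {n : ℕ} {B : Set (Fin n → ℂ)} (hB : IsOpen B)
    (hc : Convex ℝ B) {F : (Fin n → ℂ) → ℂ} (hF : DifferentiableOn ℂ F B) {b : Fin n → ℂ}
    (hb : b ∈ B) (hFb : F b ≠ 0) : B ⊆ closure {z | z ∈ B ∧ F z ≠ 0} := by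
  intro a ha
  by_contra hcl
  refine hFb (eqOn_zero_of_eventuallyEq_zero hB hc hF ha ?_ hb)
  rw [mem_closure_iff_frequently, not_frequently] at hcl
  filter_upwards [hcl, hB.mem_nhds ha] with z hz hzB
  by_contra h
  exact hz ⟨hzB, h⟩

/-- The zero set of a holomorphic function does not disconnect convex open sets. -/
theorem isPreconnected_nonzeros {n : ℕ} {B : Set (Fin n → ℂ)} (hB : IsOpen B)
    (hc : Convex ℝ B) {F : (Fin n → ℂ) → ℂ} (hF : DifferentiableOn ℂ F B) :
    IsPreconnected {z | z ∈ B ∧ F z ≠ 0} := by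
  refine isPreconnected_of_forall_pair fun a ha b hb => ?_
  set S : Set ℂ := {t : ℂ | a + t • (b - a) ∈ B}
  -- The complex line through a and b meets B in a connected planar set. Removing the countably many
  -- zeros keeps it connected, and its image joins a to b.
  have hZ := countable_zeros_line hB hc hF (a := a) (v := b - a) (s := 1) (by simpa using hb.1)
    (by simpa using hb.2)
  have hp := IsPreconnected.diff_countable (isOpen_line_preimage hB a (b - a))
    (isPreconnected_line_preimage hc _ _) hZ
  refine ⟨_, ?_, ?_, ?_, hp.image (fun t : ℂ => a + t • (b - a)) (by fun_prop)⟩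
  · rintro _ ⟨t, ⟨ht, ht'⟩, rfl⟩
    exact ⟨ht, fun h => ht' ⟨ht, h⟩⟩
  · exact ⟨0, ⟨by simpa using ha.1, fun h => ha.2 (by simpa using h.2)⟩, by simp⟩
  · exact ⟨1, ⟨by simpa using hb.1, fun h => hb.2 (by simpa using h.2)⟩, by simp⟩

/-- The zero set of a nonzero holomorphic function is a null set. -/
theorem volume_zeros_eq_zero {n : ℕ} {B : Set (Fin n → ℂ)} (hB : IsOpen B)
    (hc : Convex ℝ B) {F : (Fin n → ℂ) → ℂ} (hF : DifferentiableOn ℂ F B) {b : Fin n → ℂ}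
    (hb : b ∈ B) (hFb : F b ≠ 0) : volume {z | z ∈ B ∧ F z = 0} = 0 := by
  set Z := {z | z ∈ B ∧ F z = 0} with hZ
  have hZm : MeasurableSet Z := by
    have : Z = B \ (B ∩ F ⁻¹' {0}ᶜ) := by
      ext z; simp only [hZ, mem_ofPred_eq, Set.mem_sdiff, mem_inter_iff, mem_preimage, mem_compl_iff,
        mem_singleton_iff]; tauto
    rw [this]
    exact hB.measurableSet.diff
      (hF.continuousOn.isOpen_inter_preimage hB isOpen_compl_singleton).measurableSet
  refine measure_null_of_locally_null _ fun z₀ hz₀ => ?_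
  -- For z near z₀ the point z + e is near b, where F does not vanish. Every line in direction e
  -- through such z therefore carries only countably many zeros.
  set e := b - z₀ with he
  obtain ⟨δ, hδ, hδB⟩ : ∃ δ > 0, ∀ z ∈ Metric.ball z₀ δ, z ∈ B ∧ z + e ∈ B ∧ F (z + e) ≠ 0 := by
    have h1 : ∀ᶠ z in 𝓝 z₀, z + e ∈ {w | w ∈ B ∧ F w ≠ 0} := by
      have ho : IsOpen (B ∩ F ⁻¹' {0}ᶜ) :=
        hF.continuousOn.isOpen_inter_preimage hB isOpen_compl_singleton
      have hct : Tendsto (fun z => z + e) (𝓝 z₀) (𝓝 b) := by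
        have : Continuous fun z : Fin n → ℂ => z + e := by fun_prop
        simpa [he] using this.tendsto z₀
      exact hct.eventually (ho.mem_nhds ⟨hb, hFb⟩)
    obtain ⟨δ, hδ, h⟩ := Metric.eventually_nhds_iff_ball.1 (h1.and (hB.mem_nhds hz₀.1))
    exact ⟨δ, hδ, fun z hz => ⟨(h z hz).2, (h z hz).1.1, (h z hz).1.2⟩⟩
  have hline : ∀ᵐ z ∂(volume.restrict (Metric.ball z₀ δ)), ∀ᵐ t : ℂ, z + t • e ∉ Z := by
    refine (ae_restrict_iff' Metric.isOpen_ball.measurableSet).2 (Eventually.of_forall fun z hz => ?_)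
    obtain ⟨h1, h2, h3⟩ := hδB z hz
    have hcz := countable_zeros_line hB hc hF (a := z) (v := e) (s := 1) (by simpa using h2)
      (by simpa using h3)
    filter_upwards [hcz.ae_notMem volume] with t ht
    exact ht
  have hmeas : MeasurableSet {x : (Fin n → ℂ) × ℂ | x.1 + x.2 • e ∉ Z} :=
    (hZm.preimage (show Measurable fun x : (Fin n → ℂ) × ℂ => x.1 + x.2 • e from
      (by fun_prop : Continuous fun x : (Fin n → ℂ) × ℂ => x.1 + x.2 • e).measurable)).compl
  have hsw := (Measure.ae_ae_comm hmeas).1 hline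
  set ε := δ / 2 / (‖e‖ + 1) with hε
  have hε0 : 0 < ε := by positivity
  -- Fubini exchanges the two almost-everywhere quantifiers, so some small t works. Translating by
  -- te, of length less than δ/2, then shows that Z is null near z₀.
  obtain ⟨t, htε, ht⟩ : ∃ t ∈ Metric.ball (0 : ℂ) ε,
      ∀ᵐ z ∂(volume.restrict (Metric.ball z₀ δ)), z + t • e ∉ Z := by
    by_contra hcon
    push Not at hcon
    have : Metric.ball (0 : ℂ) ε ⊆
        {t | ¬ ∀ᵐ z ∂(volume.restrict (Metric.ball z₀ δ)), z + t • e ∉ Z} :=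
      fun t ht => by simpa using hcon t ht
    exact (Metric.measure_ball_pos volume (0 : ℂ) hε0).ne' (measure_mono_null this hsw)
  have hte : ‖t • e‖ < δ / 2 := by
    rw [norm_smul]
    have h1 : ‖t‖ < ε := by simpa using htε
    have h2 : ε * (‖e‖ + 1) = δ / 2 := by rw [hε]; field_simp
    nlinarith [norm_nonneg e, norm_nonneg t]
  refine ⟨Metric.ball z₀ (δ / 2) ∩ Z, inter_mem (mem_nhdsWithin_of_mem_nhds
    (Metric.ball_mem_nhds _ (half_pos hδ))) self_mem_nhdsWithin, ?_⟩
  rw [ae_restrict_iff' Metric.isOpen_ball.measurableSet] at ht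
  have hpre : volume ((fun z => z + t • e) ⁻¹' (Metric.ball z₀ (δ / 2) ∩ Z)) = 0 := by
    refine measure_mono_null ?_ ht
    rintro z ⟨hz1, hz2⟩ hcon
    refine hcon ?_ hz2
    rw [Metric.mem_ball] at hz1 ⊢
    have h1 : dist z (z + t • e) = ‖t • e‖ := by simp [dist_eq_norm]
    linarith [dist_triangle z (z + t • e) z₀]
  rwa [measure_preimage_add_right] at hpre

/-! ### Proper analytic subsets are null and do not disconnect. -/

/-- Local equations are available at every point of E, so at a point off V some equation is nonzero,
and it stays nonzero nearby. -/
theorem IsAnalyticSubset.isOpen_diff {n : ℕ} {E V : Set (Fin n → ℂ)}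
    (hV : IsAnalyticSubset E V) : IsOpen (E \ V) := by
  rw [isOpen_iff_mem_nhds]
  rintro z ⟨hzE, hzV⟩
  obtain ⟨U, hU, hzU, hUE, k, f, hf, hVU⟩ := hV.2 z hzE
  have hex : ∃ i, f i z ≠ 0 := by
    by_contra hcon
    push Not at hcon
    exact hzV (hVU.superset ⟨hzU, hcon⟩).1
  obtain ⟨i, hi⟩ := hex
  filter_upwards [hU.mem_nhds hzU, ((hf i).continuousOn.continuousAt
    (hU.mem_nhds hzU)).eventually_ne hi] with w hw hw'
  exact ⟨hUE hw, fun h => hw' ((hVU.subset ⟨h, hw⟩).2 i)⟩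

/-- Near every point of a connected open set, a proper analytic subset is contained in the zero set
of a nonzero holomorphic function. -/
theorem IsAnalyticSubset.exists_ball {n : ℕ} {E V : Set (Fin n → ℂ)}
    (hEc : IsPreconnected E) (hV : IsAnalyticSubset E V) (hVE : V ≠ E) {z : Fin n → ℂ}
    (hz : z ∈ E) : ∃ r > 0, Metric.ball z r ⊆ E ∧ ∃ F : (Fin n → ℂ) → ℂ,
      DifferentiableOn ℂ F (Metric.ball z r) ∧ (∃ b ∈ Metric.ball z r, F b ≠ 0) ∧
      ∀ w ∈ Metric.ball z r, w ∈ V → F w = 0 := by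
  have key : ∀ z ∈ E, ∃ r > 0, Metric.ball z r ⊆ E ∧ ∃ (k : ℕ) (f : Fin k → (Fin n → ℂ) → ℂ),
      (∀ i, DifferentiableOn ℂ (f i) (Metric.ball z r)) ∧
      ∀ w ∈ Metric.ball z r, w ∈ V ↔ ∀ i, f i w = 0 := by
    intro z hz
    obtain ⟨U, hU, hzU, hUE, k, f, hf, hVU⟩ := hV.2 z hz
    obtain ⟨r, hr, hrU⟩ := Metric.isOpen_iff.1 hU z hzU
    refine ⟨r, hr, hrU.trans hUE, k, f, fun i => (hf i).mono hrU, fun w hw => ?_⟩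
    exact ⟨fun h => (hVU.subset ⟨h, hrU hw⟩).2, fun h => (hVU.superset ⟨hrU hw, h⟩).1⟩
  -- The interior of V is relatively closed in E: at a limit point the local equations vanish near
  -- some interior point, hence on the whole ball. Connectedness would make a nonempty interior all
  -- of E.
  have hint : ∀ z ∈ E, z ∉ interior V := by
    intro z hz hzi
    have hsub : E ⊆ interior V := by
      refine hEc.subset_of_closure_inter_subset isOpen_interior ⟨z, hz, hzi⟩ ?_
      rintro a ⟨haV, haE⟩
      obtain ⟨r, hr, hrE, k, f, hf, hfV⟩ := key a haE
      obtain ⟨c, hc, hcV⟩ := mem_closure_iff_nhds.1 haV _ (Metric.ball_mem_nhds a hr)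
      refine mem_interior.2 ⟨Metric.ball a r, fun w hw => ?_, Metric.isOpen_ball,
        Metric.mem_ball_self hr⟩
      refine (hfV w hw).2 fun i => ?_
      refine eqOn_zero_of_eventuallyEq_zero Metric.isOpen_ball (convex_ball _ _) (hf i) hc ?_ hw
      filter_upwards [Metric.isOpen_ball.mem_nhds hc, isOpen_interior.mem_nhds hcV] with y hy hy'
      exact (hfV y hy).1 (interior_subset hy') i
    exact hVE (hV.1.antisymm (hsub.trans interior_subset))
  obtain ⟨r, hr, hrE, k, f, hf, hfV⟩ := key z hz
  have hex : ∃ b ∈ Metric.ball z r, b ∉ V := by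
    by_contra hcon
    push Not at hcon
    exact hint z hz (mem_interior.2 ⟨_, hcon, Metric.isOpen_ball, Metric.mem_ball_self hr⟩)
  obtain ⟨b, hb, hbV⟩ := hex
  rw [hfV b hb] at hbV
  push Not at hbV
  obtain ⟨i, hi⟩ := hbV
  exact ⟨r, hr, hrE, f i, hf i, ⟨b, hb, hi⟩, fun w hw hwV => (hfV w hw).1 hwV i⟩

theorem IsAnalyticSubset.volume_eq_zero {n : ℕ} {E V : Set (Fin n → ℂ)}
    (hEc : IsPreconnected E) (hV : IsAnalyticSubset E V) (hVE : V ≠ E) : volume V = 0 := by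
  refine measure_null_of_locally_null _ fun z hz => ?_
  obtain ⟨r, hr, -, F, hF, ⟨b, hb, hFb⟩, hFV⟩ := hV.exists_ball hEc hVE (hV.1 hz)
  refine ⟨_, inter_mem (mem_nhdsWithin_of_mem_nhds (Metric.ball_mem_nhds z hr))
    self_mem_nhdsWithin, measure_mono_null ?_
    (volume_zeros_eq_zero Metric.isOpen_ball (convex_ball z r) hF hb hFb)⟩
  rintro w ⟨hw, hwV⟩
  exact ⟨hw, hFV w hw hwV⟩

/-- A nonempty open set has positive volume, so it cannot be contained in the null set V. -/
theorem IsAnalyticSubset.subset_closure_diff {n : ℕ} {E V : Set (Fin n → ℂ)} (hE : IsOpen E)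
    (hEc : IsPreconnected E) (hV : IsAnalyticSubset E V) (hVE : V ≠ E) :
    E ⊆ closure (E \ V) := by
  intro z hz
  rw [mem_closure_iff_nhds]
  intro t ht
  by_contra hne
  rw [not_nonempty_iff_eq_empty] at hne
  have hsub : t ∩ E ⊆ V := fun w hw => by
    by_contra hwV
    exact (hne.subset ⟨hw.1, hw.2, hwV⟩ : w ∈ (∅ : Set _))
  have hpos := Measure.measure_pos_of_mem_nhds volume (inter_mem ht (hE.mem_nhds hz))
  exact hpos.ne' (measure_mono_null hsub (hV.volume_eq_zero hEc hVE))

/-- A proper analytic subset does not disconnect a connected open set. -/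
theorem IsAnalyticSubset.isPreconnected_diff {n : ℕ} {E V : Set (Fin n → ℂ)} (hE : IsOpen E)
    (hEc : IsPreconnected E) (hV : IsAnalyticSubset E V) (hVE : V ≠ E) :
    IsPreconnected (E \ V) := by
  refine hEc.diff_of_locally (hV.subset_closure_diff hE hEc hVE) fun z hz => ?_
  obtain ⟨r, hr, hrE, F, hF, ⟨b, hb, hFb⟩, hFV⟩ := hV.exists_ball hEc hVE hz
  refine ⟨_, Metric.isOpen_ball, Metric.mem_ball_self hr, hrE, ?_⟩
  -- The ball minus V lies between the connected set of non-zeros of F and its closure.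
  refine (isPreconnected_nonzeros Metric.isOpen_ball (convex_ball z r) hF).subset_closure ?_ ?_
  · rintro w ⟨hw, hFw⟩
    exact ⟨hw, fun h => hFw (hFV w hw h)⟩
  · exact sdiff_subset.trans (dense_nonzeros Metric.isOpen_ball (convex_ball z r) hF hb hFb)

/-! ### Radó's theorem. -/

/-- Maximum principle on the complement of the zero set of `f`. -/
theorem norm_le_of_differentiableAt_of_ne_zero {f h : ℂ → ℂ}
    (hf : ContinuousOn f (Metric.closedBall 0 1)) (hh : ContinuousOn h (Metric.closedBall 0 1))
    (hfd : ∀ z ∈ Metric.ball (0 : ℂ) 1, f z ≠ 0 → DifferentiableAt ℂ f z)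
    (hhd : ∀ z ∈ Metric.ball (0 : ℂ) 1, f z ≠ 0 → DifferentiableAt ℂ h z)
    {M : ℝ} (hM : ∀ z ∈ Metric.sphere (0 : ℂ) 1, ‖h z‖ ≤ M) {α : ℂ}
    (hα : α ∈ Metric.ball (0 : ℂ) 1) (hfα : f α ≠ 0) : ‖h α‖ ≤ M := by
  set Ω : Set ℂ := Metric.ball 0 1 ∩ f ⁻¹' {0}ᶜ with hΩ
  have hΩo : IsOpen Ω := (hf.mono Metric.ball_subset_closedBall).isOpen_inter_preimage
    Metric.isOpen_ball isOpen_compl_singleton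
  have hcl : closure Ω ⊆ Metric.closedBall 0 1 :=
    Metric.isClosed_closedBall.closure_subset_iff.2
      (inter_subset_left.trans Metric.ball_subset_closedBall)
  obtain ⟨A, hA⟩ := (isCompact_closedBall (0 : ℂ) 1).exists_bound_of_continuousOn hf
  have hM0 : 0 ≤ M := (norm_nonneg _).trans (hM 1 (by simp))
  have hA0 : 0 ≤ A := (norm_nonneg _).trans (hA 0 (by simp))
  -- The maximum principle is applied to f·h^k on Ω: a frontier point either is a zero of f or lies
  -- on the unit circle. Letting k tend to infinity removes the influence of f.
  have hpow : ∀ k : ℕ, ‖f α‖ * ‖h α‖ ^ k ≤ A * M ^ k := by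
    intro k
    have hd : DiffContOnCl ℂ (fun z => f z * h z ^ k) Ω :=
      ⟨fun z hz => ((hfd z hz.1 hz.2).mul ((hhd z hz.1 hz.2).pow k)).differentiableWithinAt,
        (hf.mul (hh.pow k)).mono hcl⟩
    have := Complex.norm_le_of_forall_mem_frontier_norm_le (C := A * M ^ k)
      (Metric.isBounded_ball.subset inter_subset_left) hd ?_ (subset_closure ⟨hα, hfα⟩)
    · simpa using this
    · intro z hz
      have hzc := hcl hz.1
      have hzΩ : z ∉ Ω := fun h => hz.2 (hΩo.interior_eq.symm ▸ h)
      rw [norm_mul, norm_pow]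
      by_cases h0 : f z = 0
      · simp only [h0, norm_zero, zero_mul]; positivity
      · have hzs : z ∈ Metric.sphere (0 : ℂ) 1 := by
          rw [← Metric.closedBall_sdiff_ball]
          exact ⟨hzc, fun h => hzΩ ⟨h, h0⟩⟩
        gcongr
        · exact hA z hzc
        · exact hM z hzs
  by_contra! hlt
  have hpos : 0 < ‖h α‖ := hM0.trans_lt hlt
  have hq : ∀ k : ℕ, ‖f α‖ ≤ A * (M / ‖h α‖) ^ k := by
    intro k
    rw [div_pow, ← mul_div_assoc, le_div_iff₀ (by positivity)]
    exact hpow k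
  have hlim : Tendsto (fun k : ℕ => A * (M / ‖h α‖) ^ k) atTop (𝓝 (A * 0)) :=
    (tendsto_pow_atTop_nhds_zero_of_lt_one (by positivity)
      ((div_lt_one hpos).2 hlt)).const_mul A
  have := ge_of_tendsto' hlim hq
  rw [mul_zero] at this
  exact hfα (norm_le_zero_iff.1 this)

/-- The real part of a continuous function on the unit circle is uniformly approximated by real
parts of entire functions. -/
theorem exists_differentiable_re_approx {h : ℂ → ℂ}
    (hh : ContinuousOn h (Metric.sphere 0 1)) {ε : ℝ} (hε : 0 < ε) :
    ∃ p : ℂ → ℂ, Differentiable ℂ p ∧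
      ∀ z ∈ Metric.sphere (0 : ℂ) 1, |(h z).re - (p z).re| ≤ ε := by
  have : Fact (0 < 2 * Real.pi) := ⟨by positivity⟩
  set g : C(AddCircle (2 * Real.pi), ℂ) :=
    ⟨fun x => h (AddCircle.toCircle x), by
      refine hh.comp_continuous ?_ fun x => (AddCircle.toCircle x).2
      exact continuous_subtype_val.comp AddCircle.continuous_toCircle⟩ with hg
  -- A trigonometric polynomial on the circle is p plus the conjugate of q with p, q entire, and its
  -- real part is that of p + q.
  have hspan : ∀ u ∈ Submodule.span ℂ (range (fourier (T := 2 * Real.pi))),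
      ∃ p q : ℂ → ℂ, Differentiable ℂ p ∧ Differentiable ℂ q ∧ ∀ x,
        u x = p (AddCircle.toCircle x) + (starRingEnd ℂ) (q (AddCircle.toCircle x)) := by
    intro u hu
    induction hu using Submodule.span_induction with
    | mem u hu =>
      obtain ⟨m, rfl⟩ := hu
      obtain ⟨k, rfl | rfl⟩ := m.eq_nat_or_neg
      · refine ⟨fun z => z ^ k, 0, by fun_prop, differentiable_const 0, fun x => ?_⟩
        rw [fourier_apply, AddCircle.toCircle_zsmul]; simp
      · refine ⟨0, fun z => z ^ k, differentiable_const 0, by fun_prop, fun x => ?_⟩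
        rw [fourier_neg, fourier_apply, AddCircle.toCircle_zsmul]; simp
    | zero => exact ⟨0, 0, differentiable_const 0, differentiable_const 0, by simp⟩
    | add u v _ _ hu hv =>
      obtain ⟨p, q, hp, hq, hu⟩ := hu
      obtain ⟨p', q', hp', hq', hv⟩ := hv
      refine ⟨p + p', q + q', hp.add hp', hq.add hq', fun x => ?_⟩
      simp only [ContinuousMap.add_apply, hu, hv, Pi.add_apply, map_add]; ring
    | smul c u _ hu =>
      obtain ⟨p, q, hp, hq, hu⟩ := hu
      refine ⟨c • p, (starRingEnd ℂ c) • q, hp.const_smul c, hq.const_smul _, fun x => ?_⟩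
      simp only [ContinuousMap.smul_apply, hu, Pi.smul_apply, smul_eq_mul, map_mul,
        Complex.conj_conj]; ring
  have hmem : g ∈ (Submodule.span ℂ (range (fourier (T := 2 * Real.pi)))).topologicalClosure := by
    rw [span_fourier_closure_eq_top]; trivial
  obtain ⟨u, hu, hgu⟩ := Metric.mem_closure_iff.1 hmem ε hε
  obtain ⟨p, q, hp, hq, hpq⟩ := hspan u hu
  refine ⟨p + q, hp.add hq, fun z hz => ?_⟩
  obtain ⟨x, hx⟩ := (AddCircle.homeomorphCircle (T := 2 * Real.pi) (by positivity)).surjective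
    ⟨z, hz⟩
  have hx' : (AddCircle.toCircle x : ℂ) = z := by
    rw [← AddCircle.homeomorphCircle_apply (by positivity), hx]
  have h1 : ‖g x - u x‖ ≤ ε := by
    rw [← dist_eq_norm]; exact (ContinuousMap.dist_apply_le_dist x).trans hgu.le
  have h2 : ((p + q) z).re = (u x).re := by
    rw [hpq, hx']; simp
  have h3 : (h z).re = (g x).re := by simp [hg, hx']
  rw [h2, h3, ← Complex.sub_re]
  exact (Complex.abs_re_le_norm _).trans h1

theorem continuousOn_poissonKernel {α : ℂ} (hα : α ∈ Metric.ball (0 : ℂ) 1) :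
    ContinuousOn (poissonKernel 0 α) (Metric.sphere 0 1) := by
  have h := continuousOn_herglotzRieszKernel_sphere (c := 0) (R := 1) hα
  rw [abs_one] at h
  rw [poissonKernel_eq_re_herglotzRieszKernel]
  exact Complex.continuous_re.comp_continuousOn h

theorem poissonKernel_nonneg {α : ℂ} (hα : α ∈ Metric.ball (0 : ℂ) 1) {z : ℂ}
    (hz : z ∈ Metric.sphere (0 : ℂ) 1) : 0 ≤ poissonKernel 0 α z := by
  rw [poissonKernel_def]
  have h1 : ‖α‖ < 1 := by simpa using hα
  have h2 : ‖z‖ = 1 := by simpa using hz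
  refine div_nonneg ?_ (by positivity)
  rw [sub_zero, sub_zero, h2]
  nlinarith [norm_nonneg α]

theorem circleIntegrable_poissonKernel_smul {Y : Type*} [NormedAddCommGroup Y] [NormedSpace ℝ Y]
    {α : ℂ} (hα : α ∈ Metric.ball (0 : ℂ) 1) {h : ℂ → Y}
    (hh : ContinuousOn h (Metric.sphere 0 1)) :
    CircleIntegrable (poissonKernel 0 α • h) 0 1 :=
  ((continuousOn_poissonKernel hα).smul hh).circleIntegrable zero_le_one

/-- Approximate Re h on the circle by Re p with p entire. The maximum principle off the zeros of f,
applied to exp(p - h), bounds Re p(α) by Re h(α) + ε/2, while the Poisson formula for p and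
positivity of the kernel bound the average of Re h by Re p(α) + ε/2. -/
theorem circleAverage_poissonKernel_smul_re_le {f h : ℂ → ℂ}
    (hf : ContinuousOn f (Metric.closedBall 0 1)) (hh : ContinuousOn h (Metric.closedBall 0 1))
    (hfd : ∀ z ∈ Metric.ball (0 : ℂ) 1, f z ≠ 0 → DifferentiableAt ℂ f z)
    (hhd : ∀ z ∈ Metric.ball (0 : ℂ) 1, f z ≠ 0 → DifferentiableAt ℂ h z) {α : ℂ}
    (hα : α ∈ Metric.ball (0 : ℂ) 1) (hfα : f α ≠ 0) :
    Real.circleAverage (poissonKernel 0 α • fun z => (h z).re) 0 1 ≤ (h α).re := by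
  refine le_of_forall_pos_le_add fun ε hε => ?_
  obtain ⟨p, hp, hph⟩ := exists_differentiable_re_approx
    (hh.mono Metric.sphere_subset_closedBall) (half_pos hε)
  have h1 : (p α).re - (h α).re ≤ ε / 2 := by
    have := norm_le_of_differentiableAt_of_ne_zero (h := fun z => Complex.exp (p z - h z))
      (M := Real.exp (ε / 2)) hf ((hp.continuous.continuousOn.sub hh).cexp) hfd
      (fun z hz hz' => ((hp z).sub (hhd z hz hz')).cexp) (fun z hz => ?_) hα hfα
    · rwa [Complex.norm_exp, Real.exp_le_exp, Complex.sub_re] at this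
    · rw [Complex.norm_exp, Real.exp_le_exp, Complex.sub_re]
      linarith [(abs_le.1 (hph z hz)).1]
  have hP : Real.circleAverage (poissonKernel 0 α • fun z => p z + (ε / 2 : ℝ)) 0 1 =
      p α + (ε / 2 : ℝ) :=
    DiffContOnCl.circleAverage_poissonKernel_smul (f := fun z => p z + (ε / 2 : ℝ))
      ((hp.add_const _).diffContOnCl) hα
  have hcont : ContinuousOn (fun z => p z + (ε / 2 : ℝ)) (Metric.sphere 0 1) :=
    (hp.continuous.add continuous_const).continuousOn
  have hre := Complex.reCLM.circleAverage_comp_comm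
    (circleIntegrable_poissonKernel_smul hα hcont)
  rw [hP] at hre
  have hle : Real.circleAverage (poissonKernel 0 α • fun z => (h z).re) 0 1 ≤
      Real.circleAverage (Complex.reCLM ∘ (poissonKernel 0 α • fun z => p z + (ε / 2 : ℝ))) 0 1 := by
    refine Real.circleAverage_mono (circleIntegrable_poissonKernel_smul hα
      (Complex.continuous_re.comp_continuousOn (hh.mono Metric.sphere_subset_closedBall)))
      ?_ fun z hz => ?_
    · exact (Complex.continuous_re.comp_continuousOn
        ((continuousOn_poissonKernel hα).smul hcont)).circleIntegrable zero_le_one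
    · rw [abs_one] at hz
      have h2 := poissonKernel_nonneg hα hz
      have h3 := (abs_le.1 (hph z hz)).2
      simp only [Pi.smul_apply', Function.comp_apply, smul_eq_mul, Complex.reCLM_apply,
        Complex.smul_re, Complex.add_re, Complex.ofReal_re]
      gcongr
      linarith
  rw [hre] at hle
  simp only [Complex.reCLM_apply, Complex.add_re, Complex.ofReal_re] at hle
  linarith

/-- Poisson formula at points where `f` does not vanish. -/
theorem circleAverage_poissonKernel_smul_of_ne_zero {f h : ℂ → ℂ}
    (hf : ContinuousOn f (Metric.closedBall 0 1)) (hh : ContinuousOn h (Metric.closedBall 0 1))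
    (hfd : ∀ z ∈ Metric.ball (0 : ℂ) 1, f z ≠ 0 → DifferentiableAt ℂ f z)
    (hhd : ∀ z ∈ Metric.ball (0 : ℂ) 1, f z ≠ 0 → DifferentiableAt ℂ h z) {α : ℂ}
    (hα : α ∈ Metric.ball (0 : ℂ) 1) (hfα : f α ≠ 0) :
    Real.circleAverage (poissonKernel 0 α • h) 0 1 = h α := by
  -- The one-sided inequality holds for every multiple of h. The choices c = ±1 and c = ±i give
  -- equality of real and imaginary parts.
  have key : ∀ c : ℂ, (c * Real.circleAverage (poissonKernel 0 α • h) 0 1).re ≤ (c * h α).re := by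
    intro c
    have h1 := circleAverage_poissonKernel_smul_re_le (h := fun z => c * h z) hf
      (continuousOn_const.mul hh) hfd (fun z hz hz' => (hhd z hz hz').const_mul c) hα hfα
    have h2 := (Complex.reCLM.comp ((ContinuousLinearMap.mul ℝ ℂ) c)).circleAverage_comp_comm
      (circleIntegrable_poissonKernel_smul hα (hh.mono Metric.sphere_subset_closedBall))
    have h3 : (Complex.reCLM.comp ((ContinuousLinearMap.mul ℝ ℂ) c)) ∘ (poissonKernel 0 α • h) =
        (poissonKernel 0 α • fun z => (c * h z).re) := by
      ext z
      simp only [Function.comp_apply, Pi.smul_apply', ContinuousLinearMap.comp_apply,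
        ContinuousLinearMap.mul_apply', mul_smul_comm, Complex.reCLM_apply, Complex.smul_re]
    rw [h3] at h2
    rw [h2] at h1
    simpa using h1
  apply Complex.ext
  · have h1 := key 1
    have h2 := key (-1)
    simp only [one_mul, neg_mul, Complex.neg_re] at h1 h2
    linarith
  · have h1 := key Complex.I
    have h2 := key (-Complex.I)
    simp only [neg_mul, Complex.neg_re, Complex.I_mul_re] at h1 h2
    linarith

/-- **Radó's theorem** on the unit disc: a continuous function which is holomorphic where it does
not vanish is holomorphic. -/
theorem differentiableOn_of_differentiableAt_of_ne_zero {f : ℂ → ℂ}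
    (hf : ContinuousOn f (Metric.closedBall 0 1))
    (hfd : ∀ z ∈ Metric.ball (0 : ℂ) 1, f z ≠ 0 → DifferentiableAt ℂ f z) :
    DifferentiableOn ℂ f (Metric.ball 0 1) := by
  have hsph := hf.mono Metric.sphere_subset_closedBall
  -- Half of the Herglotz kernel plus one is ζ/(ζ - w), so F is the Cauchy integral of the boundary
  -- values of f.
  set F : ℂ → ℂ := fun w => (1 / 2 : ℂ) *
    (Real.circleAverage (fun ζ => herglotzRieszKernel 0 w ζ • f ζ) 0 1 +
      Real.circleAverage f 0 1) with hF
  have hFd : DifferentiableOn ℂ F (Metric.ball 0 1) :=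
    ((differentiableOn_circleAverage_herglotzRieszKernel_smul
      (hsph.circleIntegrable zero_le_one)).add_const _).const_mul _
  have hFf : ∀ α ∈ Metric.ball (0 : ℂ) 1, f α ≠ 0 → F α = f α := by
    intro α hα hfα
    have hid : ContinuousOn (fun z : ℂ => z - α) (Metric.closedBall 0 1) := by fun_prop
    have h1 := circleAverage_poissonKernel_smul_of_ne_zero hf hf hfd hfd hα hfα
    have h2 := circleAverage_poissonKernel_smul_of_ne_zero (h := fun z => (z - α) * f z) hf
      (hid.mul hf) hfd
      (fun z hz hz' => ((differentiableAt_id.sub_const α).mul (hfd z hz hz'))) hα hfα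
    have hα1 : ‖α‖ < 1 := by simpa using hα
    have hden : (1 - α * (starRingEnd ℂ) α : ℂ) ≠ 0 := by
      rw [Complex.mul_conj, Complex.normSq_eq_norm_sq]
      norm_cast
      nlinarith [norm_nonneg α]
    set c : ℂ := (starRingEnd ℂ) α / (1 - α * (starRingEnd ℂ) α) with hc
    -- On the circle the Poisson kernel equals the Cauchy kernel plus c(z - α) times the Poisson
    -- kernel. The Poisson integral of (z - α)f vanishes at α, so the Cauchy and Poisson integrals
    -- of f agree there.
    have hker : EqOn (poissonKernel 0 α • f) ((1 / 2 : ℂ) •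
        ((fun ζ => herglotzRieszKernel 0 α ζ • f ζ) + f) +
          c • (poissonKernel 0 α • fun z => (z - α) * f z)) (Metric.sphere 0 |1|) := by
      intro z hz
      rw [abs_one] at hz
      have hz1 : ‖z‖ = 1 := by simpa using hz
      have hzz : z * (starRingEnd ℂ) z = 1 := by
        rw [Complex.mul_conj, Complex.normSq_eq_norm_sq, hz1]; simp
      have hne : z - α ≠ 0 := by
        intro h
        rw [sub_eq_zero] at h
        rw [h] at hz1; linarith
      have hne' : (starRingEnd ℂ) z - (starRingEnd ℂ) α ≠ 0 := by
        rw [← map_sub]; exact (map_ne_zero _).2 hne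
      have hPk : ((poissonKernel 0 α z : ℝ) : ℂ) =
          (1 - α * (starRingEnd ℂ) α) /
            ((z - α) * ((starRingEnd ℂ) z - (starRingEnd ℂ) α)) := by
        rw [poissonKernel_def, ← map_sub (starRingEnd ℂ), Complex.mul_conj, Complex.mul_conj,
          Complex.normSq_eq_norm_sq, Complex.normSq_eq_norm_sq]
        simp [hz1]
      simp only [Pi.smul_apply', Pi.add_apply, Pi.smul_apply, smul_eq_mul, Complex.real_smul,
        hPk, herglotzRieszKernel_def, sub_zero, hc]
      field_simp
      linear_combination (-2 * f z) * hzz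
    have hI1 : CircleIntegrable (fun ζ => herglotzRieszKernel 0 α ζ • f ζ) 0 1 := by
      refine ContinuousOn.circleIntegrable zero_le_one ?_
      have h := continuousOn_herglotzRieszKernel_sphere (c := 0) (R := 1) hα
      rw [abs_one] at h
      exact h.smul hsph
    have hI2 := hsph.circleIntegrable zero_le_one
    have hI3 := circleIntegrable_poissonKernel_smul (h := fun z => (z - α) * f z) hα
      ((hid.mul hf).mono Metric.sphere_subset_closedBall)
    have hsum := Real.circleAverage_congr_sphere hker
    rw [Real.circleAverage_add ((hI1.add hI2).const_smul) hI3.const_smul,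
      Real.circleAverage_smul, Real.circleAverage_smul, Real.circleAverage_add hI1 hI2, h2, h1]
      at hsum
    rw [hsum, hF]
    simp
  by_cases hne : ∃ a ∈ Metric.ball (0 : ℂ) 1, f a ≠ 0
  · obtain ⟨a, ha, hfa⟩ := hne
    have hZ := DifferentiableOn.countable_zeros Metric.isOpen_ball Metric.isPreconnected_ball hFd ha
      (by rwa [hFf a ha hfa])
    set Z : Set ℂ := {t | t ∈ Metric.ball (0 : ℂ) 1 ∧ F t = 0} with hZdef
    have hpc : IsPreconnected (Metric.ball (0 : ℂ) 1 \ Z) :=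
      IsPreconnected.diff_countable Metric.isOpen_ball Metric.isPreconnected_ball hZ
    have hfb := hf.mono (Metric.ball_subset_closedBall (x := (0 : ℂ)) (ε := 1))
    -- The sets {f ≠ 0} and {f ≠ F} are open and disjoint and cover the disc off the zeros of F. A
    -- point with f ≠ F has f = 0 and F ≠ 0, so both sets would meet this connected set.
    set u : Set ℂ := Metric.ball 0 1 ∩ f ⁻¹' {0}ᶜ with hu
    set v : Set ℂ := Metric.ball 0 1 ∩ (fun z => f z - F z) ⁻¹' {0}ᶜ with hv
    have huo : IsOpen u := hfb.isOpen_inter_preimage Metric.isOpen_ball isOpen_compl_singleton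
    have hvo : IsOpen v :=
      (hfb.sub hFd.continuousOn).isOpen_inter_preimage Metric.isOpen_ball isOpen_compl_singleton
    have heq : EqOn f F (Metric.ball 0 1) := by
      intro z hz
      by_contra hzne
      have hfz : f z = 0 := by
        by_contra h
        exact hzne (hFf z hz h).symm
      obtain ⟨w, -, ⟨hw, hwu⟩, -, hwv⟩ := hpc u v huo hvo
        (fun w hw => by
          by_cases h : f w = 0
          · refine Or.inr ⟨hw.1, fun h' => hw.2 ⟨hw.1, ?_⟩⟩
            have h'' : f w - F w = 0 := h'
            rw [h, zero_sub, neg_eq_zero] at h''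
            exact h''
          · exact Or.inl ⟨hw.1, h⟩)
        ⟨a, ⟨ha, fun h => hfa (by rw [← hFf a ha hfa]; exact h.2)⟩, ha, hfa⟩
        ⟨z, ⟨hz, fun h => hzne (by rw [hfz, h.2])⟩, hz, sub_ne_zero.2 hzne⟩
      exact hwv (by simp [hFf w hw hwu])
    exact hFd.congr heq
  · push Not at hne
    exact (differentiableOn_const 0).congr hne

/-! ### Continuous right inverses of holomorphic maps. -/

/-- The real determinant is the norm from ℂ to ℝ of the complex one. This puts |J|² into every
change of variables. -/
theorem det_restrictScalars_eq {n : ℕ} (L : (Fin n → ℂ) →L[ℂ] (Fin n → ℂ)) :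
    (L.restrictScalars ℝ).det = ‖L.det‖ ^ 2 := by
  have h := LinearMap.det_restrictScalars (R := ℝ) (f := (L : (Fin n → ℂ) →ₗ[ℂ] (Fin n → ℂ)))
  rw [Algebra.norm_complex_apply, Complex.normSq_eq_norm_sq] at h
  exact h

/-- Points where the derivative of `π` is invertible. -/
theorem hasFDerivAt_of_rightInverse {n : ℕ} {U B : Set (Fin n → ℂ)} (hU : IsOpen U)
    (hB : IsOpen B) {π φ : (Fin n → ℂ) → (Fin n → ℂ)} (hπ : DifferentiableOn ℂ π U)
    (hφ : ContinuousOn φ B) (hmap : MapsTo φ B U) (hinv : ∀ w ∈ B, π (φ w) = w)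
    {w : Fin n → ℂ} (hw : w ∈ B) (hJ : jacobian π (φ w) ≠ 0) : DifferentiableAt ℂ φ w := by
  have hJ' : (fderiv ℂ π (φ w)).det ≠ 0 := hJ
  have h1 : HasFDerivAt π (fderiv ℂ π (φ w)) (φ w) :=
    ((hπ _ (hmap hw)).differentiableAt (hU.mem_nhds (hmap hw))).hasFDerivAt
  have h2 : HasFDerivAt π (((fderiv ℂ π (φ w)).toContinuousLinearEquivOfDetNeZero hJ' :
      (Fin n → ℂ) ≃L[ℂ] (Fin n → ℂ)) : (Fin n → ℂ) →L[ℂ] (Fin n → ℂ)) (φ w) := by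
    rwa [ContinuousLinearMap.coe_toContinuousLinearEquivOfDetNeZero]
  exact (HasFDerivAt.of_local_left_inverse (hφ.continuousAt (hB.mem_nhds hw)) h2
    (by filter_upwards [hB.mem_nhds hw] with y hy using hinv y hy)).differentiableAt

/-- **Sard's lemma** for a right inverse. -/
theorem volume_jacobian_rightInverse_eq_zero {n : ℕ} {U B : Set (Fin n → ℂ)} (hU : IsOpen U)
    {π φ : (Fin n → ℂ) → (Fin n → ℂ)} (hπ : DifferentiableOn ℂ π U)
    (hmap : MapsTo φ B U) (hinv : ∀ w ∈ B, π (φ w) = w) :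
    volume {w | w ∈ B ∧ jacobian π (φ w) = 0} = 0 := by
  have h := addHaar_image_eq_zero_of_det_fderivWithin_eq_zero (μ := volume) (f := π)
    (s := {z | z ∈ U ∧ jacobian π z = 0}) (f' := fun z => (fderiv ℂ π z).restrictScalars ℝ)
    (fun z hz => ((hπ z hz.1).differentiableAt
      (hU.mem_nhds hz.1)).hasFDerivAt.restrictScalars ℝ |>.hasFDerivWithinAt)
    (fun z hz => by
      rw [det_restrictScalars_eq]
      have : (fderiv ℂ π z).det = 0 := hz.2
      simp [this])
  refine measure_mono_null ?_ h
  rintro w ⟨hw, hJ⟩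
  exact ⟨φ w, ⟨hmap hw, hJ⟩, hinv w hw⟩

/-- A continuous right inverse of a holomorphic map in the same dimension is holomorphic. -/
theorem differentiableOn_of_rightInverse {n : ℕ} {U B : Set (Fin n → ℂ)} (hU : IsOpen U)
    (hB : IsOpen B) {π φ : (Fin n → ℂ) → (Fin n → ℂ)} (hπ : DifferentiableOn ℂ π U)
    (hφ : ContinuousOn φ B) (hmap : MapsTo φ B U) (hinv : ∀ w ∈ B, π (φ w) = w) :
    DifferentiableOn ℂ φ B := by
  set g : (Fin n → ℂ) → ℂ := fun w => jacobian π (φ w) with hg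
  have hJd := differentiableOn_jacobian hU hπ
  have hgc : ContinuousOn g B := hJd.continuousOn.comp hφ hmap
  have hφd : ∀ w ∈ B, g w ≠ 0 → DifferentiableAt ℂ φ w := fun w hw hgw =>
    hasFDerivAt_of_rightInverse hU hB hπ hφ hmap hinv hw hgw
  have hgd : ∀ w ∈ B, g w ≠ 0 → DifferentiableAt ℂ g w := fun w hw hgw =>
    ((hJd _ (hmap hw)).differentiableAt (hU.mem_nhds (hmap hw))).comp w (hφd w hw hgw)
  intro w₀ hw₀
  obtain ⟨ρ, hρ, hρB⟩ := Metric.isOpen_iff.1 hB w₀ hw₀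
  -- By Sard's lemma the zero set of g is null, so it contains no ball.
  obtain ⟨w₁, hw₁, hgw₁⟩ : ∃ w₁ ∈ Metric.ball w₀ (ρ / 4), g w₁ ≠ 0 := by
    by_contra hcon
    push Not at hcon
    refine (Metric.measure_ball_pos volume w₀ (by positivity : 0 < ρ / 4)).ne'
      (measure_mono_null (fun w hw => ?_) (volume_jacobian_rightInverse_eq_zero hU hπ hmap hinv))
    exact ⟨hρB (Metric.ball_subset_ball (by linarith) hw), hcon w hw⟩
  -- The factor 2 places w₁ at parameter 1/2, inside the unit disc of the slice w₀ + te, on which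
  -- Radó's theorem makes g holomorphic.
  set e : Fin n → ℂ := (2 : ℂ) • (w₁ - w₀) with he
  have hen : ‖e‖ < ρ / 2 := by
    rw [he, norm_smul, ← dist_eq_norm]
    have : dist w₁ w₀ < ρ / 4 := hw₁
    simp only [Complex.norm_ofNat]; linarith
  have hmem : ∀ w ∈ Metric.ball w₀ (ρ / 2), ∀ t ∈ Metric.closedBall (0 : ℂ) 1, w + t • e ∈ B := by
    intro w hw t ht
    apply hρB
    have ht' : ‖t‖ ≤ 1 := by simpa using ht
    have h1 : dist (w + t • e) w = ‖t‖ * ‖e‖ := by simp [norm_smul]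
    rw [Metric.mem_ball] at hw ⊢
    nlinarith [dist_triangle (w + t • e) w w₀, norm_nonneg e]
  have hsd : ∀ w ∈ Metric.ball w₀ (ρ / 2),
      DifferentiableOn ℂ (fun t : ℂ => g (w + t • e)) (Metric.ball 0 1) := by
    intro w hw
    refine differentiableOn_of_differentiableAt_of_ne_zero
      (hgc.comp (by fun_prop) (hmem w hw)) fun t ht h0 => ?_
    exact (hgd _ (hmem w hw t (Metric.ball_subset_closedBall ht)) h0).comp t
      (f := fun t : ℂ => w + t • e) (by fun_prop)
  have hw₀' : w₀ ∈ Metric.ball w₀ (ρ / 2) := Metric.mem_ball_self (half_pos hρ)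
  obtain ⟨r, hr0, hr1, hgr⟩ : ∃ r : ℝ, 0 < r ∧ r < 1 ∧
      ∀ t ∈ Metric.sphere (0 : ℂ) r, g (w₀ + t • e) ≠ 0 := by
    have han := (hsd w₀ hw₀').analyticOnNhd Metric.isOpen_ball
    have h0 : (0 : ℂ) ∈ Metric.ball (0 : ℂ) 1 := Metric.mem_ball_self one_pos
    rcases (han 0 h0).eventually_eq_zero_or_eventually_ne_zero with h | h
    · have h2 := han.eqOn_zero_of_preconnected_of_eventuallyEq_zero Metric.isPreconnected_ball h0 h
        (show (1 / 2 : ℂ) ∈ Metric.ball (0 : ℂ) 1 by simp; norm_num)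
      refine absurd ?_ hgw₁
      simpa [he, smul_smul] using h2
    · rw [eventually_nhdsWithin_iff, Metric.eventually_nhds_iff_ball] at h
      obtain ⟨ε, hε, h⟩ := h
      refine ⟨min (ε / 2) (1 / 2), by positivity, by
        have := min_le_right (ε / 2) (1 / 2); linarith, fun t ht => ?_⟩
      rw [mem_sphere_zero_iff_norm] at ht
      refine h t ?_ ?_
      · rw [mem_ball_zero_iff, ht]
        have := min_le_left (ε / 2) (1 / 2); linarith
      · rintro rfl
        rw [norm_zero] at ht
        have : 0 < min (ε / 2) (1 / 2 : ℝ) := by positivity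
        linarith
  have hcirc : ∀ θ, w₀ + circleMap 0 r θ • e ∈ B ∩ g ⁻¹' {0}ᶜ := fun θ =>
    ⟨hmem w₀ hw₀' _ (by simp [abs_of_pos hr0, hr1.le]),
      hgr _ (circleMap_mem_sphere 0 hr0.le θ)⟩
  have hUo : IsOpen (B ∩ g ⁻¹' {0}ᶜ) := hgc.isOpen_inter_preimage hB isOpen_compl_singleton
  refine DifferentiableAt.differentiableWithinAt (differentiableAt_pi.2 fun i => ?_)
  have hd : DifferentiableOn ℂ (fun w => φ w i) (B ∩ g ⁻¹' {0}ᶜ) := fun w hw =>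
    (differentiableAt_pi.1 (hφd w hw.1 hw.2) i).differentiableWithinAt
  -- For w near w₀, φ is continuous on the slice through w and holomorphic off the countable zeros
  -- of g, so φ(w) is its mean over the circle of radius r. The circle around w₀ avoids those zeros,
  -- so the mean is holomorphic at w₀.
  have hG := differentiableAt_integral_circleMap hUo hd (k := fun _ => 1) continuous_const hcirc
  refine (hG.const_smul ((2 * Real.pi)⁻¹ : ℝ)).congr_of_eventuallyEq ?_
  have hev : ∀ᶠ w in 𝓝 w₀, w + (r : ℂ) • e ∈ B ∩ g ⁻¹' {0}ᶜ := by
    have hct : Continuous fun w : Fin n → ℂ => w + (r : ℂ) • e := by fun_prop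
    have h0 := hcirc 0
    exact hct.continuousAt.eventually (hUo.mem_nhds (by simpa [circleMap] using h0))
  filter_upwards [hev, Metric.ball_mem_nhds w₀ (half_pos hρ)] with w hw hwb
  have hZ := DifferentiableOn.countable_zeros Metric.isOpen_ball Metric.isPreconnected_ball
    (hsd w hwb) (a := (r : ℂ)) (by simp [abs_of_pos hr0, hr1]) hw.2
  have hsub : Metric.closedBall (0 : ℂ) |r| ⊆ Metric.ball 0 1 := by
    rw [abs_of_pos hr0]; exact Metric.closedBall_subset_ball hr1
  have havg := circleAverage_of_differentiable_on_off_countable (c := 0) (R := r)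
    (f := fun t : ℂ => φ (w + t • e) i) hZ ?_ ?_
  · rw [Real.circleAverage_def] at havg
    simpa using havg.symm
  · have h1 : ContinuousOn (fun w => φ w i) B := continuousOn_pi.1 hφ i
    exact h1.comp (by fun_prop) fun t ht =>
      hmem w hwb t (Metric.ball_subset_closedBall (hsub ht))
  · rintro t ⟨ht, htZ⟩
    have htb := hsub (Metric.ball_subset_closedBall ht)
    have h2 : g (w + t • e) ≠ 0 := fun h => htZ ⟨htb, h⟩
    exact (differentiableAt_pi.1 (hφd _ (hmem w hwb t (Metric.ball_subset_closedBall htb)) h2)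
      i).comp t (f := fun t : ℂ => w + t • e) (by fun_prop)

theorem jacobian_comp {n : ℕ} {f g : (Fin n → ℂ) → (Fin n → ℂ)} {z : Fin n → ℂ}
    (hf : DifferentiableAt ℂ f (g z)) (hg : DifferentiableAt ℂ g z) :
    jacobian (f ∘ g) z = jacobian f (g z) * jacobian g z := by
  rw [jacobian, fderiv_comp z hf hg, jacobian, jacobian, ContinuousLinearMap.det]
  exact LinearMap.det_comp _ _

theorem jacobian_congr {n : ℕ} {f g : (Fin n → ℂ) → (Fin n → ℂ)} {z : Fin n → ℂ}
    (h : f =ᶠ[𝓝 z] g) : jacobian f z = jacobian g z := by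
  rw [jacobian, jacobian, h.fderiv_eq]

theorem jacobian_id {n : ℕ} (z : Fin n → ℂ) : jacobian id z = 1 := by
  rw [jacobian, fderiv_id, ContinuousLinearMap.det]
  exact LinearMap.det_id

/-- The chain rule for π ∘ φ = id, once φ is known to be holomorphic. -/
theorem jacobian_rightInverse {n : ℕ} {U B : Set (Fin n → ℂ)} (hU : IsOpen U)
    (hB : IsOpen B) {π φ : (Fin n → ℂ) → (Fin n → ℂ)} (hπ : DifferentiableOn ℂ π U)
    (hφ : ContinuousOn φ B) (hmap : MapsTo φ B U) (hinv : ∀ w ∈ B, π (φ w) = w)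
    {w : Fin n → ℂ} (hw : w ∈ B) : jacobian π (φ w) * jacobian φ w = 1 := by
  have hφd := differentiableOn_of_rightInverse hU hB hπ hφ hmap hinv
  rw [← jacobian_comp ((hπ _ (hmap hw)).differentiableAt (hU.mem_nhds (hmap hw)))
    ((hφd w hw).differentiableAt (hB.mem_nhds hw)), ← jacobian_id w]
  exact jacobian_congr (by filter_upwards [hB.mem_nhds hw] with y hy using hinv y hy)

/-! ### Extension of square-integrable holomorphic functions. -/

/-- Sub-mean value property of squares of holomorphic functions of one variable. -/
theorem enorm_sq_mul_volume_closedBall_le {S : Set ℂ} (hS : IsOpen S) {h : ℂ → ℂ}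
    (hh : DifferentiableOn ℂ h S) {z : ℂ} {r : ℝ} (hr : Metric.closedBall z r ⊆ S) :
    ‖h z‖ₑ ^ 2 * volume (Metric.closedBall z r) ≤ ∫⁻ w in Metric.closedBall z r, ‖h w‖ₑ ^ 2 := by
  have hmp : MeasurePreserving (MeasurableEquiv.funUnique (Fin 1) ℂ) :=
    volume_preserving_funUnique (Fin 1) ℂ
  have hev : ∀ w : Fin 1 → ℂ, MeasurableEquiv.funUnique (Fin 1) ℂ w = w 0 := fun w => rfl
  have hpre : (MeasurableEquiv.funUnique (Fin 1) ℂ) ⁻¹' Metric.closedBall z r =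
      Metric.closedBall (fun _ => z) r := by
    ext w
    rw [mem_preimage, hev, Metric.mem_closedBall, Metric.mem_closedBall]
    have : w = fun _ => w 0 := by ext i; rw [Subsingleton.elim i 0]
    conv_rhs => rw [this]
    rw [dist_pi_const]
  have hSo : IsOpen ((fun w : Fin 1 → ℂ => w 0) ⁻¹' S) := hS.preimage (by fun_prop)
  have hd : DifferentiableOn ℂ (fun w : Fin 1 → ℂ => h (w 0) ^ 2)
      ((fun w : Fin 1 → ℂ => w 0) ⁻¹' S) := by
    refine DifferentiableOn.pow ?_ 2
    exact hh.comp (by fun_prop) fun w hw => hw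
  have hcl : MeasurableSet (Metric.closedBall z r) := Metric.isClosed_closedBall.measurableSet
  have key := enorm_mul_volume_closedBall_le hSo hd (z := fun _ => z) (r := r)
    (fun w hw => by
      rw [← hpre] at hw
      exact hr hw)
  rw [← hpre, hmp.measure_preimage hcl.nullMeasurableSet] at key
  have h2 := hmp.setLIntegral_comp_preimage_emb
    (MeasurableEquiv.measurableEmbedding _) (fun w => ‖h w‖ₑ ^ 2) (Metric.closedBall z r)
  rw [← h2]
  simpa [enorm_pow, hev] using key

/-- An isolated singularity of a square integrable holomorphic function is removable. -/
theorem exists_differentiableAt_update_of_lintegral_lt_top {h : ℂ → ℂ} {c : ℂ} {ρ : ℝ}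
    (hρ : 0 < ρ) (hd : DifferentiableOn ℂ h (Metric.ball c ρ \ {c}))
    (hL : ∫⁻ w in Metric.ball c ρ, ‖h w‖ₑ ^ 2 ≠ ∞) :
    ∃ l, DifferentiableOn ℂ (Function.update h c l) (Metric.ball c ρ) := by
  refine ⟨_, Complex.differentiableOn_update_limUnder_of_isLittleO
    (Metric.ball_mem_nhds c hρ) hd ?_⟩
  have hlim : Tendsto (fun z => (z - c) * h z) (𝓝[≠] c) (𝓝 0) := by
    have hint : Tendsto (fun z => ∫⁻ w in Metric.closedBall z (‖z - c‖ / 2),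
        ‖h w‖ₑ ^ 2 ∂(volume.restrict (Metric.ball c ρ))) (𝓝[≠] c) (𝓝 0) := by
      refine tendsto_setLIntegral_zero hL ?_
      have hvol : Tendsto (fun z : ℂ => volume (Metric.closedBall z (‖z - c‖ / 2)))
          (𝓝[≠] c) (𝓝 0) := by
        simp_rw [Complex.volume_closedBall]
        have : Continuous fun z : ℂ => ENNReal.ofReal (‖z - c‖ / 2) ^ 2 * (NNReal.pi : ℝ≥0∞) := by
          refine ENNReal.continuous_mul_const ENNReal.coe_ne_top |>.comp ?_
          exact (ENNReal.continuous_pow 2).comp (ENNReal.continuous_ofReal.comp (by fun_prop))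
        have h0 := this.tendsto c
        simp only [sub_self, norm_zero, zero_div, ENNReal.ofReal_zero, ne_eq, OfNat.ofNat_ne_zero,
          not_false_eq_true, zero_pow, zero_mul] at h0
        exact h0.mono_left nhdsWithin_le_nhds
      exact tendsto_of_tendsto_of_tendsto_of_le_of_le tendsto_const_nhds hvol
        (fun _ => zero_le) (fun z => Measure.restrict_apply_le _ _)
    -- The disc of radius |z - c|/2 about z misses c and has area π|z - c|²/4, whence the constant
    -- 4/π in the sub-mean value estimate. The integral on the right tends to zero by absolute
    -- continuity.
    have hbound : ∀ᶠ z in 𝓝[≠] c, ‖(z - c) * h z‖ₑ ^ 2 ≤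
        (4 / NNReal.pi : ℝ≥0∞) * ∫⁻ w in Metric.closedBall z (‖z - c‖ / 2),
          ‖h w‖ₑ ^ 2 ∂(volume.restrict (Metric.ball c ρ)) := by
      have hb : Metric.ball c (ρ / 2) ∈ 𝓝[≠] c :=
        mem_nhdsWithin_of_mem_nhds (Metric.ball_mem_nhds c (half_pos hρ))
      filter_upwards [hb, self_mem_nhdsWithin] with z hz hzc
      have hzc' : 0 < ‖z - c‖ := norm_pos_iff.2 (sub_ne_zero.2 hzc)
      have hzd : ‖z - c‖ < ρ / 2 := by rwa [Metric.mem_ball, dist_eq_norm] at hz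
      have hsub : Metric.closedBall z (‖z - c‖ / 2) ⊆ Metric.ball c ρ \ {c} := by
        intro w hw
        rw [Metric.mem_closedBall, dist_eq_norm] at hw
        refine ⟨?_, ?_⟩
        · rw [Metric.mem_ball, dist_eq_norm]
          have := norm_sub_le_norm_sub_add_norm_sub w z c
          linarith
        · rintro rfl
          rw [norm_sub_rev] at hw
          linarith
      have hk := enorm_sq_mul_volume_closedBall_le
        (Metric.isOpen_ball.sdiff isClosed_singleton) hd hsub
      rw [Measure.restrict_restrict_of_subset (hsub.trans sdiff_subset)]
      rw [Complex.volume_closedBall] at hk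
      have hpi0 : (NNReal.pi : ℝ≥0∞) ≠ 0 := by simp [NNReal.pi_ne_zero]
      have hhalf : ENNReal.ofReal (‖z - c‖ / 2) = ‖z - c‖ₑ / 2 := by
        rw [ENNReal.ofReal_div_of_pos (by norm_num), ofReal_norm]; simp
      calc ‖(z - c) * h z‖ₑ ^ 2 = ‖z - c‖ₑ ^ 2 * ‖h z‖ₑ ^ 2 := by rw [enorm_mul, mul_pow]
        _ = (4 / NNReal.pi : ℝ≥0∞) *
            (‖h z‖ₑ ^ 2 * (ENNReal.ofReal (‖z - c‖ / 2) ^ 2 * NNReal.pi)) := by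
          rw [hhalf, ENNReal.div_eq_inv_mul, ENNReal.div_eq_inv_mul, mul_pow, ← ENNReal.inv_pow]
          have e1 : (NNReal.pi : ℝ≥0∞)⁻¹ * NNReal.pi = 1 :=
            ENNReal.inv_mul_cancel hpi0 ENNReal.coe_ne_top
          have e2 : (4 : ℝ≥0∞) * (2 ^ 2)⁻¹ = 1 := by
            norm_num
            exact ENNReal.mul_inv_cancel (by norm_num) (by norm_num)
          calc ‖z - c‖ₑ ^ 2 * ‖h z‖ₑ ^ 2 =
              ((NNReal.pi : ℝ≥0∞)⁻¹ * NNReal.pi) * (4 * (2 ^ 2)⁻¹) *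
                (‖z - c‖ₑ ^ 2 * ‖h z‖ₑ ^ 2) := by rw [e1, e2, one_mul, one_mul]
            _ = _ := by ring
        _ ≤ _ := by gcongr
    have hsq : Tendsto (fun z => ‖(z - c) * h z‖ₑ ^ 2) (𝓝[≠] c) (𝓝 0) := by
      have hC : (4 / NNReal.pi : ℝ≥0∞) ≠ ∞ :=
        (ENNReal.div_lt_top (by norm_num) (by simp [NNReal.pi_ne_zero])).ne
      have := ENNReal.Tendsto.const_mul hint (Or.inr hC)
      rw [mul_zero] at this
      exact tendsto_of_tendsto_of_tendsto_of_le_of_le' tendsto_const_nhds this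
        (Eventually.of_forall fun _ => zero_le) hbound
    have hen : Tendsto (fun z => ‖(z - c) * h z‖ₑ) (𝓝[≠] c) (𝓝 0) := by
      have := ((ENNReal.continuous_rpow_const (y := (1 / 2 : ℝ))).tendsto 0).comp hsq
      simp only [Function.comp_def, ← ENNReal.rpow_natCast, ← ENNReal.rpow_mul] at this
      simpa using this
    exact tendsto_zero_iff_enorm_tendsto_zero.2 hen
  have h1 : ∀ k : ℂ → ℂ, Tendsto (fun z => (z - c) * k z) (𝓝[≠] c) (𝓝 0) →
      k =o[𝓝[≠] c] fun z => (z - c)⁻¹ := by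
    intro k hk
    refine Asymptotics.isLittleO_of_tendsto' ?_ ?_
    · filter_upwards [self_mem_nhdsWithin] with z hz h0
      exact absurd (inv_eq_zero.1 h0) (sub_ne_zero.2 hz)
    · refine hk.congr fun z => ?_
      rw [div_inv_eq_mul, mul_comm]
  refine (h1 h hlim).sub (h1 (fun _ => h c) ?_)
  have : Continuous fun z : ℂ => (z - c) * h c := by fun_prop
  have h0 := this.tendsto c
  rw [sub_self, zero_mul] at h0
  exact h0.mono_left nhdsWithin_le_nhds

/-- Mean value property of a square integrable holomorphic function with isolated singularities. -/
theorem circleAverage_eq_of_isolated_singularities {φ f : ℂ → ℂ} {S : Set ℂ} (hS : IsOpen S)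
    (hSb : Metric.closedBall 0 1 ⊆ S) (hSc : IsPreconnected S)
    (hf : DifferentiableOn ℂ f S) (hf0 : ∃ s ∈ S, f s ≠ 0)
    (hφ : ∀ t ∈ S, f t ≠ 0 → DifferentiableAt ℂ φ t)
    (hL : ∫⁻ t in S, ‖φ t‖ₑ ^ 2 ≠ ∞)
    (hcirc : ∀ t ∈ Metric.sphere (0 : ℂ) 1, f t ≠ 0) (h0 : f 0 ≠ 0) :
    Real.circleAverage φ 0 1 = φ 0 := by
  obtain ⟨s, hs, hfs⟩ := hf0
  have han := hf.analyticOnNhd hS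
  have hext : ∀ c ∈ S, ∃ ρ > 0, ∃ l, Metric.ball c ρ ⊆ S ∧
      (∀ t ∈ Metric.ball c ρ, t ≠ c → f t ≠ 0) ∧
      DifferentiableOn ℂ (Function.update φ c l) (Metric.ball c ρ) := by
    intro c hc
    rcases (han c hc).eventually_eq_zero_or_eventually_ne_zero with h | h
    · exact absurd (han.eqOn_zero_of_preconnected_of_eventuallyEq_zero hSc hc h hs) hfs
    · rw [eventually_nhdsWithin_iff] at h
      obtain ⟨ρ, hρ, hb⟩ := Metric.eventually_nhds_iff_ball.1 (h.and (hS.mem_nhds hc))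
      have hbS : Metric.ball c ρ ⊆ S := fun t ht => (hb t ht).2
      obtain ⟨l, hl⟩ := exists_differentiableAt_update_of_lintegral_lt_top (h := φ) hρ
        (fun t ht => (hφ t (hbS ht.1) ((hb t ht.1).1 ht.2)).differentiableWithinAt)
        (ne_top_of_le_ne_top hL (lintegral_mono_set hbS))
      exact ⟨ρ, hρ, l, hbS, fun t ht hne => (hb t ht).1 hne, hl⟩
  choose! ρ hρ l hbS hne hl using hext
  classical
  -- All singularities are filled in at once by their removable values. The result agrees with φ on
  -- the circle and at 0, where f does not vanish.
  set ψ : ℂ → ℂ := fun t => if f t = 0 then l t else φ t with hψ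
  have hψd : ∀ c ∈ S, DifferentiableAt ℂ ψ c := by
    intro c hc
    by_cases hfc : f c = 0
    · have h1 : DifferentiableAt ℂ (Function.update φ c (l c)) c :=
        (hl c hc).differentiableAt (Metric.ball_mem_nhds c (hρ c hc))
      refine h1.congr_of_eventuallyEq ?_
      filter_upwards [Metric.ball_mem_nhds c (hρ c hc)] with t ht
      by_cases htc : t = c
      · subst htc; simp [hψ, hfc]
      · simp [hψ, hne c hc t ht htc, htc]
    · refine (hφ c hc hfc).congr_of_eventuallyEq ?_
      filter_upwards [((hf c hc).differentiableAt (hS.mem_nhds hc)).continuousAt.eventually_ne hfc]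
        with t ht
      simp [hψ, ht]
  have h1 := circleAverage_of_differentiable_on_off_countable (c := 0) (R := 1) (f := ψ) (s := ∅)
    countable_empty (fun t ht => (hψd t (hSb (by simpa using ht))).continuousAt.continuousWithinAt)
    (fun t ht => hψd t (hSb (Metric.ball_subset_closedBall (by simpa using ht.1))))
  have h2 : Real.circleAverage ψ 0 1 = Real.circleAverage φ 0 1 := by
    refine Real.circleAverage_congr_sphere fun t ht => ?_
    rw [abs_one] at ht
    simp [hψ, hcirc t ht]
  rw [← h2, h1]
  simp [hψ, h0]

/-- Local extension of square integrable holomorphic functions across the zero set of `f`. -/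
theorem exists_local_extension {n : ℕ} {z₀ : Fin n → ℂ} {r : ℝ} (hr : 0 < r)
    {f F : (Fin n → ℂ) → ℂ} (hf : DifferentiableOn ℂ f (Metric.ball z₀ r))
    {b : Fin n → ℂ} (hb : b ∈ Metric.ball z₀ r) (hfb : f b ≠ 0)
    {V : Set (Fin n → ℂ)} (hVo : IsOpen (Metric.ball z₀ r \ V))
    (hV : ∀ w ∈ Metric.ball z₀ r, w ∈ V → f w = 0)
    (hF : DifferentiableOn ℂ F (Metric.ball z₀ r \ V))
    (hL : ∫⁻ z in Metric.ball z₀ r \ V, ‖F z‖ₑ ^ 2 ≠ ∞) :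
    ∃ δ > 0, δ ≤ r ∧ ∃ G : (Fin n → ℂ) → ℂ, DifferentiableOn ℂ G (Metric.ball z₀ δ) ∧
      EqOn G F (Metric.ball z₀ δ \ V) := by
  set B := Metric.ball z₀ r with hB
  have hBo : IsOpen B := Metric.isOpen_ball
  have hz₀ : z₀ ∈ B := Metric.mem_ball_self hr
  -- choice of a direction
  obtain ⟨e, her, hfe⟩ : ∃ e : Fin n → ℂ, ‖e‖ < r / 4 ∧
      ∀ t ∈ Metric.sphere (0 : ℂ) 1, f (z₀ + t • e) ≠ 0 := by
    have hd : DifferentiableOn ℂ (fun t : ℂ => f (z₀ + t • (b - z₀)))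
        {t : ℂ | z₀ + t • (b - z₀) ∈ B} :=
      fun _ ht => (differentiableAt_comp_line hBo hf ht).differentiableWithinAt
    have han := hd.analyticOnNhd (isOpen_line_preimage hBo _ _)
    have h0 : (0 : ℂ) ∈ {t : ℂ | z₀ + t • (b - z₀) ∈ B} := by simpa using hz₀
    rcases (han 0 h0).eventually_eq_zero_or_eventually_ne_zero with h | h
    · have h2 := han.eqOn_zero_of_preconnected_of_eventuallyEq_zero
        (isPreconnected_line_preimage (convex_ball _ _) _ _) h0 h
        (show (1 : ℂ) ∈ {t : ℂ | z₀ + t • (b - z₀) ∈ B} by simpa using hb)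
      exact absurd (by simpa using h2) hfb
    · rw [eventually_nhdsWithin_iff, Metric.eventually_nhds_iff_ball] at h
      obtain ⟨ε, hε, h⟩ := h
      set s : ℝ := min (ε / 2) (1 / 4) with hs
      have hs0 : 0 < s := by positivity
      have hs1 : s ≤ ε / 2 := min_le_left _ _
      have hs2 : s ≤ 1 / 4 := min_le_right _ _
      refine ⟨(s : ℂ) • (b - z₀), ?_, fun t ht => ?_⟩
      · rw [norm_smul, Complex.norm_real, Real.norm_of_nonneg hs0.le, ← dist_eq_norm]
        have : dist b z₀ < r := hb
        nlinarith [dist_nonneg (x := b) (y := z₀)]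
      · rw [mem_sphere_zero_iff_norm] at ht
        rw [smul_smul]
        refine h _ ?_ ?_
        · rw [mem_ball_zero_iff, norm_mul, ht, Complex.norm_real, Real.norm_of_nonneg hs0.le]
          linarith
        · refine mul_ne_zero (fun h => by simp [h] at ht) (by exact_mod_cast hs0.ne')
  have hmem : ∀ z ∈ Metric.ball z₀ (r / 2), ∀ t ∈ Metric.ball (0 : ℂ) 2, z + t • e ∈ B := by
    intro z hz t ht
    have ht' : ‖t‖ < 2 := by simpa using ht
    have h1 : dist (z + t • e) z = ‖t‖ * ‖e‖ := by simp [norm_smul]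
    rw [Metric.mem_ball] at hz
    rw [hB, Metric.mem_ball]
    nlinarith [dist_triangle (z + t • e) z z₀, norm_nonneg e, norm_nonneg t]
  have hballs : Metric.closedBall (0 : ℂ) 1 ⊆ Metric.ball 0 2 :=
    Metric.closedBall_subset_ball (by norm_num)
  set U : Set (Fin n → ℂ) := B ∩ f ⁻¹' {0}ᶜ with hU
  have hUo : IsOpen U := hf.continuousOn.isOpen_inter_preimage hBo isOpen_compl_singleton
  have hUV : U ⊆ B \ V := fun w hw => ⟨hw.1, fun h => hw.2 (hV w hw.1 h)⟩
  have hFU : DifferentiableOn ℂ F U := hF.mono hUV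
  have hcirc₀ : (fun t : ℂ => z₀ + t • e) '' Metric.sphere 0 1 ⊆ U := by
    rintro _ ⟨t, ht, rfl⟩
    exact ⟨hmem z₀ (Metric.mem_ball_self (half_pos hr)) t
      (hballs (Metric.sphere_subset_closedBall ht)), hfe t ht⟩
  obtain ⟨η, hη, hηU⟩ := ((isCompact_sphere (0 : ℂ) 1).image
    (f := fun t : ℂ => z₀ + t • e) (by fun_prop)).exists_thickening_subset_open hUo hcirc₀
  set δ := min η (r / 2) with hδ
  have hδ0 : 0 < δ := by positivity
  have hδr : δ ≤ r / 2 := min_le_right _ _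
  have hcirc : ∀ z ∈ Metric.ball z₀ δ, ∀ t ∈ Metric.sphere (0 : ℂ) 1, z + t • e ∈ U := by
    intro z hz t ht
    refine hηU (Metric.mem_thickening_iff.2 ⟨z₀ + t • e, ⟨t, ht, rfl⟩, ?_⟩)
    rw [dist_add_right]
    exact lt_of_lt_of_le hz (min_le_left _ _)
  -- For z near z₀ the circle stays off the zeros of f, so its mean is holomorphic in z even across
  -- V. The mean value property on slices identifies it with F.
  set G : (Fin n → ℂ) → ℂ := fun z => ((2 * Real.pi)⁻¹ : ℝ) •
    ∫ θ in (0 : ℝ)..2 * Real.pi, 1 * F (z + circleMap 0 1 θ • e) with hG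
  have hGd : DifferentiableOn ℂ G (Metric.ball z₀ δ) := fun z hz =>
    ((differentiableAt_integral_circleMap hUo hFU (k := fun _ => 1) continuous_const fun θ =>
      hcirc z hz _ (circleMap_mem_sphere 0 zero_le_one θ)).const_smul
        ((2 * Real.pi)⁻¹ : ℝ)).differentiableWithinAt
  refine ⟨δ, hδ0, by linarith, G, hGd, ?_⟩
  -- almost every slice is square integrable
  set H : (Fin n → ℂ) → ℝ≥0∞ := (B \ V).indicator fun w => ‖F w‖ₑ ^ 2 with hH
  have hHm : Measurable H := by
    classical
    have h1 : Measurable ((B \ V).indicator F) := by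
      rw [← piecewise_eq_indicator]
      exact hF.continuousOn.measurable_piecewise continuous_zero.continuousOn hVo.measurableSet
    have h2 : H = fun w => ‖(B \ V).indicator F w‖ₑ ^ 2 := by
      ext w; by_cases hw : w ∈ B \ V <;> simp [hH, hw]
    rw [h2]; exact h1.enorm.pow_const 2
  have hslice : ∀ᵐ z ∂(volume.restrict (Metric.ball z₀ δ)),
      ∫⁻ t in Metric.ball (0 : ℂ) 2, H (z + t • e) < ∞ := by
    have hHm2 : Measurable fun p : (Fin n → ℂ) × ℂ => H (p.1 + p.2 • e) :=
      hHm.comp (by fun_prop : Continuous fun p : (Fin n → ℂ) × ℂ => p.1 + p.2 • e).measurable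
    refine ae_lt_top hHm2.lintegral_prod_right' ?_
    rw [lintegral_lintegral_swap hHm2.aemeasurable]
    refine ne_top_of_le_ne_top (b := (∫⁻ w, H w) * volume (Metric.ball (0 : ℂ) 2))
      (ENNReal.mul_ne_top ?_ measure_ball_lt_top.ne) ?_
    · rwa [hH, lintegral_indicator hVo.measurableSet]
    · rw [← setLIntegral_const]
      refine lintegral_mono fun t => ?_
      calc ∫⁻ z in Metric.ball z₀ δ, H (z + t • e) ≤ ∫⁻ z, H (z + t • e) :=
            setLIntegral_le_lintegral _ _
        _ = ∫⁻ w, H w := lintegral_add_right_eq_self H (t • e)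
  have hzero := volume_zeros_eq_zero hBo (convex_ball z₀ r) hf hb hfb
  have hsubV : Metric.ball z₀ δ \ V ⊆ B \ V :=
    sdiff_subset_sdiff_left (Metric.ball_subset_ball (by linarith))
  have hopen : IsOpen (Metric.ball z₀ δ \ V) := by
    have : Metric.ball z₀ δ \ V = Metric.ball z₀ δ ∩ (B \ V) := by
      ext w
      exact ⟨fun h => ⟨h.1, hsubV h⟩, fun h => ⟨h.1, h.2.2⟩⟩
    rw [this]; exact Metric.isOpen_ball.inter hVo
  refine Measure.eqOn_open_of_ae_eq (μ := volume) ?_ hopen (hGd.continuousOn.mono sdiff_subset)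
    (hF.continuousOn.mono hsubV)
  have hslice' := ae_restrict_of_ae_restrict_of_subset
    (sdiff_subset : Metric.ball z₀ δ \ V ⊆ _) hslice
  have hz0 : ∀ᵐ z ∂(volume.restrict (Metric.ball z₀ δ \ V)), z ∉ {z | z ∈ B ∧ f z = 0} :=
    ae_restrict_of_ae (measure_eq_zero_iff_ae_notMem.1 hzero)
  filter_upwards [hslice', hz0, ae_restrict_mem hopen.measurableSet] with z hz hzf hzm
  have hzb : z ∈ Metric.ball z₀ (r / 2) := Metric.ball_subset_ball hδr hzm.1
  have hslo : Metric.ball (0 : ℂ) 2 ⊆ {t : ℂ | z + t • e ∈ B} := fun t ht => hmem z hzb t ht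
  have hfz : f z ≠ 0 := fun h => hzf ⟨(hsubV hzm).1, h⟩
  -- F is uncontrolled on V, so it is cut off by the indicator of B ∖ V to make the slice integral
  -- finite. The indicator is 1 wherever f ≠ 0.
  have havg := circleAverage_eq_of_isolated_singularities
    (φ := (fun t : ℂ => F (z + t • e)) * fun t : ℂ => ((B \ V).indicator 1 (z + t • e) : ℂ))
    (f := fun t : ℂ => f (z + t • e)) Metric.isOpen_ball hballs Metric.isPreconnected_ball
    (fun t ht => (differentiableAt_comp_line hBo hf (hslo ht)).differentiableWithinAt)
    ⟨0, by simp, by simpa using hfz⟩ ?_ ?_ (fun t ht => (hcirc z hzm.1 t ht).2)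
    (by simpa using hfz)
  · have hz1 : (B \ V).indicator (1 : (Fin n → ℂ) → ℂ) z = 1 := indicator_of_mem (hsubV hzm) _
    have h1 : Real.circleAverage (fun t : ℂ => F (z + t • e)) 0 1 = F z := by
      rw [← Real.circleAverage_congr_sphere (f₁ := (fun t : ℂ => F (z + t • e)) *
        fun t : ℂ => ((B \ V).indicator 1 (z + t • e) : ℂ)), havg]
      · simp [hz1]
      · intro t ht
        rw [abs_one] at ht
        simp [indicator_of_mem (hUV (hcirc z hzm.1 t ht))]
    rw [← h1, hG, Real.circleAverage_def]
    simp
  · intro t ht hft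
    have hU' : z + t • e ∈ U := ⟨hslo ht, hft⟩
    have h1 : DifferentiableAt ℂ (fun t : ℂ => F (z + t • e)) t :=
      differentiableAt_comp_line hUo hFU hU'
    refine h1.congr_of_eventuallyEq ?_
    have hct : Continuous fun t : ℂ => z + t • e := by fun_prop
    filter_upwards [hct.continuousAt.eventually (hUo.mem_nhds hU')] with s hs
    simp [indicator_of_mem (hUV hs)]
  · refine ne_top_of_le_ne_top hz.ne (lintegral_mono fun t => ?_)
    by_cases hw : z + t • e ∈ B \ V <;> simp [hH, hw]

/-- Square integrable holomorphic functions extend across analytic subsets. -/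
theorem exists_extension_of_lintegral_ne_top {n : ℕ} {E V : Set (Fin n → ℂ)} (hE : IsOpen E)
    (hEc : IsPreconnected E) (hV : IsAnalyticSubset E V) (hVE : V ≠ E) {F : (Fin n → ℂ) → ℂ}
    (hF : DifferentiableOn ℂ F (E \ V)) (hL : ∫⁻ z in E \ V, ‖F z‖ₑ ^ 2 ≠ ∞) :
    ∃ G : (Fin n → ℂ) → ℂ, DifferentiableOn ℂ G E ∧ EqOn G F (E \ V) := by
  have hloc : ∀ z ∈ E, ∃ δ > 0, Metric.ball z δ ⊆ E ∧ ∃ G : (Fin n → ℂ) → ℂ,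
      DifferentiableOn ℂ G (Metric.ball z δ) ∧ EqOn G F (Metric.ball z δ \ V) := by
    intro z hz
    obtain ⟨r, hr, hrE, f, hf, ⟨b, hb, hfb⟩, hfV⟩ := hV.exists_ball hEc hVE hz
    have hsub : Metric.ball z r \ V ⊆ E \ V := sdiff_subset_sdiff_left hrE
    have ho : IsOpen (Metric.ball z r \ V) := by
      have : Metric.ball z r \ V = Metric.ball z r ∩ (E \ V) := by
        ext w
        exact ⟨fun h => ⟨h.1, hsub h⟩, fun h => ⟨h.1, h.2.2⟩⟩
      rw [this]; exact Metric.isOpen_ball.inter hV.isOpen_diff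
    obtain ⟨δ, hδ, hδr, G, hG, hGF⟩ := exists_local_extension hr hf hb hfb ho hfV
      (hF.mono hsub) (ne_top_of_le_ne_top hL (lintegral_mono_set hsub))
    exact ⟨δ, hδ, (Metric.ball_subset_ball hδr).trans hrE, G, hG, hGF⟩
  choose! δ hδ hδE G hG hGF using hloc
  classical
  -- At a point of V the value comes from that point's own local extension. Two local extensions
  -- agree off V, hence by density and continuity on their whole overlap.
  refine ⟨fun z => if z ∈ V then G z z else F z, fun z hz => ?_, fun z hz => by simp [hz.2]⟩
  have h1 : DifferentiableAt ℂ (G z) z :=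
    (hG z hz).differentiableAt (Metric.ball_mem_nhds z (hδ z hz))
  refine (h1.congr_of_eventuallyEq ?_).differentiableWithinAt
  filter_upwards [Metric.ball_mem_nhds z (hδ z hz)] with w hw
  by_cases hwV : w ∈ V
  · have hwE : w ∈ E := hδE z hz hw
    have hww : w ∈ Metric.ball w (δ w) := Metric.mem_ball_self (hδ w hwE)
    set O := Metric.ball w (δ w) ∩ Metric.ball z (δ z) with hO
    have hOo : IsOpen O := Metric.isOpen_ball.inter Metric.isOpen_ball
    have heq : EqOn (G w) (G z) (O \ V) := fun y hy =>
      (hGF w hwE ⟨hy.1.1, hy.2⟩).trans (hGF z hz ⟨hy.1.2, hy.2⟩).symm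
    have hcl : O ⊆ closure (O \ V) := by
      intro y hy
      rw [mem_closure_iff_nhds]
      intro t ht
      obtain ⟨x, hx, hxE⟩ := mem_closure_iff_nhds.1
        (hV.subset_closure_diff hE hEc hVE (hδE z hz hy.2)) _ (inter_mem ht (hOo.mem_nhds hy))
      exact ⟨x, hx.1, hx.2, hxE.2⟩
    have := heq.of_subset_closure ((hG w hwE).continuousOn.mono inter_subset_left)
      ((hG z hz).continuousOn.mono inter_subset_right) sdiff_subset hcl ⟨hww, hw⟩
    simpa [hwV] using this
  · simpa [hwV] using (hGF z hz ⟨hw, hwV⟩).symm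

/-! ### Inverse branches of the unramified covering. -/

/-- The maps `φ k`, `k < N`, are the holomorphic inverse branches over `B` of the restriction of `π`
to `Ω`. -/
structure IsInverseBranches {n : ℕ} (Ω : Set (Fin n → ℂ)) (π : (Fin n → ℂ) → (Fin n → ℂ)) {N : ℕ}
    (B : Set (Fin n → ℂ)) (φ : Fin N → (Fin n → ℂ) → (Fin n → ℂ)) : Prop where
  isOpen : IsOpen B
  differentiableOn : ∀ k, DifferentiableOn ℂ (φ k) B
  mapsTo : ∀ k, MapsTo (φ k) B Ω
  rightInv : ∀ k, ∀ w ∈ B, π (φ k w) = w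
  injective : ∀ w ∈ B, Function.Injective fun k => φ k w
  exists_eq : ∀ z ∈ Ω, π z ∈ B → ∃ k, φ k (π z) = z

/-- Unramified `N`-sheeted holomorphic coverings between open subsets of `ℂⁿ`. -/
structure IsHolomorphicCovering {n : ℕ} (N : ℕ) (Ω Ω' : Set (Fin n → ℂ))
    (π : (Fin n → ℂ) → (Fin n → ℂ)) : Prop where
  isOpen_source : IsOpen Ω
  isOpen_target : IsOpen Ω'
  nonempty : Ω'.Nonempty
  differentiableOn : DifferentiableOn ℂ π Ω
  mapsTo : MapsTo π Ω Ω'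
  exists_branches : ∀ w ∈ Ω', ∃ B, w ∈ B ∧ B ⊆ Ω' ∧
    ∃ φ : Fin N → (Fin n → ℂ) → (Fin n → ℂ), IsInverseBranches Ω π B φ

/-- Local triviality of a covering map, in terms of inverse branches. -/
theorem exists_continuous_branches {n : ℕ} {Ω Ω' : Set (Fin n → ℂ)}
    {π : (Fin n → ℂ) → (Fin n → ℂ)} (hΩ' : IsOpen Ω')
    (hm : MapsTo π Ω Ω') (hc : IsCoveringMap (hm.restrict π Ω Ω'))
    {w₀ : Fin n → ℂ} (hw₀ : w₀ ∈ Ω') (hfin : {z | z ∈ Ω ∧ π z = w₀}.Finite) :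
    ∃ B, IsOpen B ∧ w₀ ∈ B ∧ B ⊆ Ω' ∧ ∃ (N : ℕ) (φ : Fin N → (Fin n → ℂ) → (Fin n → ℂ)),
      (∀ k, ContinuousOn (φ k) B) ∧ (∀ k, MapsTo (φ k) B Ω) ∧ (∀ k, ∀ w ∈ B, π (φ k w) = w) ∧
      (∀ w ∈ B, Function.Injective fun k => φ k w) ∧
      ∀ z ∈ Ω, π z ∈ B → ∃ k, φ k (π z) = z := by
  set f := hm.restrict π Ω Ω' with hf
  have hfv : ∀ z : Ω, (f z : Fin n → ℂ) = π z := fun z => rfl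
  obtain ⟨-, U, hxU, hUo, -, H, hH⟩ := hc ⟨w₀, hw₀⟩
  have hI : Finite (f ⁻¹' {(⟨w₀, hw₀⟩ : Ω')}) := by
    have := hfin.to_subtype
    refine Finite.of_injective (β := {z | z ∈ Ω ∧ π z = w₀})
      (fun z => ⟨z.1.1, z.1.2, by
        have h : f z.1 = ⟨w₀, hw₀⟩ := z.2
        rw [← hfv, h]⟩) ?_
    intro x y hxy
    exact Subtype.ext (Subtype.ext (congrArg (fun z : {z | z ∈ Ω ∧ π z = w₀} => z.1) hxy))
  obtain ⟨N, ⟨e⟩⟩ := Finite.exists_equiv_fin (f ⁻¹' {(⟨w₀, hw₀⟩ : Ω')})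
  obtain ⟨O, hO, hOU⟩ := isOpen_induced_iff.1 hUo
  have hBU : ∀ w (hw : w ∈ O ∩ Ω'), (⟨w, hw.2⟩ : Ω') ∈ U := fun w hw => by
    rw [← hOU]; exact hw.1
  set s : (O ∩ Ω' : Set _) → U := fun w => ⟨⟨w.1, w.2.2⟩, hBU w.1 w.2⟩ with hs
  have hsc : Continuous s := by fun_prop
  classical
  -- Sheets are labelled by the fibre over w₀ through the local trivialization. The value 0 off O ∩
  -- Ω' is arbitrary.
  set φ : Fin N → (Fin n → ℂ) → (Fin n → ℂ) := fun k w =>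
    if h : w ∈ O ∩ Ω' then ((H.symm (s ⟨w, h⟩, e.symm k)).1 : Fin n → ℂ) else 0 with hφ
  have hφv : ∀ k w (h : w ∈ O ∩ Ω'), φ k w = ((H.symm (s ⟨w, h⟩, e.symm k)).1 : Fin n → ℂ) :=
    fun k w h => dif_pos h
  refine ⟨O ∩ Ω', hO.inter hΩ', ⟨?_, hw₀⟩, inter_subset_right, N, φ, ?_, ?_, ?_, ?_, ?_⟩
  · have : (⟨w₀, hw₀⟩ : Ω') ∈ Subtype.val ⁻¹' O := by rw [hOU]; exact hxU
    exact this
  · intro k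
    rw [continuousOn_iff_continuous_domRestrict]
    have : (O ∩ Ω').domRestrict (φ k) =
        fun w => ((H.symm (s w, e.symm k)).1 : Fin n → ℂ) := by
      ext1 w; exact hφv k w.1 w.2
    rw [this]
    exact continuous_subtype_val.comp (continuous_subtype_val.comp
      (H.symm.continuous.comp (hsc.prodMk continuous_const)))
  · intro k w hw
    rw [hφv k w hw]
    exact (H.symm (s ⟨w, hw⟩, e.symm k)).1.2
  · intro k w hw
    rw [hφv k w hw, ← hfv, ← hH, H.apply_symm_apply]
  · intro w hw k k' hkk
    have h1 : φ k w = φ k' w := hkk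
    rw [hφv k w hw, hφv k' w hw] at h1
    have h2 := H.symm.injective (Subtype.ext (Subtype.ext h1))
    exact e.symm.injective (Prod.ext_iff.1 h2).2
  · intro z hz hzB
    have hzU : (⟨z, hz⟩ : Ω) ∈ f ⁻¹' U := hBU (π z) hzB
    refine ⟨e (H ⟨⟨z, hz⟩, hzU⟩).2, ?_⟩
    rw [hφv _ _ hzB, e.symm_apply_apply]
    have : (s ⟨π z, hzB⟩, (H ⟨⟨z, hz⟩, hzU⟩).2) = H ⟨⟨z, hz⟩, hzU⟩ := by
      refine Prod.ext (Subtype.ext ?_) rfl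
      rw [hH]; rfl
    rw [this, H.symm_apply_apply]

theorem IsInverseBranches.fiber_eq {n N : ℕ} {Ω : Set (Fin n → ℂ)}
    {π : (Fin n → ℂ) → (Fin n → ℂ)} {B : Set (Fin n → ℂ)}
    {φ : Fin N → (Fin n → ℂ) → (Fin n → ℂ)} (h : IsInverseBranches Ω π B φ) {w : Fin n → ℂ}
    (hw : w ∈ B) : {z | z ∈ Ω ∧ π z = w} = range fun k => φ k w := by
  ext z
  constructor
  · rintro ⟨hz, rfl⟩
    exact h.exists_eq z hz hw
  · rintro ⟨k, rfl⟩
    exact ⟨h.mapsTo k hw, h.rightInv k w hw⟩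

/-- The unramified part of a ramified covering. -/
theorem IsRamifiedCovering.exists_isHolomorphicCovering {n : ℕ} {E V D W : Set (Fin n → ℂ)}
    {π : (Fin n → ℂ) → (Fin n → ℂ)} (hπ : IsRamifiedCovering E V D W π) :
    ∃ N, N ≠ 0 ∧ IsHolomorphicCovering N (E \ V) (D \ W) π := by
  have hΩ : IsOpen (E \ V) := hπ.analytic_source.isOpen_diff
  have hΩ' : IsOpen (D \ W) := hπ.analytic_target.isOpen_diff
  have hbr : ∀ w ∈ D \ W, ∃ B, w ∈ B ∧ B ⊆ D \ W ∧ ∃ (N : ℕ)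
      (φ : Fin N → (Fin n → ℂ) → (Fin n → ℂ)), IsInverseBranches (E \ V) π B φ := by
    intro w hw
    obtain ⟨B, hBo, hwB, hB, N, φ, h1, h2, h3, h4, h5⟩ := exists_continuous_branches hΩ'
      hπ.mapsTo hπ.isCoveringMap hw (hπ.finite_fibers w hw)
    exact ⟨B, hwB, hB, N, φ, hBo, fun k =>
      differentiableOn_of_rightInverse hΩ hBo hπ.holomorphic (h1 k) (h2 k) (h3 k), h2, h3, h4, h5⟩
  -- The fibre cardinality is locally constant and D ∖ W is connected, so a single number of sheets
  -- serves everywhere.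
  set c : (Fin n → ℂ) → ℕ := fun w => {z | z ∈ E \ V ∧ π z = w}.ncard with hc
  have hcard : ∀ {B : Set (Fin n → ℂ)} {N : ℕ} {φ : Fin N → (Fin n → ℂ) → (Fin n → ℂ)},
      IsInverseBranches (E \ V) π B φ → ∀ w ∈ B, c w = N := by
    intro B N φ h w hw
    simp only [hc]
    rw [h.fiber_eq hw, ← image_univ, ncard_image_of_injective _ (h.injective w hw), ncard_univ,
      Nat.card_eq_fintype_card, Fintype.card_fin]
  have hcont : ContinuousOn c (D \ W) := by
    intro w hw
    obtain ⟨B, hwB, -, N, φ, h⟩ := hbr w hw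
    refine ContinuousAt.continuousWithinAt ?_
    refine (continuousAt_const (y := N)).congr ?_
    filter_upwards [h.isOpen.mem_nhds hwB] with y hy
    exact (hcard h y hy).symm
  have hpc := hπ.analytic_target.isPreconnected_diff hπ.domain_target.isOpen
    hπ.domain_target.isConnected.isPreconnected hπ.proper_target
  have hne : (D \ W).Nonempty := by
    rw [nonempty_iff_ne_empty]
    intro h
    exact hπ.proper_target (hπ.analytic_target.1.antisymm (sdiff_eq_empty.1 h))
  obtain ⟨w₀, hw₀⟩ := hne
  refine ⟨c w₀, ?_, hΩ, hΩ', ⟨w₀, hw₀⟩, hπ.holomorphic, hπ.mapsTo, fun w hw => ?_⟩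
  · obtain ⟨z, hz, hzw⟩ := hπ.surjOn hw₀
    exact ((ncard_pos (hπ.finite_fibers w₀ hw₀)).2 ⟨z, hz, hzw⟩).ne'
  · obtain ⟨B, hwB, hB, N, φ, h⟩ := hbr w hw
    have hN : c w₀ = N := (hpc.constant hcont hw₀ hw).trans (hcard h w hwB)
    subst hN
    exact ⟨B, hwB, hB, φ, h⟩

theorem IsHolomorphicCovering.jacobian_mul {n N : ℕ} {Ω Ω' : Set (Fin n → ℂ)}
    {π : (Fin n → ℂ) → (Fin n → ℂ)} (h : IsHolomorphicCovering N Ω Ω' π)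
    {B : Set (Fin n → ℂ)} {φ : Fin N → (Fin n → ℂ) → (Fin n → ℂ)}
    (hφ : IsInverseBranches Ω π B φ) (k : Fin N) {w : Fin n → ℂ} (hw : w ∈ B) :
    jacobian π (φ k w) * jacobian (φ k) w = 1 :=
  jacobian_rightInverse h.isOpen_source hφ.isOpen h.differentiableOn
    (hφ.differentiableOn k).continuousOn (hφ.mapsTo k) (hφ.rightInv k) hw

/-- An inverse branch passes through z, and its Jacobian inverts J(π)(z). This permits division by
J(π) throughout Ω. -/
theorem IsHolomorphicCovering.jacobian_ne_zero {n N : ℕ} {Ω Ω' : Set (Fin n → ℂ)}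
    {π : (Fin n → ℂ) → (Fin n → ℂ)} (h : IsHolomorphicCovering N Ω Ω' π) {z : Fin n → ℂ}
    (hz : z ∈ Ω) : jacobian π z ≠ 0 := by
  obtain ⟨B, hwB, -, φ, hφ⟩ := h.exists_branches (π z) (h.mapsTo hz)
  obtain ⟨k, hk⟩ := hφ.exists_eq z hz hwB
  have := h.jacobian_mul hφ k hwB
  rw [hk] at this
  exact left_ne_zero_of_mul_eq_one this

/-! ### Fibre sums and change of variables. -/

/-- Sum over the fibre of `π : Ω → ℂⁿ` over `w`. -/
noncomputable def fiberSum {n : ℕ} {M : Type*} [AddCommMonoid M] (Ω : Set (Fin n → ℂ))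
    (π : (Fin n → ℂ) → (Fin n → ℂ)) (a : (Fin n → ℂ) → M) (w : Fin n → ℂ) : M :=
  ∑ᶠ z ∈ {z | z ∈ Ω ∧ π z = w}, a z

namespace IsInverseBranches

variable {n N : ℕ} {Ω : Set (Fin n → ℂ)} {π : (Fin n → ℂ) → (Fin n → ℂ)} {B : Set (Fin n → ℂ)}
  {φ : Fin N → (Fin n → ℂ) → (Fin n → ℂ)}

theorem fiberSum_eq {M : Type*} [AddCommMonoid M] (h : IsInverseBranches Ω π B φ)
    (a : (Fin n → ℂ) → M) {w : Fin n → ℂ} (hw : w ∈ B) :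
    fiberSum Ω π a w = ∑ k, a (φ k w) := by
  rw [fiberSum, h.fiber_eq hw, finsum_mem_range (h.injective w hw), finsum_eq_sum_of_fintype]

theorem preimage_eq (h : IsInverseBranches Ω π B φ) {S : Set (Fin n → ℂ)} (hS : S ⊆ B) :
    Ω ∩ π ⁻¹' S = ⋃ k, φ k '' S := by
  ext z
  simp only [mem_inter_iff, mem_preimage, mem_iUnion, mem_image]
  constructor
  · rintro ⟨hz, hzS⟩
    obtain ⟨k, hk⟩ := h.exists_eq z hz (hS hzS)
    exact ⟨k, π z, hzS, hk⟩
  · rintro ⟨k, w, hw, rfl⟩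
    exact ⟨h.mapsTo k (hS hw), by rwa [h.rightInv k w (hS hw)]⟩

theorem injOn (h : IsInverseBranches Ω π B φ) {S : Set (Fin n → ℂ)} (hS : S ⊆ B) (k : Fin N) :
    InjOn (φ k) S := fun x hx y hy hxy => by
  rw [← h.rightInv k x (hS hx), hxy, h.rightInv k y (hS hy)]

theorem disjoint_image (h : IsInverseBranches Ω π B φ) {S : Set (Fin n → ℂ)} (hS : S ⊆ B) :
    Pairwise (Function.onFun Disjoint fun k => φ k '' S) := by
  intro k l hkl
  refine disjoint_left.2 ?_
  rintro _ ⟨x, hx, rfl⟩ ⟨y, hy, hxy⟩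
  have : y = x := by rw [← h.rightInv l y (hS hy), hxy, h.rightInv k x (hS hx)]
  subst this
  exact hkl (h.injective y (hS hx) hxy.symm)

theorem hasFDerivWithinAt (h : IsInverseBranches Ω π B φ) {S : Set (Fin n → ℂ)} (hS : S ⊆ B)
    (k : Fin N) : ∀ w ∈ S, HasFDerivWithinAt (φ k) ((fderiv ℂ (φ k) w).restrictScalars ℝ) S w :=
  fun w hw => (((h.differentiableOn k w (hS hw)).differentiableAt
    (h.isOpen.mem_nhds (hS hw))).hasFDerivAt.restrictScalars ℝ).hasFDerivWithinAt

theorem measurableSet_image (h : IsInverseBranches Ω π B φ) {S : Set (Fin n → ℂ)} (hS : S ⊆ B)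
    (hSm : MeasurableSet S) (k : Fin N) : MeasurableSet (φ k '' S) :=
  measurable_image_of_fderivWithin hSm (h.hasFDerivWithinAt hS k) (h.injOn hS k)

theorem aemeasurable_comp (h : IsInverseBranches Ω π B φ) {S : Set (Fin n → ℂ)}
    (hS : S ⊆ B) (hSm : MeasurableSet S) {M : Type*} [TopologicalSpace M]
    [Zero M] [MeasurableSpace M]
    {a : (Fin n → ℂ) → M} (ha : Measurable (Ω.indicator a)) (k : Fin N) :
    AEMeasurable (fun w => a (φ k w)) (volume.restrict S) := by
  have h1 : AEMeasurable (φ k) (volume.restrict S) :=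
    ((h.differentiableOn k).continuousOn.mono hS).aemeasurable hSm
  refine (ha.comp_aemeasurable h1).congr ?_
  filter_upwards [ae_restrict_mem hSm] with w hw
  exact indicator_of_mem (h.mapsTo k (hS hw)) a

end IsInverseBranches

namespace IsHolomorphicCovering

variable {n N : ℕ} {Ω Ω' : Set (Fin n → ℂ)} {π : (Fin n → ℂ) → (Fin n → ℂ)}

/-- The Lindelöf property leaves countably many evenly covered open sets, which are then made
disjoint. The pieces are only measurable, so the branch lemmas are stated for subsets S of B. -/
theorem exists_partition (h : IsHolomorphicCovering N Ω Ω' π) :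
    ∃ S : ℕ → Set (Fin n → ℂ), (∀ i, MeasurableSet (S i)) ∧
      Pairwise (Function.onFun Disjoint S) ∧ ⋃ i, S i = Ω' ∧
      ∀ i, ∃ B, S i ⊆ B ∧ ∃ φ : Fin N → (Fin n → ℂ) → (Fin n → ℂ), IsInverseBranches Ω π B φ := by
  choose! B hwB hB φ hφ using h.exists_branches
  obtain ⟨t, ht, htc, hcov⟩ := TopologicalSpace.countable_cover_nhdsWithin
    (s := Ω') (f := B) fun w hw =>
      mem_nhdsWithin_of_mem_nhds ((hφ w hw).isOpen.mem_nhds (hwB w hw))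
  have hne : t.Nonempty := by
    obtain ⟨w, hw⟩ := h.nonempty
    obtain ⟨x, hx, -⟩ := mem_iUnion₂.1 (hcov hw)
    exact ⟨x, hx⟩
  obtain ⟨u, rfl⟩ := htc.exists_eq_range hne
  have hu : ∀ i, u i ∈ Ω' := fun i => ht (mem_range_self i)
  refine ⟨disjointed fun i => B (u i), fun i => MeasurableSet.disjointed
    (fun i => (hφ _ (hu i)).isOpen.measurableSet) i, disjoint_disjointed _, ?_, fun i =>
      ⟨B (u i), disjointed_subset _ i, φ (u i), hφ _ (hu i)⟩⟩
  rw [iUnion_disjointed]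
  refine (iUnion_subset fun i => hB _ (hu i)).antisymm fun w hw => ?_
  obtain ⟨x, ⟨i, rfl⟩, hx⟩ := mem_iUnion₂.1 (hcov hw)
  exact mem_iUnion.2 ⟨i, hx⟩

theorem enorm_jacobian_mul (h : IsHolomorphicCovering N Ω Ω' π) {B : Set (Fin n → ℂ)}
    {φ : Fin N → (Fin n → ℂ) → (Fin n → ℂ)} (hφ : IsInverseBranches Ω π B φ) (k : Fin N)
    {w : Fin n → ℂ} (hw : w ∈ B) :
    |((fderiv ℂ (φ k) w).restrictScalars ℝ).det| * ‖jacobian π (φ k w)‖ ^ 2 = 1 := by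
  have h1 := congrArg (‖·‖) (h.jacobian_mul hφ k hw)
  simp only [norm_mul, norm_one] at h1
  have h2 : ((fderiv ℂ (φ k) w).restrictScalars ℝ).det = ‖jacobian (φ k) w‖ ^ 2 :=
    det_restrictScalars_eq _
  rw [h2, abs_of_nonneg (by positivity), ← mul_pow, mul_comm, h1, one_pow]

theorem measurableSet_preimage (h : IsHolomorphicCovering N Ω Ω' π) {S : Set (Fin n → ℂ)}
    (hS : MeasurableSet S) : MeasurableSet (Ω ∩ π ⁻¹' S) := by
  classical
  have h1 : Measurable (Ω.piecewise π 0) := h.differentiableOn.continuousOn.measurable_piecewise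
    continuous_zero.continuousOn h.isOpen_source.measurableSet
  have h2 : Ω ∩ π ⁻¹' S = Ω ∩ (Ω.piecewise π 0) ⁻¹' S := by
    ext z
    refine and_congr_right fun hz => ?_
    rw [mem_preimage, mem_preimage, piecewise_eq_of_mem _ _ _ hz]
  rw [h2]
  exact h.isOpen_source.measurableSet.inter (h1 hS)

/-- The preimage of S is the disjoint union of its images under the branches, and on each image the
Jacobian of the branch cancels |J(π)|². -/
theorem setLIntegral_preimage (h : IsHolomorphicCovering N Ω Ω' π) {B S : Set (Fin n → ℂ)}
    {φ : Fin N → (Fin n → ℂ) → (Fin n → ℂ)} (hφ : IsInverseBranches Ω π B φ) (hS : S ⊆ B)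
    (hSm : MeasurableSet S) {a : (Fin n → ℂ) → ℝ≥0∞} (ha : Measurable (Ω.indicator a)) :
    ∫⁻ z in Ω ∩ π ⁻¹' S, a z * ‖jacobian π z‖ₑ ^ 2 = ∫⁻ w in S, fiberSum Ω π a w := by
  rw [hφ.preimage_eq hS, lintegral_iUnion (hφ.measurableSet_image hS hSm) (hφ.disjoint_image hS),
    tsum_fintype]
  have h1 : ∀ k, ∫⁻ z in φ k '' S, a z * ‖jacobian π z‖ₑ ^ 2 = ∫⁻ w in S, a (φ k w) := by
    intro k
    rw [lintegral_image_eq_lintegral_abs_det_fderiv_mul volume hSm (hφ.hasFDerivWithinAt hS k)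
      (hφ.injOn hS k)]
    refine setLIntegral_congr_fun hSm fun w hw => ?_
    have h2 := h.enorm_jacobian_mul hφ k (hS hw)
    have h3 : ‖jacobian π (φ k w)‖ₑ ^ 2 = ENNReal.ofReal (‖jacobian π (φ k w)‖ ^ 2) := by
      rw [ENNReal.ofReal_pow (norm_nonneg _), ofReal_norm]
    rw [h3, mul_left_comm, ← ENNReal.ofReal_mul (abs_nonneg _), h2, ENNReal.ofReal_one, mul_one]
  simp_rw [h1]
  rw [← lintegral_finsetSum' _ fun k _ => hφ.aemeasurable_comp hS hSm ha k]
  exact setLIntegral_congr_fun hSm fun w hw => (hφ.fiberSum_eq a (hS hw)).symm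

/-- Change of variables for coverings. -/
theorem lintegral_fiberSum (h : IsHolomorphicCovering N Ω Ω' π) {a : (Fin n → ℂ) → ℝ≥0∞}
    (ha : Measurable (Ω.indicator a)) :
    ∫⁻ z in Ω, a z * ‖jacobian π z‖ₑ ^ 2 = ∫⁻ w in Ω', fiberSum Ω π a w := by
  obtain ⟨S, hSm, hSd, hSU, hS⟩ := h.exists_partition
  have h1 : Ω = ⋃ i, Ω ∩ π ⁻¹' S i := by
    rw [← inter_iUnion, ← preimage_iUnion, hSU]
    exact (inter_eq_left.2 h.mapsTo).symm
  have hd : Pairwise (Function.onFun Disjoint fun i => Ω ∩ π ⁻¹' S i) := fun i j hij =>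
    ((hSd hij).preimage π).mono inter_subset_right inter_subset_right
  conv_lhs => rw [h1]
  rw [← hSU, lintegral_iUnion (fun i => h.measurableSet_preimage (hSm i)) hd,
    lintegral_iUnion hSm hSd]
  congr 1 with i
  obtain ⟨B, hSB, φ, hφ⟩ := hS i
  exact h.setLIntegral_preimage hφ hSB (hSm i) ha

theorem aestronglyMeasurable_fiberSum (h : IsHolomorphicCovering N Ω Ω' π) {a : (Fin n → ℂ) → ℂ}
    (ha : Measurable (Ω.indicator a)) :
    AEStronglyMeasurable (fiberSum Ω π a) (volume.restrict Ω') := by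
  obtain ⟨S, hSm, -, hSU, hS⟩ := h.exists_partition
  rw [← hSU]
  refine AEStronglyMeasurable.iUnion fun i => ?_
  obtain ⟨B, hSB, φ, hφ⟩ := hS i
  have h1 : AEMeasurable (fun w => ∑ k, a (φ k w)) (volume.restrict (S i)) :=
    Finset.aemeasurable_fun_sum _ fun k _ => hφ.aemeasurable_comp hSB (hSm i) ha k
  refine (h1.congr ?_).aestronglyMeasurable
  filter_upwards [ae_restrict_mem (hSm i)] with w hw
  exact (hφ.fiberSum_eq a (hSB hw)).symm

/-- One enumeration of the fibre serves all summands, so pointwise relations between fibre sums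
reduce to relations between finite sums. -/
theorem fiberSum_eq_sum (h : IsHolomorphicCovering N Ω Ω' π) {w : Fin n → ℂ} (hw : w ∈ Ω') :
    ∃ p : Fin N → (Fin n → ℂ), (∀ k, p k ∈ Ω ∧ π (p k) = w) ∧
      (∀ z ∈ Ω, π z = w → ∃ k, p k = z) ∧
      (∀ a : (Fin n → ℂ) → ℂ, fiberSum Ω π a w = ∑ k, a (p k)) ∧
      ∀ a : (Fin n → ℂ) → ℝ≥0∞, fiberSum Ω π a w = ∑ k, a (p k) := by
  obtain ⟨B, hwB, -, φ, hφ⟩ := h.exists_branches w hw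
  refine ⟨fun k => φ k w, fun k => ⟨hφ.mapsTo k hwB, hφ.rightInv k w hwB⟩, ?_,
    fun a => hφ.fiberSum_eq a hwB, fun a => hφ.fiberSum_eq a hwB⟩
  rintro z hz rfl
  exact hφ.exists_eq z hz hwB

theorem enorm_fiberSum_le (h : IsHolomorphicCovering N Ω Ω' π) (a : (Fin n → ℂ) → ℂ)
    {w : Fin n → ℂ} (hw : w ∈ Ω') :
    ‖fiberSum Ω π a w‖ₑ ≤ fiberSum Ω π (fun z => ‖a z‖ₑ) w := by
  obtain ⟨p, -, -, h1, h2⟩ := h.fiberSum_eq_sum hw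
  rw [h1, h2]
  exact enorm_sum_le _ _

/-- Cauchy–Schwarz on the `N` points of the fibre. -/
theorem enorm_sq_fiberSum_le (h : IsHolomorphicCovering N Ω Ω' π) (a : (Fin n → ℂ) → ℂ)
    {w : Fin n → ℂ} (hw : w ∈ Ω') :
    ‖fiberSum Ω π a w‖ₑ ^ 2 ≤ N * fiberSum Ω π (fun z => ‖a z‖ₑ ^ 2) w := by
  obtain ⟨p, -, -, h1, h2⟩ := h.fiberSum_eq_sum hw
  rw [h1, h2]
  have h3 := sq_sum_le_card_mul_sum_sq (s := Finset.univ) (f := fun k => ‖a (p k)‖₊)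
  rw [Finset.card_univ, Fintype.card_fin] at h3
  have h4 : (‖∑ k, a (p k)‖₊) ^ 2 ≤ N * ∑ k, ‖a (p k)‖₊ ^ 2 :=
    (pow_le_pow_left₀ zero_le (nnnorm_sum_le _ _) 2).trans h3
  simp only [enorm_eq_nnnorm]
  exact_mod_cast h4

theorem fiberSum_comp (h : IsHolomorphicCovering N Ω Ω' π) (b : (Fin n → ℂ) → ℝ≥0∞)
    {w : Fin n → ℂ} (hw : w ∈ Ω') : fiberSum Ω π (fun z => b (π z)) w = N * b w := by
  obtain ⟨p, hp, -, -, h2⟩ := h.fiberSum_eq_sum hw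
  rw [h2]
  simp [(hp _).2]

theorem fiberSum_mul_comp (h : IsHolomorphicCovering N Ω Ω' π) (b a : (Fin n → ℂ) → ℂ)
    {w : Fin n → ℂ} (hw : w ∈ Ω') :
    fiberSum Ω π (fun z => b (π z) * a z) w = b w * fiberSum Ω π a w := by
  obtain ⟨p, hp, -, h1, -⟩ := h.fiberSum_eq_sum hw
  rw [h1, h1, Finset.mul_sum]
  simp [(hp _).2]

theorem setIntegral_preimage (h : IsHolomorphicCovering N Ω Ω' π) {B S : Set (Fin n → ℂ)}
    {φ : Fin N → (Fin n → ℂ) → (Fin n → ℂ)} (hφ : IsInverseBranches Ω π B φ) (hS : S ⊆ B)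
    (hSm : MeasurableSet S) {a : (Fin n → ℂ) → ℂ}
    (hi : IntegrableOn (fun z => (‖jacobian π z‖ ^ 2) • a z) (Ω ∩ π ⁻¹' S)) :
    ∫ z in Ω ∩ π ⁻¹' S, (‖jacobian π z‖ ^ 2) • a z = ∫ w in S, fiberSum Ω π a w := by
  rw [hφ.preimage_eq hS] at hi ⊢
  rw [integrableOn_finite_iUnion] at hi
  rw [integral_iUnion_fintype (hφ.measurableSet_image hS hSm) (hφ.disjoint_image hS) hi]
  have heq : ∀ k, EqOn (fun w => |((fderiv ℂ (φ k) w).restrictScalars ℝ).det| •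
      ((‖jacobian π (φ k w)‖ ^ 2) • a (φ k w))) (fun w => a (φ k w)) S := by
    intro k w hw
    beta_reduce
    rw [smul_smul, h.enorm_jacobian_mul hφ k (hS hw), one_smul]
  have h1 : ∀ k, ∫ z in φ k '' S, (‖jacobian π z‖ ^ 2) • a z = ∫ w in S, a (φ k w) := by
    intro k
    rw [integral_image_eq_integral_abs_det_fderiv_smul volume hSm (hφ.hasFDerivWithinAt hS k)
      (hφ.injOn hS k)]
    exact setIntegral_congr_fun hSm (heq k)
  have h2 : ∀ k, IntegrableOn (fun w => a (φ k w)) S := by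
    intro k
    have := (integrableOn_image_iff_integrableOn_abs_det_fderiv_smul volume hSm
      (hφ.hasFDerivWithinAt hS k) (hφ.injOn hS k) _).1 (hi k)
    exact this.congr_fun (heq k) hSm
  simp_rw [h1]
  rw [← integral_finsetSum _ fun k _ => h2 k]
  exact setIntegral_congr_fun hSm fun w hw => (hφ.fiberSum_eq a (hS hw)).symm

/-- Change of variables for coverings. -/
theorem integral_fiberSum (h : IsHolomorphicCovering N Ω Ω' π) {a : (Fin n → ℂ) → ℂ}
    (ha : Measurable (Ω.indicator a))
    (hi : IntegrableOn (fun z => (‖jacobian π z‖ ^ 2) • a z) Ω) :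
    ∫ z in Ω, (‖jacobian π z‖ ^ 2) • a z = ∫ w in Ω', fiberSum Ω π a w := by
  -- Integrability downstairs comes from the nonnegative change of variables applied to |a|. It is
  -- needed to split the integral over the countable partition.
  have hi' : IntegrableOn (fiberSum Ω π a) Ω' := by
    refine ⟨h.aestronglyMeasurable_fiberSum ha, ?_⟩
    have h1 : Measurable (Ω.indicator fun z => ‖a z‖ₑ) := by
      have : (Ω.indicator fun z => ‖a z‖ₑ) = fun z => ‖Ω.indicator a z‖ₑ := by
        ext z; rw [enorm_indicator_eq_indicator_enorm]
      rw [this]; exact ha.enorm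
    refine lt_of_le_of_lt (setLIntegral_mono' h.isOpen_target.measurableSet
      fun w hw => h.enorm_fiberSum_le a hw) ?_
    rw [← h.lintegral_fiberSum h1]
    refine lt_of_le_of_lt (lintegral_mono fun z => ?_) hi.2
    rw [enorm_smul, enorm_pow, enorm_norm, mul_comm]
  obtain ⟨S, hSm, hSd, hSU, hS⟩ := h.exists_partition
  have h1 : Ω = ⋃ i, Ω ∩ π ⁻¹' S i := by
    rw [← inter_iUnion, ← preimage_iUnion, hSU]
    exact (inter_eq_left.2 h.mapsTo).symm
  have hd : Pairwise (Function.onFun Disjoint fun i => Ω ∩ π ⁻¹' S i) := fun i j hij =>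
    ((hSd hij).preimage π).mono inter_subset_right inter_subset_right
  conv_lhs => rw [h1]
  rw [← hSU, integral_iUnion (fun i => h.measurableSet_preimage (hSm i)) hd (by rwa [← h1]),
    integral_iUnion hSm hSd (by rwa [hSU])]
  congr 1 with i
  obtain ⟨B, hSB, φ, hφ⟩ := hS i
  exact h.setIntegral_preimage hφ hSB (hSm i) (hi.mono_set inter_subset_left)

/-- Preimages of null sets are null sets. -/
theorem volume_preimage_eq_zero (h : IsHolomorphicCovering N Ω Ω' π) {Z : Set (Fin n → ℂ)}
    (hZ : volume Z = 0) : volume (Ω ∩ π ⁻¹' Z) = 0 := by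
  refine measure_null_of_locally_null _ ?_
  rintro z ⟨hz, hzZ⟩
  obtain ⟨B, hwB, -, φ, hφ⟩ := h.exists_branches (π z) (h.mapsTo hz)
  have ho : IsOpen (Ω ∩ π ⁻¹' B) :=
    h.differentiableOn.continuousOn.isOpen_inter_preimage h.isOpen_source hφ.isOpen
  refine ⟨_, inter_mem (mem_nhdsWithin_of_mem_nhds (ho.mem_nhds ⟨hz, hwB⟩)) self_mem_nhdsWithin,
    measure_mono_null (t := ⋃ k, φ k '' (Z ∩ B)) ?_ (measure_iUnion_null fun k => ?_)⟩
  · rw [← hφ.preimage_eq inter_subset_right]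
    rintro x ⟨⟨hx, hxB⟩, -, hxZ⟩
    exact ⟨hx, hxZ, hxB⟩
  · refine addHaar_image_eq_zero_of_differentiableOn_of_addHaar_eq_zero volume
      (fun w hw => (hφ.hasFDerivWithinAt inter_subset_right k w hw).differentiableWithinAt)
      (measure_mono_null inter_subset_left hZ)

/-- The fibre sum of a holomorphic function is holomorphic. -/
theorem differentiableOn_fiberSum (h : IsHolomorphicCovering N Ω Ω' π) {a : (Fin n → ℂ) → ℂ}
    (ha : DifferentiableOn ℂ a Ω) : DifferentiableOn ℂ (fiberSum Ω π a) Ω' := by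
  intro w hw
  obtain ⟨B, hwB, -, φ, hφ⟩ := h.exists_branches w hw
  have h1 : DifferentiableOn ℂ (fun w => ∑ k, a (φ k w)) B :=
    DifferentiableOn.fun_sum fun k _ => ha.comp (hφ.differentiableOn k) (hφ.mapsTo k)
  have h2 : DifferentiableOn ℂ (fiberSum Ω π a) B :=
    h1.congr fun w hw => hφ.fiberSum_eq a hw
  exact (h2.differentiableAt (hφ.isOpen.mem_nhds hwB)).differentiableWithinAt

end IsHolomorphicCovering

/-! ### Pull-back and push-forward on L². -/

theorem measurable_jacobian {n : ℕ} (ψ : (Fin n → ℂ) → (Fin n → ℂ)) : Measurable (jacobian ψ) :=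
  ContinuousLinearMap.continuous_det.measurable.comp (measurable_fderiv ℂ ψ)

theorem measurable_indicator_div_jacobian {n : ℕ} {Ω : Set (Fin n → ℂ)}
    (π : (Fin n → ℂ) → (Fin n → ℂ)) {v : (Fin n → ℂ) → ℂ} (hv : Measurable (Ω.indicator v)) :
    Measurable (Ω.indicator fun z => v z / jacobian π z) := by
  have : (Ω.indicator fun z => v z / jacobian π z) =
      fun z => Ω.indicator v z / jacobian π z := by
    ext z
    by_cases hz : z ∈ Ω <;> simp [hz]
  rw [this]
  exact hv.div (measurable_jacobian π)

theorem memLp_two_iff_lintegral {α : Type*} [MeasurableSpace α] {μ : Measure α} {f : α → ℂ} :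
    MemLp f 2 μ ↔ AEStronglyMeasurable f μ ∧ ∫⁻ x, ‖f x‖ₑ ^ 2 ∂μ < ∞ := by
  rw [MemLp, eLpNorm_lt_top_iff_lintegral_rpow_enorm_lt_top (by norm_num) (by norm_num)]
  simp

namespace IsHolomorphicCovering

variable {n N : ℕ} {Ω Ω' : Set (Fin n → ℂ)} {π : (Fin n → ℂ) → (Fin n → ℂ)}

/-- Preimages of null sets under π are null; this makes composition with π meaningful on
almost-everywhere classes. -/
theorem ae_comp (h : IsHolomorphicCovering N Ω Ω' π) {P : (Fin n → ℂ) → Prop}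
    (hP : ∀ᵐ w ∂volume.restrict Ω', P w) : ∀ᵐ z ∂volume.restrict Ω, P (π z) := by
  rw [ae_restrict_iff' h.isOpen_target.measurableSet, ae_iff] at hP
  rw [ae_restrict_iff' h.isOpen_source.measurableSet, ae_iff]
  refine measure_mono_null ?_ (h.volume_preimage_eq_zero hP)
  intro z hz
  rw [mem_ofPred_eq, Classical.not_imp] at hz
  exact ⟨hz.1, fun hz' => hz.2 (hz' (h.mapsTo hz.1))⟩

theorem aemeasurable (h : IsHolomorphicCovering N Ω Ω' π) :
    AEMeasurable π (volume.restrict Ω) :=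
  h.differentiableOn.continuousOn.aemeasurable h.isOpen_source.measurableSet

theorem measurable_indicator_comp (h : IsHolomorphicCovering N Ω Ω' π) {M : Type*} [Zero M]
    [MeasurableSpace M] {b : (Fin n → ℂ) → M} (hb : Measurable b) :
    Measurable (Ω.indicator fun z => b (π z)) := by
  classical
  have h1 : Measurable (Ω.piecewise π 0) := h.differentiableOn.continuousOn.measurable_piecewise
    continuous_zero.continuousOn h.isOpen_source.measurableSet
  have h2 : (Ω.indicator fun z => b (π z)) = Ω.indicator (b ∘ Ω.piecewise π 0) :=
    indicator_congr fun z hz => by rw [Function.comp_apply, piecewise_eq_of_mem _ _ _ hz]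
  rw [h2]
  exact (hb.comp h1).indicator h.isOpen_source.measurableSet

/-- Integrals of pull-backs. -/
theorem lintegral_comp_mul (h : IsHolomorphicCovering N Ω Ω' π) {b : (Fin n → ℂ) → ℝ≥0∞}
    (hb : AEMeasurable b (volume.restrict Ω')) :
    ∫⁻ z in Ω, b (π z) * ‖jacobian π z‖ₑ ^ 2 = N * ∫⁻ w in Ω', b w := by
  have h1 : ∫⁻ z in Ω, b (π z) * ‖jacobian π z‖ₑ ^ 2 =
      ∫⁻ z in Ω, hb.mk b (π z) * ‖jacobian π z‖ₑ ^ 2 := by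
    refine lintegral_congr_ae ?_
    filter_upwards [h.ae_comp hb.ae_eq_mk] with z hz
    rw [hz]
  rw [h1, h.lintegral_fiberSum (h.measurable_indicator_comp hb.measurable_mk),
    lintegral_congr_ae hb.ae_eq_mk, ← lintegral_const_mul _ hb.measurable_mk]
  exact setLIntegral_congr_fun h.isOpen_target.measurableSet fun w hw => h.fiberSum_comp _ hw

theorem pullback_congr (h : IsHolomorphicCovering N Ω Ω' π) {u u' : (Fin n → ℂ) → ℂ}
    (hu : u =ᵐ[volume.restrict Ω'] u') :
    pullback π u =ᵐ[volume.restrict Ω] pullback π u' := by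
  filter_upwards [h.ae_comp hu] with z hz
  rw [pullback, pullback, hz]

theorem aestronglyMeasurable_pullback (h : IsHolomorphicCovering N Ω Ω' π)
    {u : (Fin n → ℂ) → ℂ} (hu : AEStronglyMeasurable u (volume.restrict Ω')) :
    AEStronglyMeasurable (pullback π u) (volume.restrict Ω) := by
  refine AEStronglyMeasurable.congr ?_ (h.pullback_congr hu.ae_eq_mk).symm
  exact ((measurable_jacobian π).aemeasurable.mul
    (hu.stronglyMeasurable_mk.measurable.comp_aemeasurable h.aemeasurable)).aestronglyMeasurable

theorem memLp_pullback (h : IsHolomorphicCovering N Ω Ω' π) {u : (Fin n → ℂ) → ℂ}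
    (hu : MemLp u 2 (volume.restrict Ω')) : MemLp (pullback π u) 2 (volume.restrict Ω) := by
  rw [memLp_two_iff_lintegral] at hu ⊢
  refine ⟨h.aestronglyMeasurable_pullback hu.1, ?_⟩
  have h1 := h.lintegral_comp_mul (hu.1.enorm.pow_const 2)
  have h2 : ∫⁻ z in Ω, ‖pullback π u z‖ₑ ^ 2 = N * ∫⁻ w in Ω', ‖u w‖ₑ ^ 2 := by
    rw [← h1]
    refine lintegral_congr fun z => ?_
    rw [pullback, enorm_mul, mul_pow, mul_comm]
  rw [h2]
  exact ENNReal.mul_lt_top (ENNReal.natCast_lt_top N) hu.2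

/-- The weight completes |J|^p to |J|², the density of the change of variables. Since 2 - p may be
negative, this uses that J(π) has no zeros on Ω. -/
theorem lintegral_pullback_mul_weight (h : IsHolomorphicCovering N Ω Ω' π)
    {u : (Fin n → ℂ) → ℂ} (hu : AEStronglyMeasurable u (volume.restrict Ω')) {p : ℝ}
    (hp : 0 ≤ p) :
    ∫⁻ z in Ω, ‖pullback π u z‖ₑ ^ p * jacobianWeight π p z = N * ∫⁻ w in Ω', ‖u w‖ₑ ^ p := by
  rw [← h.lintegral_comp_mul (hu.enorm.pow_const p)]
  refine setLIntegral_congr_fun h.isOpen_source.measurableSet fun z hz => ?_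
  have h0 : ‖jacobian π z‖ₑ ≠ 0 := enorm_ne_zero.2 (h.jacobian_ne_zero hz)
  have h1 : ‖jacobian π z‖ₑ ^ p * ‖jacobian π z‖ₑ ^ (2 - p) = ‖jacobian π z‖ₑ ^ 2 := by
    rw [← ENNReal.rpow_add _ _ h0 enorm_ne_top, ← ENNReal.rpow_natCast]
    congr 1
    push_cast
    ring
  rw [pullback, jacobianWeight, enorm_mul, ENNReal.mul_rpow_of_nonneg _ _ hp, ← h1]
  ring

/-- The `L²` bound for the push-forward `v ↦ ∑ v / J(π)` along the fibres. -/
theorem lintegral_pushforward_le (h : IsHolomorphicCovering N Ω Ω' π) {v : (Fin n → ℂ) → ℂ}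
    (hv : Measurable (Ω.indicator v)) :
    ∫⁻ w in Ω', ‖fiberSum Ω π (fun z => v z / jacobian π z) w‖ₑ ^ 2 ≤
      N * ∫⁻ z in Ω, ‖v z‖ₑ ^ 2 := by
  have hm : Measurable (Ω.indicator fun z => ‖v z / jacobian π z‖ₑ ^ 2) := by
    have : (Ω.indicator fun z => ‖v z / jacobian π z‖ₑ ^ 2) =
        fun z => ‖Ω.indicator (fun z => v z / jacobian π z) z‖ₑ ^ 2 := by
      ext z
      by_cases hz : z ∈ Ω <;> simp [hz]
    rw [this]
    exact (measurable_indicator_div_jacobian π hv).enorm.pow_const 2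
  -- Writing v = (v/J)·J produces the density |J|², so the integral descends to the fibre sum of
  -- |v/J|², where Cauchy–Schwarz supplies the factor `N`.
  have h1 : ∫⁻ z in Ω, ‖v z‖ₑ ^ 2 =
      ∫⁻ z in Ω, ‖v z / jacobian π z‖ₑ ^ 2 * ‖jacobian π z‖ₑ ^ 2 := by
    refine setLIntegral_congr_fun h.isOpen_source.measurableSet fun z hz => ?_
    rw [← mul_pow, ← enorm_mul, div_mul_cancel₀ _ (h.jacobian_ne_zero hz)]
  rw [h1, h.lintegral_fiberSum hm, ← lintegral_const_mul' _ _ (ENNReal.natCast_ne_top N)]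
  exact setLIntegral_mono' h.isOpen_target.measurableSet fun w hw => h.enorm_sq_fiberSum_le _ hw

theorem memLp_pushforward (h : IsHolomorphicCovering N Ω Ω' π) {v : (Fin n → ℂ) → ℂ}
    (hv : Measurable (Ω.indicator v)) (hv2 : ∫⁻ z in Ω, ‖v z‖ₑ ^ 2 < ∞) :
    MemLp (fiberSum Ω π fun z => v z / jacobian π z) 2 (volume.restrict Ω') :=
  memLp_two_iff_lintegral.2
    ⟨h.aestronglyMeasurable_fiberSum (measurable_indicator_div_jacobian π hv),
      (h.lintegral_pushforward_le hv).trans_lt (ENNReal.mul_lt_top (ENNReal.natCast_lt_top N) hv2)⟩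

/-- The push-forward is adjoint to the pull-back. -/
theorem integral_inner_pullback (h : IsHolomorphicCovering N Ω Ω' π) {u v : (Fin n → ℂ) → ℂ}
    (hu : Measurable u) (hv : Measurable (Ω.indicator v))
    (hi : IntegrableOn (fun z => inner ℂ (pullback π u z) (v z)) Ω) :
    ∫ z in Ω, inner ℂ (pullback π u z) (v z) =
      ∫ w in Ω', inner ℂ (u w) (fiberSum Ω π (fun z => v z / jacobian π z) w) := by
  set a : (Fin n → ℂ) → ℂ := fun z => (starRingEnd ℂ) (u (π z)) * (v z / jacobian π z) with ha
  -- The conjugate of J times v is |J|² times v/J; this is where the quotient in the push-forward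
  -- comes from.
  have heq : EqOn (fun z => inner ℂ (pullback π u z) (v z))
      (fun z => (‖jacobian π z‖ ^ 2) • a z) Ω := by
    intro z hz
    have hJ := h.jacobian_ne_zero hz
    simp only [RCLike.inner_apply', pullback, map_mul, ha, Complex.real_smul]
    rw [Complex.ofReal_pow, ← Complex.conj_mul']
    field_simp
  have ham : Measurable (Ω.indicator a) := by
    have h1 := (h.measurable_indicator_comp (Complex.continuous_conj.measurable.comp hu)).mul
      (measurable_indicator_div_jacobian π hv)
    rw [ha, indicator_mul]
    exact h1
  have hm := h.isOpen_source.measurableSet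
  rw [setIntegral_congr_fun hm heq, h.integral_fiberSum ham (hi.congr_fun heq hm)]
  refine setIntegral_congr_fun h.isOpen_target.measurableSet fun w hw => ?_
  rw [RCLike.inner_apply']
  exact h.fiberSum_mul_comp (fun w => (starRingEnd ℂ) (u w)) _ hw

end IsHolomorphicCovering

/-! ### Bergman projections under ramified coverings. -/

theorem volume_restrict_sdiff_eq {n : ℕ} {E V : Set (Fin n → ℂ)} (hE : IsBoundedDomain E)
    (hV : IsAnalyticSubset E V) (hVE : V ≠ E) :
    volume.restrict (E \ V) = volume.restrict E :=
  Measure.restrict_congr_set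
    (sdiff_null_ae_eq_self (hV.volume_eq_zero hE.isConnected.isPreconnected hVE))

/-- A square-integrable function which is holomorphic off a proper analytic subset defines an
element of the Bergman space. -/
theorem toLp_mem_bergmanSpace {n : ℕ} {E V : Set (Fin n → ℂ)} (hE : IsBoundedDomain E)
    (hV : IsAnalyticSubset E V) (hVE : V ≠ E) {F : (Fin n → ℂ) → ℂ}
    (hF : DifferentiableOn ℂ F (E \ V)) {f : (Fin n → ℂ) → ℂ} (hf : MemLp f 2 (volume.restrict E))
    (hfF : f =ᵐ[volume.restrict E] F) : hf.toLp f ∈ bergmanSpace E := by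
  have hres := volume_restrict_sdiff_eq hE hV hVE
  have hL : ∫⁻ z in E \ V, ‖F z‖ₑ ^ 2 ≠ ∞ := by
    rw [hres]
    exact (memLp_two_iff_lintegral.1 ((memLp_congr_ae hfF).1 hf)).2.ne
  obtain ⟨G, hG, hGF⟩ := exists_extension_of_lintegral_ne_top hE.isOpen
    hE.isConnected.isPreconnected hV hVE hF hL
  refine ⟨G, hG, hf.coeFn_toLp.trans (hfF.trans ?_)⟩
  rw [← hres]
  filter_upwards [ae_restrict_mem hV.isOpen_diff.measurableSet] with z hz
  exact (hGF hz).symm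

theorem lp_two_inner_eq_setIntegral {n : ℕ} {E : Set (Fin n → ℂ)}
    (f g : Lp ℂ 2 (volume.restrict E)) {F G : (Fin n → ℂ) → ℂ} (hf : f =ᵐ[volume.restrict E] F)
    (hg : g =ᵐ[volume.restrict E] G) :
    Integrable (fun z => inner ℂ (F z) (G z)) (volume.restrict E) ∧
      inner ℂ f g = ∫ z in E, inner ℂ (F z) (G z) := by
  have h1 : (fun z => inner ℂ (f z) (g z)) =ᵐ[volume.restrict E]
      fun z => inner ℂ (F z) (G z) := by
    filter_upwards [hf, hg] with z h1 h2
    rw [h1, h2]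
  exact ⟨(L2.integrable_inner f g).congr h1, (L2.inner_def f g).trans (integral_congr_ae h1)⟩

namespace IsRamifiedCovering

variable {n : ℕ} {E V D W : Set (Fin n → ℂ)} {π : (Fin n → ℂ) → (Fin n → ℂ)}

theorem restrict_source (hπ : IsRamifiedCovering E V D W π) :
    volume.restrict (E \ V) = volume.restrict E :=
  volume_restrict_sdiff_eq hπ.domain_source hπ.analytic_source hπ.proper_source

theorem restrict_target (hπ : IsRamifiedCovering E V D W π) :
    volume.restrict (D \ W) = volume.restrict D :=
  volume_restrict_sdiff_eq hπ.domain_target hπ.analytic_target hπ.proper_target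

theorem pullback_congr (hπ : IsRamifiedCovering E V D W π) {u u' : (Fin n → ℂ) → ℂ}
    (hu : u =ᵐ[volume.restrict D] u') : pullback π u =ᵐ[volume.restrict E] pullback π u' := by
  obtain ⟨N, -, h⟩ := hπ.exists_isHolomorphicCovering
  rw [← hπ.restrict_target] at hu
  rw [← hπ.restrict_source]
  exact h.pullback_congr hu

theorem memLp_pullback (hπ : IsRamifiedCovering E V D W π) {u : (Fin n → ℂ) → ℂ}
    (hu : MemLp u 2 (volume.restrict D)) : MemLp (pullback π u) 2 (volume.restrict E) := by
  obtain ⟨N, -, h⟩ := hπ.exists_isHolomorphicCovering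
  rw [← hπ.restrict_target] at hu
  rw [← hπ.restrict_source]
  exact h.memLp_pullback hu

/-- `N` is the number of sheets and does not depend on p, u or v. It can therefore be cancelled when
the identity is used for a function and for its projection. -/
theorem lintegral_pullback_mul_weight (hπ : IsRamifiedCovering E V D W π) :
    ∃ N : ℝ≥0∞, N ≠ 0 ∧ N ≠ ∞ ∧ ∀ p : ℝ, 0 ≤ p →
      ∀ u v : (Fin n → ℂ) → ℂ, AEStronglyMeasurable u (volume.restrict D) →
        v =ᵐ[volume.restrict E] pullback π u →
        ∫⁻ z in E, ‖v z‖ₑ ^ p * jacobianWeight π p z = N * ∫⁻ w in D, ‖u w‖ₑ ^ p := by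
  obtain ⟨N, hN, h⟩ := hπ.exists_isHolomorphicCovering
  refine ⟨N, by exact_mod_cast hN, ENNReal.natCast_ne_top N, fun p hp u v hu huv => ?_⟩
  have h1 : ∫⁻ z in E, ‖v z‖ₑ ^ p * jacobianWeight π p z =
      ∫⁻ z in E, ‖pullback π u z‖ₑ ^ p * jacobianWeight π p z := by
    refine lintegral_congr_ae ?_
    filter_upwards [huv] with z hz
    rw [hz]
  rw [h1, ← hπ.restrict_source, ← hπ.restrict_target]
  refine h.lintegral_pullback_mul_weight ?_ hp
  rwa [hπ.restrict_target]

/-- The pull-back intertwines the Bergman projections. -/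
theorem bergmanProjection_pullback (hπ : IsRamifiedCovering E V D W π)
    (u : Lp ℂ 2 (volume.restrict D)) (v : Lp ℂ 2 (volume.restrict E))
    (huv : v =ᵐ[volume.restrict E] pullback π u) :
    bergmanProjection E hπ.domain_source.isOpen v =ᵐ[volume.restrict E]
      pullback π (bergmanProjection D hπ.domain_target.isOpen u) := by
  obtain ⟨N, -, h⟩ := hπ.exists_isHolomorphicCovering
  have hcE : CompleteSpace (bergmanSpace E) :=
    (isClosed_bergmanSpace hπ.domain_source.isOpen).completeSpace_coe
  have hcD : CompleteSpace (bergmanSpace D) :=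
    (isClosed_bergmanSpace hπ.domain_target.isOpen).completeSpace_coe
  set f := (bergmanSpace D).starProjection u with hf
  have hPD : bergmanProjection D hπ.domain_target.isOpen u = f := rfl
  obtain ⟨F, hF, hfF⟩ : f ∈ bergmanSpace D := Submodule.starProjection_apply_mem _ u
  have hm : MemLp (pullback π f) 2 (volume.restrict E) := hπ.memLp_pullback (Lp.memLp f)
  -- J(π)·(F ∘ π) is known to be holomorphic only off V; square integrability carries it across.
  have hg : hm.toLp _ ∈ bergmanSpace E := by
    refine toLp_mem_bergmanSpace hπ.domain_source hπ.analytic_source hπ.proper_source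
      (F := pullback π F) ?_ hm (hπ.pullback_congr hfF)
    exact (differentiableOn_jacobian h.isOpen_source h.differentiableOn).mul
      ((hF.mono sdiff_subset).comp h.differentiableOn h.mapsTo)
  have hP : (bergmanSpace E).starProjection v = hm.toLp _ := by
    -- The remainder is the pull-back of u - f. Its pairing with k equals the pairing of u - f with
    -- the push-forward of k, which is zero because that push-forward is square integrable and
    -- holomorphic off W, hence in A²(D).
    refine Submodule.eq_starProjection_of_mem_of_inner_eq_zero hg fun k hk => ?_
    obtain ⟨K, hK, hkK⟩ := hk
    have hKΩ : DifferentiableOn ℂ K (E \ V) := hK.mono sdiff_subset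
    have hKm : Measurable ((E \ V).indicator K) := by
      classical
      rw [← piecewise_eq_indicator]
      exact hKΩ.continuousOn.measurable_piecewise continuous_zero.continuousOn
        h.isOpen_source.measurableSet
    have hK2 : ∫⁻ z in E \ V, ‖K z‖ₑ ^ 2 < ∞ := by
      rw [hπ.restrict_source]
      exact (memLp_two_iff_lintegral.1 ((memLp_congr_ae hkK).1 (Lp.memLp k))).2
    have hK' := h.memLp_pushforward hKm hK2
    rw [hπ.restrict_target] at hK'
    have hdiv : DifferentiableOn ℂ (fun z => K z / jacobian π z) (E \ V) := by
      simp only [div_eq_mul_inv]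
      exact hKΩ.mul ((differentiableOn_jacobian h.isOpen_source h.differentiableOn).inv
        fun z hz => h.jacobian_ne_zero hz)
    have hq : hK'.toLp _ ∈ bergmanSpace D :=
      toLp_mem_bergmanSpace hπ.domain_target hπ.analytic_target hπ.proper_target
        (h.differentiableOn_fiberSum hdiv) hK' ae_eq_rfl
    have hperp := Submodule.starProjection_inner_eq_zero (K := bergmanSpace D) u _ hq
    have hdiff : ((v - hm.toLp _ : Lp ℂ 2 (volume.restrict E)) : (Fin n → ℂ) → ℂ)
        =ᵐ[volume.restrict E] pullback π (u - f : Lp ℂ 2 (volume.restrict D)) := by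
      refine EventuallyEq.trans ?_ (hπ.pullback_congr (Lp.coeFn_sub u f)).symm
      filter_upwards [Lp.coeFn_sub v (hm.toLp _), huv, hm.coeFn_toLp] with z h1 h2 h3
      rw [h1, Pi.sub_apply, h2, h3]
      simp only [pullback, Pi.sub_apply, mul_sub]
    obtain ⟨hi, he⟩ := lp_two_inner_eq_setIntegral _ k hdiff hkK
    rw [he, ← hπ.restrict_source, h.integral_inner_pullback
      (Lp.stronglyMeasurable _).measurable hKm (by rwa [IntegrableOn, hπ.restrict_source]),
      hπ.restrict_target, ← hperp]
    exact (lp_two_inner_eq_setIntegral _ _ ae_eq_rfl hK'.coeFn_toLp).2.symm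
  have hPE : bergmanProjection E hπ.domain_source.isOpen v = hm.toLp _ := hP
  rw [hPE, hPD]
  exact hm.coeFn_toLp

theorem exists_lp_pullback (hπ : IsRamifiedCovering E V D W π)
    {v : Lp ℂ 2 (volume.restrict E)} (hv : v ∈ pullbackL2 E D π) :
    ∃ u : Lp ℂ 2 (volume.restrict D), v =ᵐ[volume.restrict E] pullback π u := by
  obtain ⟨u, hu, huv⟩ := hv
  exact ⟨hu.toLp u, huv.trans (hπ.pullback_congr hu.coeFn_toLp.symm)⟩

end IsRamifiedCovering

/-! ### The covering group and invariant functions. -/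

section CoveringGroup

variable {n N : ℕ} {Ω Ω' : Set (Fin n → ℂ)} {π : (Fin n → ℂ) → (Fin n → ℂ)}

theorem mapsTo_ambientMap (g : Equiv.Perm Ω) : MapsTo (ambientMap g) Ω Ω := fun z hz => by
  rw [ambientMap_apply g hz]
  exact (g ⟨z, hz⟩).2

/-- The preimage of a null set under g is its image under the differentiable map g⁻¹, hence null. -/
theorem ae_comp_ambientMap (hΩ : IsOpen Ω) {g : Equiv.Perm Ω} (hg : g ∈ coveringGroup Ω π)
    {P : (Fin n → ℂ) → Prop} (hP : ∀ᵐ z ∂volume.restrict Ω, P z) :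
    ∀ᵐ z ∂volume.restrict Ω, P (ambientMap g z) := by
  rw [ae_restrict_iff' hΩ.measurableSet, ae_iff] at hP ⊢
  have h1 : DifferentiableOn ℝ (ambientMap g⁻¹) ({z | ¬(z ∈ Ω → P z)}) :=
    (hg.2.1.restrictScalars ℝ).mono fun z hz => by
      rw [mem_ofPred_eq, Classical.not_imp] at hz
      exact hz.1
  refine measure_mono_null ?_
    (addHaar_image_eq_zero_of_differentiableOn_of_addHaar_eq_zero volume h1 hP)
  intro z hz
  rw [mem_ofPred_eq, Classical.not_imp] at hz
  have hgz := mapsTo_ambientMap g hz.1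
  refine ⟨ambientMap g z, fun h => hz.2 (h hgz), ?_⟩
  rw [ambientMap_apply g⁻¹ hgz]
  simp [ambientMap_apply g hz.1]

/-- The chain rule applied to π ∘ g = π. -/
theorem jacobian_ambientMap_mul (hΩ : IsOpen Ω) (hπ : DifferentiableOn ℂ π Ω) {g : Equiv.Perm Ω}
    (hg : g ∈ coveringGroup Ω π) {z : Fin n → ℂ} (hz : z ∈ Ω) :
    jacobian π (ambientMap g z) * jacobian (ambientMap g) z = jacobian π z := by
  have hgz := mapsTo_ambientMap g hz
  rw [← jacobian_comp ((hπ _ hgz).differentiableAt (hΩ.mem_nhds hgz))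
    ((hg.1 z hz).differentiableAt (hΩ.mem_nhds hz))]
  refine jacobian_congr ?_
  filter_upwards [hΩ.mem_nhds hz] with w hw
  rw [Function.comp_apply, ambientMap_apply g hw, hg.2.2]

/-- An element of the covering group of a connected covering is determined by one value. -/
theorem coveringGroup_ext (hΩ : IsPreconnected Ω) (hm : MapsTo π Ω Ω')
    (hc : IsCoveringMap (hm.restrict π Ω Ω')) {g g' : Equiv.Perm Ω} (hg : g ∈ coveringGroup Ω π)
    (hg' : g' ∈ coveringGroup Ω π) (z : Ω) (h : g z = g' z) : g = g' := by
  have hcont : ∀ f ∈ coveringGroup Ω π, Continuous f := by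
    intro f hf
    refine continuous_induced_rng.2 ?_
    have h1 := continuousOn_iff_continuous_domRestrict.1 hf.1.continuousOn
    refine h1.congr fun x => ?_
    exact ambientMap_apply f x.2
  have : PreconnectedSpace Ω := isPreconnected_iff_preconnectedSpace.1 hΩ
  refine DFunLike.coe_injective (hc.eq_of_comp_eq (hcont g hg) (hcont g' hg') ?_ z h)
  ext1 x
  refine Subtype.ext ?_
  change π (g x) = π (g' x)
  rw [hg.2.2, hg'.2.2]

/-- By uniqueness of lifts, evaluation at z embeds the group into the finite fibre through z. -/
theorem finite_coveringGroup (hΩ : IsPreconnected Ω) (hm : MapsTo π Ω Ω')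
    (hc : IsCoveringMap (hm.restrict π Ω Ω')) (z : Ω)
    (hfin : {w | w ∈ Ω ∧ π w = π z}.Finite) : Finite (coveringGroup Ω π) := by
  have := hfin.to_subtype
  refine Finite.of_injective
    (fun g : coveringGroup Ω π => (⟨(g : Equiv.Perm Ω) z, ((g : Equiv.Perm Ω) z).2, g.2.2.2 z⟩ :
      {w | w ∈ Ω ∧ π w = π z})) fun g g' hgg' => ?_
  refine Subtype.ext (coveringGroup_ext hΩ hm hc g.2 g'.2 z (Subtype.ext ?_))
  simpa only [Subtype.mk.injEq] using hgg'

end CoveringGroup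

namespace IsRamifiedCovering

variable {n : ℕ} {E V D W : Set (Fin n → ℂ)} {π : (Fin n → ℂ) → (Fin n → ℂ)}

theorem pullback_ambientMap_eq (hπ : IsRamifiedCovering E V D W π)
    {u v : (Fin n → ℂ) → ℂ} (huv : v =ᵐ[volume.restrict E] pullback π u)
    {g : Equiv.Perm (E \ V : Set (Fin n → ℂ))} (hg : g ∈ coveringGroup (E \ V) π) :
    pullback (ambientMap g) v =ᵐ[volume.restrict E] v := by
  have hΩ := hπ.analytic_source.isOpen_diff
  rw [← hπ.restrict_source] at huv ⊢
  filter_upwards [huv, ae_comp_ambientMap hΩ hg huv, ae_restrict_mem hΩ.measurableSet]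
    with z h1 h2 hz
  have h3 : π (ambientMap g z) = π z := by rw [ambientMap_apply g hz, hg.2.2]
  rw [pullback, h2, h1, pullback, pullback, ← jacobian_ambientMap_mul hΩ hπ.holomorphic hg hz, h3]
  ring

theorem finite_coveringGroup (hπ : IsRamifiedCovering E V D W π) :
    Finite (coveringGroup (E \ V) π) := by
  obtain ⟨N, hN, h⟩ := hπ.exists_isHolomorphicCovering
  obtain ⟨w, hw⟩ := h.nonempty
  obtain ⟨z, hz, hzw⟩ := hπ.surjOn hw
  refine _root_.finite_coveringGroup (hπ.analytic_source.isPreconnected_diff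
    hπ.domain_source.isOpen hπ.domain_source.isConnected.isPreconnected hπ.proper_source)
    hπ.mapsTo hπ.isCoveringMap ⟨z, hz⟩ (hπ.finite_fibers _ (hπ.mapsTo hz))

/-- Invariance of v means invariance of v/J(π) under the group. Normality makes this quotient
constant on almost every fibre, so it is the pull-back of its fibre average u, the push-forward of v
divided by `N`. -/
theorem exists_eq_pullback_of_invariant (hπ : IsRamifiedCovering E V D W π)
    (hn : IsNormalCovering (E \ V) π) {v : (Fin n → ℂ) → ℂ} (hvm : Measurable v)
    (hv2 : MemLp v 2 (volume.restrict E))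
    (hv : ∀ g ∈ coveringGroup (E \ V) π, pullback (ambientMap g) v =ᵐ[volume.restrict E] v) :
    ∃ u, MemLp u 2 (volume.restrict D) ∧ v =ᵐ[volume.restrict E] pullback π u := by
  obtain ⟨N, hN, h⟩ := hπ.exists_isHolomorphicCovering
  rw [← hπ.restrict_source] at hv hv2 ⊢
  have hm := h.memLp_pushforward (hvm.indicator h.isOpen_source.measurableSet)
    (memLp_two_iff_lintegral.1 hv2).2
  rw [hπ.restrict_target] at hm
  refine ⟨_, hm.const_smul ((N : ℂ)⁻¹), ?_⟩
  have := hπ.finite_coveringGroup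
  -- Finiteness of the group allows one exceptional null set for all g together.
  have hall : ∀ᵐ z ∂volume.restrict (E \ V), ∀ g : coveringGroup (E \ V) π,
      pullback (ambientMap g.1) v z = v z := ae_all_iff.2 fun g => hv g g.2
  filter_upwards [hall, ae_restrict_mem h.isOpen_source.measurableSet] with z hz hzΩ
  obtain ⟨p, hp, -, hsum, -⟩ := h.fiberSum_eq_sum (h.mapsTo hzΩ)
  have hJ := h.jacobian_ne_zero hzΩ
  have hconst : ∀ k, v (p k) / jacobian π (p k) = v z / jacobian π z := by
    intro k
    obtain ⟨g, hg, hgz⟩ := (hn ⟨z, hzΩ⟩ ⟨p k, (hp k).1⟩).1 (hp k).2.symm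
    have h1 := hz ⟨g, hg⟩
    have h2 := jacobian_ambientMap_mul h.isOpen_source h.differentiableOn hg hzΩ
    have h3 : ambientMap g z = p k := by rw [ambientMap_apply g hzΩ, hgz]
    simp only [pullback, h3] at h1 h2
    rw [div_eq_div_iff (h.jacobian_ne_zero (hp k).1) hJ, ← h1, ← h2]
    ring
  rw [pullback, Pi.smul_apply, hsum, Finset.sum_congr rfl fun k _ => hconst k]
  have hN' : (N : ℂ) ≠ 0 := by exact_mod_cast hN
  simp only [Finset.sum_const, Finset.card_univ, Fintype.card_fin, nsmul_eq_mul, smul_eq_mul]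
  field_simp

end IsRamifiedCovering

/-! ### Conclusion. -/

theorem proposition1p3 {n : ℕ} {E V D W : Set (Fin n → ℂ)} {π : (Fin n → ℂ) → (Fin n → ℂ)}
    (hπ : IsRamifiedCovering E V D W π) :
    -- the pull-back `u ↦ J(π) · (u ∘ π)` is well defined from `L²(D)` to `L²(E)`
    ((∀ u u' : (Fin n → ℂ) → ℂ, u =ᵐ[volume.restrict D] u' →
        pullback π u =ᵐ[volume.restrict E] pullback π u') ∧
      (∀ u : (Fin n → ℂ) → ℂ, MemLp u 2 (volume.restrict D) →
        MemLp (pullback π u) 2 (volume.restrict E))) ∧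
    -- lifting of the `L^p` estimate, with the same constant
    (∀ p : ℝ, 1 ≤ p → ∀ C : ℝ, 0 < C →
      ((∀ u : Lp ℂ 2 (volume.restrict D), ∫⁻ z in D, ‖u z‖ₑ ^ p < ∞ →
          ∫⁻ z in D, ‖bergmanProjection D hπ.domain_target.isOpen u z‖ₑ ^ p ≤
            ENNReal.ofReal C * ∫⁻ z in D, ‖u z‖ₑ ^ p) ↔
        (∀ v ∈ pullbackL2 E D π, ∫⁻ z in E, ‖v z‖ₑ ^ p * jacobianWeight π p z < ∞ →
          ∫⁻ z in E, ‖bergmanProjection E hπ.domain_source.isOpen v z‖ₑ ^ p *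
              jacobianWeight π p z ≤
            ENNReal.ofReal C * ∫⁻ z in E, ‖v z‖ₑ ^ p * jacobianWeight π p z))) ∧
    -- description of `π^*(L²(D))` for normal coverings
    (IsNormalCovering (E \ V) π →
      pullbackL2 E D π = {v : Lp ℂ 2 (volume.restrict E) |
        ∀ g ∈ coveringGroup (E \ V) π,
          pullback (ambientMap g) v =ᵐ[volume.restrict E] v}) := by
  refine ⟨⟨fun u u' hu => hπ.pullback_congr hu, fun u hu => hπ.memLp_pullback hu⟩,
    fun p hp C hC => ?_, fun hn => ?_⟩
  · obtain ⟨N, hN0, hNt, hN⟩ := hπ.lintegral_pullback_mul_weight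
    have hp0 : 0 ≤ p := zero_le_one.trans hp
    -- Each integral over E is `N` times its counterpart over D, for v and, by the intertwining, for
    -- its projection. As `N` is neither 0 nor ∞, finiteness and the inequality transfer with the
    -- same C.
    have key : ∀ (u : Lp ℂ 2 (volume.restrict D)) (v : Lp ℂ 2 (volume.restrict E)),
        v =ᵐ[volume.restrict E] pullback π u →
        ((∫⁻ z in E, ‖v z‖ₑ ^ p * jacobianWeight π p z < ∞ ↔ ∫⁻ z in D, ‖u z‖ₑ ^ p < ∞) ∧
        (∫⁻ z in E, ‖bergmanProjection E hπ.domain_source.isOpen v z‖ₑ ^ p *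
              jacobianWeight π p z ≤
            ENNReal.ofReal C * ∫⁻ z in E, ‖v z‖ₑ ^ p * jacobianWeight π p z ↔
          ∫⁻ z in D, ‖bergmanProjection D hπ.domain_target.isOpen u z‖ₑ ^ p ≤
            ENNReal.ofReal C * ∫⁻ z in D, ‖u z‖ₑ ^ p)) := by
      intro u v huv
      rw [hN p hp0 u v (Lp.aestronglyMeasurable u) huv,
        hN p hp0 _ _ (Lp.aestronglyMeasurable _) (hπ.bergmanProjection_pullback u v huv),
        mul_left_comm, ENNReal.mul_le_mul_iff_right hN0 hNt]
      refine ⟨⟨fun h => ?_, fun h => ENNReal.mul_lt_top hNt.lt_top h⟩, Iff.rfl⟩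
      exact ENNReal.lt_top_of_mul_ne_top_right h.ne hN0
    constructor
    · intro H v hv hvp
      obtain ⟨u, huv⟩ := hπ.exists_lp_pullback hv
      obtain ⟨h1, h2⟩ := key u v huv
      exact h2.2 (H u (h1.1 hvp))
    · intro H u hup
      have hm := hπ.memLp_pullback (Lp.memLp u)
      obtain ⟨h1, h2⟩ := key u (hm.toLp _) hm.coeFn_toLp
      exact h2.1 (H _ ⟨u, Lp.memLp u, hm.coeFn_toLp⟩ (h1.2 hup))
  · ext v
    exact ⟨fun ⟨u, _, huv⟩ g hg => hπ.pullback_ambientMap_eq huv hg,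
      fun hv => hπ.exists_eq_pullback_of_invariant hn
        (Lp.stronglyMeasurable v).measurable (Lp.memLp v) hv⟩
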